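/- Let $\mathbb F$ be a field; algebras are associative unital $\mathbb F$-algebras and $\otimes=\otimes_{\mathbb F}$. **Definitions.** For an algebra $H$ put $\widehat H=\mathrm{Hom}_{\mathbb F\text{-alg}}(H,\mathbb F)$. A *regular triangular algebra* (RTA) is a nonzero algebra $A$ with unital subalgebras $B^\pm$, $H_0\subset H_1$, a submonoid $Q_0^+\subset\mathrm{Aut}_{\mathbb F\text{-alg}}(H_0)$ and a linear map $i:A\to A$ such that: (RTA1) multiplication $B^-\otimes H_1\otimes B^+\to A$ is bijective; (RTA2) $Q_0^+\setminus\{\mathrm{id}\}$ is a semigroup, and $B^+=\bigoplus_{\theta\in Q_1^+}B^+_\theta$, where $Q_1^+$ is the set of $\theta\in\mathrm{Aut}_{\mathbb F\text{-alg}}(H_1)$ restricting to an element of $Q_0^+$ and, for an automorphism $\theta$ of $H_r$, $B^+_\theta=\{b\in B^+: bh=\theta(h)b\ \forall h\in H_r\}$; moreover $B^+_{\mathrm{id}_{H_0}}=\mathbb F\cdot 1$ and $\dim B^+_{\theta}<\infty$ for all $\theta\in Q_0^+$; (RTA3) $i$ is an anti-involution of the algebra $A$, fixes $H_1$ pointwise,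 and $i(B^\pm)\subset H_1B^\mp$. It is *strict* if $H_1=H_0$; *based* if $Q_0^+=\mathbb Z_{\ge0}\Delta$ for a pairwise commuting, $\mathbb Z$-linearly independent $\Delta\subset Q_0^+$; *discretely graded* if for each $\theta\in Q_0^+$ the interval $[\mathrm{id},\theta]$ in $Q_0^+$ is finite, where $\theta'\le\theta$ iff $\theta\in Q_0^+\theta'$. A *Hopf RTA* is given by the same data and conditions, except that $H_1$ is a Hopf algebra, $H_0$ a Hopf subalgebra, and $Q_0^+$ is replaced by a submonoid $Q_0'^+\subset\widehat{H_0}$ (under convolution) with $Q_0'^+\setminus\{\varepsilon\}$ a semigroup, root spaces being replaced by weight spaces for the adjoint action $\mathrm{ad}\,h(a)=\sum h_{(1)}aS(h_{(2)})$ (and $Q_1^+$ by the set of $\mu\in\widehat{H_1}$ with $\mu|_{H_0}\in Q_0'^+$); strict, based and discretely graded are defined in the same way. A Hopf RTA has underlying RTA data with $Q_0^+=\{\rho(\mu):\mu\in Q_0'^+\}$, $\rho(\mu)(h)=\sum\mu(S(h_{(1)}))h_{(2)}$. For an RTA, automorphisms act on weights by $\theta*\lambda=\lambda\circ\theta^{-1}$.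 Let $\widehat{H_0}^{free}$ be the set of $\lambda\in\widehat{H_0}$ with trivial stabilizer in the group generated by $Q_0^+$, and $\widehat{H_1}^{free}$ the set of $\lambda\in\widehat{H_1}$ with $\lambda|_{H_0}\in\widehat{H_0}^{free}$. Write $\mu\le\lambda$ for $\lambda\in Q_0^+*\mu$ (weights of $H_0$), and, for weights of $H_1$, if $\mu|_{H_0}<\lambda|_{H_0}$ or $\mu=\lambda$. Category $\mathcal O$ consists of the finitely generated $A$-modules which are the direct sum of their $H_1$-weight spaces, these being finite-dimensional, and on which $B^+$ acts locally finitely; $\mathcal O[\widehat{H_1}^{free}]$ is the full subcategory of the objects all of whose weights lie in $\widehat{H_1}^{free}$. Let $N^+=\bigoplus_{\mathrm{id}\ne\theta\in Q_0^+}B^+_\theta$, $M(\lambda)=A/(AN^++A\ker\lambda)$, and, for $\lambda\in\widehat{H_1}^{free}$, let $L(\lambda)$ be the unique simple quotient of $M(\lambda)$. For $\lambda\in\widehat{H_1}^{free}$: $S^4(\lambda)$ is the set of $\mu\in\widehat{H_1}$ such that the center of $A$ acts on $M(\mu)$ and $M(\lambda)$ by the same character; $S^3(\lambda)$ is the class of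 $\lambda$ in $\widehat{H_1}$ for the equivalence relation generated by: $\mu\to\nu$ if $L(\mu)$ is a subquotient of $M(\nu)$; $S^2(\lambda)=\{\mu|_{H_0}:\mu\in S^3(\lambda)\}$; $S^1(\lambda)=\{\mu|_{H_0}:\mu\in S^3(\lambda),\ \mu\le\lambda\}$. Put $S^m(A)=\{\lambda\in\widehat{H_1}^{free}:S^m(\lambda)\text{ is finite}\}$; Condition (S$m$) says $S^m(A)=\widehat{H_1}^{free}$ ($1\le m\le4$). Finally $\overline{S^2}(A)$ is the set of $\lambda\in S^2(A)$ such that every $\mu\in\widehat{H_1}$ with $\mu_0'\le\mu|_{H_0}\le\mu_0''$ for some $\mu_0',\mu_0''\in S^2(\lambda)$ lies in $S^1(A)$. **Theorem.** Let $A_j$ ($1\le j\le n$) be RTAs, with data $B_j^\pm,H_{1j},H_{0j},Q_{0j}^+,i_j$, and equip $A=\bigotimes_jA_j$ with $B^\pm=\bigotimes_jB_j^\pm$, $H_r=\bigotimes_jH_{rj}$, $Q_0^+=\{\bigotimes_j\theta_j:\theta_j\in Q_{0j}^+\}$, $i=\bigotimes_ji_j$. 1. $A$ is an RTA. It is strict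 (respectively based, discretely graded) if and only if every $A_j$ is. If the $A_j$ are Hopf RTAs, then $A$, with the tensor product Hopf structures on $H_1,H_0$ and $Q_0'^+=\prod_jQ_{0j}'^+$, is a Hopf RTA, and it is strict (respectively based, discretely graded) if and only if every $A_j$ is. In this case the underlying data of the $A_j$ are RTAs, and the underlying data of $A$ are the tensor product of those of the $A_j$. 2. An $A$-module is a simple object of $\mathcal O[\widehat{H_1}^{free}]$ if and only if it is isomorphic to $\bigotimes_jV_j$ with $V_j$ a simple object of $\mathcal O[\widehat{H_{1j}}^{free}]$ for every $j$; the $V_j$ are unique up to isomorphism. 3. Restriction to the factors gives bijections $\widehat{H_r}\cong\prod_j\widehat{H_{rj}}$ ($r=0,1$), under which $\widehat{H_1}^{free}=\prod_j\widehat{H_{1j}}^{free}$, and for $1\le m\le4$ and $\lambda=(\lambda_1,\dots,\lambda_n)$ with $\lambda_j\in\widehat{H_{1j}}^{free}$, $$S^m_A(\lambda)=\prod_jS^m_{A_j}(\lambda_j),\qquad S^m(A)=\prod_jS^m(A_j),\qquad \overline{S^2}(A)=\prod_j\overline{S^2}(A_j).$$ Consequently each Condition (S$m$) holds for $A$ if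 it holds for all $A_j$; and if all the sets $\widehat{H_{1j}}^{free}$ are nonempty, it holds for $A$ if and only if it holds for all $A_j$. 4. If for every $j$ all finite-dimensional modules in $\mathcal O[\widehat{H_{1j}}^{free}]$ are completely reducible, then so are all finite-dimensional modules in $\mathcal O[\widehat{H_1}^{free}]$. The converse holds provided that for every $j$ there is $\mu_j\in\widehat{H_{1j}}^{free}$ with $\dim L_j(\mu_j)<\infty$. -/

import Mathlib

open scoped TensorProduct

universe u

namespace RTAlg

noncomputable section

/-! ## The Hopf algebra structure on a finite tensor product of commutative Hopf algebras -/

section PiHopfAux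

variable {F H R : Type u} [Field F] [CommRing H] [HopfAlgebra F H] [CommRing R] [Algebra F R]
  (s : H →ₐ[F] R) (Δ : R →ₐ[F] R ⊗[F] R) (ε : R →ₐ[F] F) (S : R →ₐ[F] R)
open Algebra.TensorProduct Bialgebra

theorem gen_coassoc (hΔ : Δ.comp s = (map s s).comp (comulAlgHom F H)) :
    ((Algebra.TensorProduct.assoc F F F R R R).toAlgHom.comp ((map Δ (.id F R)).comp Δ)).comp s =
      ((map (.id F R) Δ).comp Δ).comp s := by
  have h1 : (map Δ (.id F R)).comp (map s s) = (map (map s s) s).comp (map (comulAlgHom F H) (.id F H)) := by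
    rw [← map_comp, ← map_comp, hΔ, AlgHom.id_comp, AlgHom.comp_id]
  have h2 : (map (.id F R) Δ).comp (map s s) = (map s (map s s)).comp (map (.id F H) (comulAlgHom F H)) := by
    rw [← map_comp, ← map_comp, hΔ, AlgHom.id_comp, AlgHom.comp_id]
  have h3 : (Algebra.TensorProduct.assoc F F F R R R).toAlgHom.comp (map (map s s) s) =
      (map s (map s s)).comp (Algebra.TensorProduct.assoc F F F H H H).toAlgHom := by
    apply Algebra.TensorProduct.ext'
    intro a b
    induction a with
    | zero => simp
    | tmul x y => simp
    | add x y hx hy => rw [TensorProduct.add_tmul, _root_.map_add, hx, hy, _root_.map_add]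
  ext x
  have e := DFunLike.congr_fun hΔ x
  have e1 := fun t => DFunLike.congr_fun h1 t
  have e2 := fun t => DFunLike.congr_fun h2 t
  have e3 := fun t => DFunLike.congr_fun h3 t
  have e4 := Coalgebra.coassoc_apply (R := F) x
  simp only [AlgHom.comp_apply] at *
  rw [e, e1, e2, e3]
  exact congrArg _ e4

theorem gen_rTensor (hΔ : Δ.comp s = (map s s).comp (comulAlgHom F H)) (hε : ε.comp s = counitAlgHom F H) :
    ((map ε (.id F R)).comp Δ).comp s = AlgHom.comp (Algebra.TensorProduct.lid F R).symm.toAlgHom s := by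
  have h1 : (map ε (.id F R)).comp (map s s) = (map (.id F F) s).comp (map (counitAlgHom F H) (.id F H)) := by
    rw [← map_comp, ← map_comp, hε, AlgHom.id_comp, AlgHom.comp_id, AlgHom.id_comp]
  ext x
  have e := DFunLike.congr_fun hΔ x
  have e1 := fun t => DFunLike.congr_fun h1 t
  have e4 := Coalgebra.rTensor_counit_comul (R := F) x
  simp only [AlgHom.comp_apply] at *
  rw [e, e1]
  refine (congrArg (map (AlgHom.id F F) s) e4).trans ?_
  simp

theorem gen_lTensor (hΔ : Δ.comp s = (map s s).comp (comulAlgHom F H)) (hε : ε.comp s = counitAlgHom F H) :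
    ((map (.id F R) ε).comp Δ).comp s = AlgHom.comp (Algebra.TensorProduct.rid F F R).symm.toAlgHom s := by
  have h1 : (map (.id F R) ε).comp (map s s) = (map s (.id F F)).comp (map (.id F H) (counitAlgHom F H)) := by
    rw [← map_comp, ← map_comp, hε, AlgHom.id_comp, AlgHom.comp_id, AlgHom.id_comp]
  ext x
  have e := DFunLike.congr_fun hΔ x
  have e1 := fun t => DFunLike.congr_fun h1 t
  have e4 := Coalgebra.lTensor_counit_comul (R := F) x
  simp only [AlgHom.comp_apply] at *
  rw [e, e1]
  refine (congrArg (map s (AlgHom.id F F)) e4).trans ?_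
  simp

theorem gen_S1 (hΔ : Δ.comp s = (map s s).comp (comulAlgHom F H)) (hε : ε.comp s = counitAlgHom F H)
    (hS : S.comp s = s.comp (HopfAlgebra.antipodeAlgHom F H)) :
    ((lift S (.id F R) fun _ ↦ Commute.all _).comp Δ).comp s = ((Algebra.ofId F R).comp ε).comp s := by
  have h1 : (lift S (.id F R) fun _ ↦ Commute.all _).comp (map s s) =
     s.comp (lift (HopfAlgebra.antipodeAlgHom F H) (.id F H) fun _ ↦ Commute.all _) := by
    apply Algebra.TensorProduct.ext'
    intro a b
    have h := DFunLike.congr_fun hS a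
    simp only [AlgHom.comp_apply] at h
    refine Eq.trans (lift_tmul S (.id F R) (fun _ _ => Commute.all _ _) (s a) (s b)) (Eq.trans ?_ (congrArg s (lift_tmul (HopfAlgebra.antipodeAlgHom F H) (.id F H) (fun _ _ => Commute.all _ _) a b)).symm)
    rw [h, AlgHom.id_apply, AlgHom.id_apply, map_mul]
  ext x
  have e := DFunLike.congr_fun hΔ x
  have e1 := fun t => DFunLike.congr_fun h1 t
  have e4 := HopfAlgebra.mul_antipode_rTensor_comul_apply (R := F) x
  have e5 := DFunLike.congr_fun hε x
  simp only [AlgHom.comp_apply] at *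
  rw [e, e1, e5]
  have e6 : ∀ t : H ⊗[F] H, lift (HopfAlgebra.antipodeAlgHom F H) (.id F H) (fun _ ↦ Commute.all _) t
     = LinearMap.mul' F H (LinearMap.rTensor H (HopfAlgebra.antipode F) t) := by
    intro t
    induction t with
    | zero => simp
    | tmul x y => exact lift_tmul _ _ _ x y
    | add x y hx hy => simp only [_root_.map_add, hx, hy]
  rw [e6]
  refine (congrArg s e4).trans ?_
  simp [Algebra.ofId_apply]

theorem gen_S2 (hΔ : Δ.comp s = (map s s).comp (comulAlgHom F H)) (hε : ε.comp s = counitAlgHom F H)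
    (hS : S.comp s = s.comp (HopfAlgebra.antipodeAlgHom F H)) :
    ((lift (.id F R) S fun _ _ ↦ Commute.all _ _).comp Δ).comp s = ((Algebra.ofId F R).comp ε).comp s := by
  have h1 : (lift (.id F R) S fun _ _ ↦ Commute.all _ _).comp (map s s) =
     s.comp (lift (.id F H) (HopfAlgebra.antipodeAlgHom F H) fun _ _ ↦ Commute.all _ _) := by
    apply Algebra.TensorProduct.ext'
    intro a b
    have := DFunLike.congr_fun hS b
    simp only [AlgHom.comp_apply] at this
    simp [this]
  ext x
  have e := DFunLike.congr_fun hΔ x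
  have e1 := fun t => DFunLike.congr_fun h1 t
  have e4 := HopfAlgebra.mul_antipode_lTensor_comul_apply (R := F) x
  have e5 := DFunLike.congr_fun hε x
  simp only [AlgHom.comp_apply] at *
  rw [e, e1, e5]
  have e6 : ∀ t : H ⊗[F] H, lift (.id F H) (HopfAlgebra.antipodeAlgHom F H) (fun _ _ ↦ Commute.all _ _) t
     = LinearMap.mul' F H (LinearMap.lTensor H (HopfAlgebra.antipode F) t) := by
    intro t
    induction t with
    | zero => simp
    | tmul x y => simp
    | add x y hx hy => simp only [_root_.map_add, hx, hy]
  rw [e6]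
  refine (congrArg s e4).trans ?_
  simp [Algebra.ofId_apply]

end PiHopfAux

section PiHopf

variable {ι : Type} [Fintype ι] [DecidableEq ι] {F : Type u} [Field F] {K : ι → Type u}
  [∀ j, CommRing (K j)]

/-- The algebra map `⨂ⱼ xⱼ ↦ ∏ⱼ fⱼ xⱼ` into a commutative algebra. -/
def piLift [∀ j, Algebra F (K j)] {R : Type u} [CommRing R] [Algebra F R]
    (f : ∀ j, K j →ₐ[F] R) : (⨂[F] j, K j) →ₐ[F] R :=
  PiTensorProduct.liftAlgHom
    ((MultilinearMap.mkPiAlgebra F ι R).compLinearMap fun j => (f j).toLinearMap)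
    (by simp) (fun x y => by simp [Finset.prod_mul_distrib])

theorem piLift_single [∀ j, Algebra F (K j)] {R : Type u} [CommRing R] [Algebra F R]
    (f : ∀ j, K j →ₐ[F] R) (j : ι) :
    (piLift f).comp (PiTensorProduct.singleAlgHom j) = f j := by
  ext x
  refine (PiTensorProduct.lift.tprod _).trans ?_
  change ∏ i, f i (Pi.mulSingle j x i) = f j x
  rw [Finset.prod_eq_single j]
  · simp
  · intro b _ hb
    simp [Pi.mulSingle_eq_of_ne hb]
  · simp

variable [∀ j, HopfAlgebra F (K j)]

variable (F K) in
/-- The comultiplication of `⨂ⱼ Kⱼ`: on the `j`-th factor it is that of `Kⱼ`. -/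
def piComul : (⨂[F] j, K j) →ₐ[F] (⨂[F] j, K j) ⊗[F] (⨂[F] j, K j) :=
  piLift fun j => (Algebra.TensorProduct.map (PiTensorProduct.singleAlgHom j)
    (PiTensorProduct.singleAlgHom j)).comp (Bialgebra.comulAlgHom F (K j))

variable (F K) in
/-- The counit of `⨂ⱼ Kⱼ`. -/
def piCounit : (⨂[F] j, K j) →ₐ[F] F :=
  piLift fun j => Bialgebra.counitAlgHom F (K j)

variable (F K) in
/-- The antipode of `⨂ⱼ Kⱼ`. -/
def piAntipode : (⨂[F] j, K j) →ₐ[F] (⨂[F] j, K j) :=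
  piLift fun j => (PiTensorProduct.singleAlgHom j).comp (HopfAlgebra.antipodeAlgHom F (K j))

theorem piComul_single (j : ι) :
    (piComul F K).comp (PiTensorProduct.singleAlgHom j) =
      (Algebra.TensorProduct.map (PiTensorProduct.singleAlgHom j)
        (PiTensorProduct.singleAlgHom j)).comp (Bialgebra.comulAlgHom F (K j)) :=
  piLift_single _ j

instance piBialgebra : Bialgebra F (⨂[F] j, K j) :=
  Bialgebra.ofAlgHom (piComul F K) (piCounit F K)
    (PiTensorProduct.algHom_ext fun j => gen_coassoc _ _ (piComul_single j))
    (PiTensorProduct.algHom_ext fun j =>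
      gen_rTensor _ _ _ (piComul_single j) (piLift_single _ j))
    (PiTensorProduct.algHom_ext fun j =>
      gen_lTensor _ _ _ (piComul_single j) (piLift_single _ j))

instance piHopfAlgebra : HopfAlgebra F (⨂[F] j, K j) :=
  HopfAlgebra.ofAlgHom (piAntipode F K)
    (PiTensorProduct.algHom_ext fun j =>
      gen_S1 _ _ _ _ (piComul_single j) (piLift_single _ j) (piLift_single _ j))
    (PiTensorProduct.algHom_ext fun j =>
      gen_S2 _ _ _ _ (piComul_single j) (piLift_single _ j) (piLift_single _ j))

/-- The tensor product of bialgebra maps between commutative Hopf algebras. -/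
def piBialgHom {K' : ι → Type u} [∀ j, CommRing (K' j)] [∀ j, HopfAlgebra F (K' j)]
    (f : ∀ j, K j →ₐc[F] K' j) : (⨂[F] j, K j) →ₐc[F] (⨂[F] j, K' j) :=
  BialgHom.ofAlgHom (piLift fun j => (PiTensorProduct.singleAlgHom j).comp (f j : K j →ₐ[F] K' j))
    (PiTensorProduct.algHom_ext fun j => by
      rw [AlgHom.comp_assoc, piLift_single, ← AlgHom.comp_assoc]
      refine (congrArg (fun g => AlgHom.comp g (f j : K j →ₐ[F] K' j))
        (piLift_single (fun j => Bialgebra.counitAlgHom F (K' j)) j)).trans ?_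
      refine Eq.trans ?_ (piLift_single (fun j => Bialgebra.counitAlgHom F (K j)) j).symm
      ext x
      simp)
    (PiTensorProduct.algHom_ext fun j => by
      have h1 := piComul_single (F := F) (K := K) j
      have h2 := piComul_single (F := F) (K := K') j
      have h3 := piLift_single
        (fun j => (PiTensorProduct.singleAlgHom (R := F) j).comp (f j : K j →ₐ[F] K' j)) j
      change (AlgHom.comp _ (piComul F K)).comp _ = (AlgHom.comp (piComul F K') _).comp _
      rw [AlgHom.comp_assoc, AlgHom.comp_assoc, h1, h3, ← AlgHom.comp_assoc,
        ← AlgHom.comp_assoc, ← Algebra.TensorProduct.map_comp, h3, h2,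
        Algebra.TensorProduct.map_comp, AlgHom.comp_assoc, AlgHom.comp_assoc]
      congr 1
      ext x
      exact CoalgHomClass.map_comp_comul_apply (f j) x)

end PiHopf

/-! ## Generalities -/

/-- `W` is the (internal) direct sum of the family of subspaces `V`. -/
def IsDirectSum {F M I : Type*} [Field F] [AddCommGroup M] [Module F M]
    (V : I → Submodule F M) (W : Submodule F M) : Prop :=
  iSupIndep V ∧ iSup V = W

/-- `L` is isomorphic to a subquotient of `M`. -/
def IsSubquotient (R L M : Type*) [Ring R] [AddCommGroup L] [Module R L] [AddCommGroup M]
    [Module R M] : Prop :=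
  ∃ (N : Submodule R M) (f : N →ₗ[R] L), Function.Surjective f

/-- `Q` is a submonoid and `Q ∖ {1}` is a semigroup. -/
structure IsPositiveMonoid {G : Type*} [Monoid G] (Q : Set G) : Prop where
  one_mem : 1 ∈ Q
  mul_mem : ∀ x ∈ Q, ∀ y ∈ Q, x * y ∈ Q
  mul_ne_one : ∀ x ∈ Q, ∀ y ∈ Q, x ≠ 1 → y ≠ 1 → x * y ≠ 1

/-- `Q` consists of the `ℕ`-combinations of a pairwise commuting, `ℤ`-linearly independent
subset `Δ` (everything written multiplicatively). -/
def IsBasedMonoid {G : Type*} [Group G] (Q : Set G) : Prop :=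
  ∃ (Δ : Set G) (hcomm : ∀ a ∈ Δ, ∀ b ∈ Δ, Commute a b), Δ ⊆ Q ∧
    (∀ (s : Finset G) (hs : ∀ a ∈ s, a ∈ Δ) (f : G → ℤ),
      s.noncommProd (fun a => a ^ f a)
        (fun a ha b hb _ => (hcomm a (hs a ha) b (hs b hb)).zpow_zpow (f a) (f b)) = 1 →
      ∀ a ∈ s, f a = 0) ∧
    (Submonoid.closure Δ : Set G) = Q

/-- All intervals `[1, y]`, `y ∈ Q`, are finite for the order
`x ≤ y ↔ ∃ q ∈ Q, y = q * x` on `Q`. -/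
def IsDiscreteMonoid {G : Type*} [Monoid G] (Q : Set G) : Prop :=
  ∀ y ∈ Q, {x | x ∈ Q ∧ ∃ q ∈ Q, y = q * x}.Finite

/-! ## Triangular data -/

/-- The data `(B⁻, H₁, H₀, B⁺, i)`. -/
structure TriData (F A : Type u) [Field F] [Ring A] [Algebra F A] where
  Bm : Subalgebra F A
  Bp : Subalgebra F A
  H1 : Subalgebra F A
  H0 : Subalgebra F A
  H0_le : H0 ≤ H1
  i : A →ₗ[F] A

section Tri

variable {F A : Type u} [Field F] [Ring A] [Algebra F A]

/-- The multiplication map `B⁻ ⊗ H₁ ⊗ B⁺ → A`. -/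
def TriData.mulMap (T : TriData F A) : T.Bm ⊗[F] (T.H1 ⊗[F] T.Bp) →ₗ[F] A :=
  LinearMap.mul' F A ∘ₗ TensorProduct.map T.Bm.val.toLinearMap
    (LinearMap.mul' F A ∘ₗ TensorProduct.map T.H1.val.toLinearMap T.Bp.val.toLinearMap)

/-- Triangular decomposition of a nonzero algebra, and an anti-involution `i` which fixes `H₁`
pointwise and maps `B^±` into `H₁ · B^∓` (the span of the products). -/
structure TriData.IsTriangular (T : TriData F A) : Prop where
  nontrivial : Nontrivial A
  bijective : Function.Bijective T.mulMap
  i_mul : ∀ a b, T.i (a * b) = T.i b * T.i a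
  i_i : ∀ a, T.i (T.i a) = a
  i_fix : ∀ h ∈ T.H1, T.i h = h
  i_Bp : ∀ b ∈ T.Bp, T.i b ∈ Subalgebra.toSubmodule T.H1 * Subalgebra.toSubmodule T.Bm
  i_Bm : ∀ b ∈ T.Bm, T.i b ∈ Subalgebra.toSubmodule T.H1 * Subalgebra.toSubmodule T.Bp

/-- The root space `{a | a h = θ(h) a for all h ∈ H}`. -/
def rootSpace (H : Subalgebra F A) (θ : H ≃ₐ[F] H) : Submodule F A where
  carrier := {a | ∀ h : H, a * (h : A) = (θ h : A) * a}
  add_mem' := fun ha hb h => by rw [add_mul, mul_add, ha h, hb h]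
  zero_mem' := fun h => by simp
  smul_mem' := fun c a ha h => by rw [smul_mul_assoc, mul_smul_comm, ha h]

/-- The weight space `{m | h m = w(h) m for all h ∈ H}` of an `A`-module. -/
def weightSpace (H : Subalgebra F A) (M : Type u) [AddCommGroup M] [Module F M] [Module A M]
    [IsScalarTower F A M] (w : H →ₐ[F] F) : Submodule F M where
  carrier := {m | ∀ h : H, (h : A) • m = w h • m}
  add_mem' := fun ha hb h => by rw [smul_add, smul_add, ha h, hb h]
  zero_mem' := fun h => by simp
  smul_mem' := fun c a ha h => by rw [smul_algebra_smul_comm, ha h, smul_comm]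

end Tri

/-! ## Regular triangular algebras -/

/-- The data `(B⁻, H₁, H₀, B⁺, i, Q₀⁺)` with `Q₀⁺` a set of automorphisms of `H₀`. -/
structure RTAData (F A : Type u) [Field F] [Ring A] [Algebra F A] extends TriData F A where
  Q0 : Set (H0 ≃ₐ[F] H0)

namespace RTAData

variable {F A : Type u} [Field F] [Ring A] [Algebra F A] (D : RTAData F A)

/-- The automorphisms of `H₁` which restrict to an element of `Q₀⁺`. -/
def Q1 : Set (D.H1 ≃ₐ[F] D.H1) :=
  {θ₁ | ∃ θ₀ ∈ D.Q0, ∀ h : D.H0, θ₁ (Subalgebra.inclusion D.H0_le h) =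
    Subalgebra.inclusion D.H0_le (θ₀ h)}

/-- The `H₀`-root space of `B⁺`. -/
def BpRoot0 (θ : D.H0 ≃ₐ[F] D.H0) : Submodule F A :=
  Subalgebra.toSubmodule D.Bp ⊓ rootSpace D.H0 θ

/-- The `H₁`-root space of `B⁺`. -/
def BpRoot1 (θ : D.H1 ≃ₐ[F] D.H1) : Submodule F A :=
  Subalgebra.toSubmodule D.Bp ⊓ rootSpace D.H1 θ

/-- Regular triangular algebra. -/
structure IsRTA : Prop where
  triangular : D.toTriData.IsTriangular
  positive : IsPositiveMonoid D.Q0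
  decomp : IsDirectSum (fun θ : D.Q1 => D.BpRoot1 θ) (Subalgebra.toSubmodule D.Bp)
  root_one : D.BpRoot0 1 = Submodule.span F {1}
  finite : ∀ θ ∈ D.Q0, FiniteDimensional F (D.BpRoot0 θ)

def IsStrict : Prop := D.H1 = D.H0

def IsBased : Prop := IsBasedMonoid D.Q0

def IsDiscretelyGraded : Prop := IsDiscreteMonoid D.Q0

/-- Restriction of weights from `H₁` to `H₀`. -/
def res (w : D.H1 →ₐ[F] F) : D.H0 →ₐ[F] F := w.comp (Subalgebra.inclusion D.H0_le)

/-- The action `θ * w = w ∘ θ⁻¹` of automorphisms of `H₀` on weights of `H₀`. -/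
def act (θ : D.H0 ≃ₐ[F] D.H0) (w : D.H0 →ₐ[F] F) : D.H0 →ₐ[F] F :=
  w.comp (θ⁻¹ : D.H0 ≃ₐ[F] D.H0).toAlgHom

/-- The weights of `H₀` with trivial stabilizer in the group generated by `Q₀⁺`. -/
def free0 : Set (D.H0 →ₐ[F] F) :=
  {w | ∀ θ ∈ Subgroup.closure D.Q0, D.act θ w = w → θ = 1}

/-- The weights of `H₁` whose restriction to `H₀` lies in `free0`. -/
def free1 : Set (D.H1 →ₐ[F] F) := {w | D.res w ∈ D.free0}

/-- `v ≤ w` for weights of `H₀`. -/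
def le0 (v w : D.H0 →ₐ[F] F) : Prop := ∃ θ ∈ D.Q0, w = D.act θ v

/-- `v ≤ w` for weights of `H₁`. -/
def le1 (v w : D.H1 →ₐ[F] F) : Prop :=
  (D.le0 (D.res v) (D.res w) ∧ D.res v ≠ D.res w) ∨ v = w

/-- The subspace `N⁺` of `B⁺`. -/
def Np : Submodule F A := ⨆ θ : {θ : D.H0 ≃ₐ[F] D.H0 // θ ∈ D.Q0 ∧ θ ≠ 1}, D.BpRoot0 θ

/-- The left ideal `A · N⁺ + A · ker w`. -/
def vermaIdeal (w : D.H1 →ₐ[F] F) : Submodule A A :=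
  Submodule.span A (D.Np : Set A) ⊔ Submodule.span A {a : A | ∃ h : D.H1, w h = 0 ∧ (h : A) = a}

/-- The Verma module `M(w)`. -/
abbrev Verma (w : D.H1 →ₐ[F] F) : Type u := A ⧸ D.vermaIdeal w

/-- The sum of all proper submodules of `M(w)`; for `w ∈ free1` over an RTA this is the unique
maximal submodule. -/
def radVerma (w : D.H1 →ₐ[F] F) : Submodule A (D.Verma w) := sSup {N | N ≠ ⊤}

/-- The module `L(w)`, meant for `w ∈ free1`, where it is the unique simple quotient of `M(w)`. -/
abbrev Simple (w : D.H1 →ₐ[F] F) : Type u := D.Verma w ⧸ D.radVerma w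

/-- Category `𝒪`. -/
structure InO (M : Type u) [AddCommGroup M] [Module F M] [Module A M] [IsScalarTower F A M] :
    Prop where
  fg : Module.Finite A M
  semisimple : IsDirectSum (fun w : D.H1 →ₐ[F] F => weightSpace D.H1 M w) ⊤
  finite : ∀ w : D.H1 →ₐ[F] F, FiniteDimensional F (weightSpace D.H1 M w)
  locallyFinite : ∀ m : M, FiniteDimensional F (Submodule.span F {x : M | ∃ b ∈ D.Bp, x = b • m})

/-- The objects of `𝒪` all of whose weights lie in `free1`. -/
structure InOFree (M : Type u) [AddCommGroup M] [Module F M] [Module A M] [IsScalarTower F A M] :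
    Prop extends D.InO M where
  weights : ∀ w : D.H1 →ₐ[F] F, weightSpace D.H1 M w ≠ ⊥ → w ∈ D.free1

/-- `v → w`: the simple module `L(v)` is a subquotient of `M(w)`. -/
def Linked (v w : D.H1 →ₐ[F] F) : Prop :=
  v ∈ D.free1 ∧ IsSubquotient A (D.Simple v) (D.Verma w)

/-- The weights `v` such that every central `z` acts on `M(v)` and on `M(w)` by the same scalar. -/
def S4 (w : D.H1 →ₐ[F] F) : Set (D.H1 →ₐ[F] F) :=
  {v | ∀ z ∈ Subalgebra.center F A, ∃ c : F,
    (∀ m : D.Verma v, z • m = c • m) ∧ (∀ m : D.Verma w, z • m = c • m)}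

def S3 (w : D.H1 →ₐ[F] F) : Set (D.H1 →ₐ[F] F) := {v | Relation.EqvGen D.Linked v w}

def S2 (w : D.H1 →ₐ[F] F) : Set (D.H0 →ₐ[F] F) := D.res '' D.S3 w

def S1 (w : D.H1 →ₐ[F] F) : Set (D.H0 →ₐ[F] F) := D.res '' {v ∈ D.S3 w | D.le1 v w}

def S4A : Set (D.H1 →ₐ[F] F) := {w ∈ D.free1 | (D.S4 w).Finite}

def S3A : Set (D.H1 →ₐ[F] F) := {w ∈ D.free1 | (D.S3 w).Finite}

def S2A : Set (D.H1 →ₐ[F] F) := {w ∈ D.free1 | (D.S2 w).Finite}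

def S1A : Set (D.H1 →ₐ[F] F) := {w ∈ D.free1 | (D.S1 w).Finite}

/-- The set `\overline{S^2}(A)`. -/
def S2barA : Set (D.H1 →ₐ[F] F) :=
  {w ∈ D.S2A | ∀ v : D.H1 →ₐ[F] F, ∀ a ∈ D.S2 w, ∀ b ∈ D.S2 w,
    D.le0 a (D.res v) → D.le0 (D.res v) b → v ∈ D.S1A}

def CondS1 : Prop := D.S1A = D.free1

def CondS2 : Prop := D.S2A = D.free1

def CondS3 : Prop := D.S3A = D.free1

def CondS4 : Prop := D.S4A = D.free1

/-- Every finite-dimensional module in `𝒪[free]` is semisimple. -/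
def CompletelyReducible : Prop :=
  ∀ (M : Type u) [AddCommGroup M] [Module F M] [Module A M] [IsScalarTower F A M],
    FiniteDimensional F M → D.InOFree M → IsSemisimpleModule A M

end RTAData

/-! ## Tensor products of triangular data -/

section Tensor

variable {ι : Type} [Fintype ι] [DecidableEq ι] {F : Type u} [Field F] {A : ι → Type u}
  [∀ j, Ring (A j)] [∀ j, Algebra F (A j)]

/-- The image of `⨂ⱼ Sⱼ` in `⨂ⱼ Aⱼ`, i.e. the subalgebra generated by the `1 ⊗ ⋯ ⊗ Sⱼ ⊗ ⋯ ⊗ 1`. -/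
def tensorSub (S : ∀ j, Subalgebra F (A j)) : Subalgebra F (⨂[F] j, A j) :=
  ⨆ j, (S j).map (PiTensorProduct.singleAlgHom j)

/-- The inclusion of the `j`-th factor. -/
def tensorIncl (S : ∀ j, Subalgebra F (A j)) (j : ι) : S j →ₐ[F] tensorSub S :=
  ((PiTensorProduct.singleAlgHom j).comp (S j).val).codRestrict _ fun x =>
    le_iSup (fun j => (S j).map (PiTensorProduct.singleAlgHom (R := F) j)) j ⟨x, x.2, rfl⟩

def TriData.tensor (T : ∀ j, TriData F (A j)) : TriData F (⨂[F] j, A j) where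
  Bm := tensorSub fun j => (T j).Bm
  Bp := tensorSub fun j => (T j).Bp
  H1 := tensorSub fun j => (T j).H1
  H0 := tensorSub fun j => (T j).H0
  H0_le := iSup_mono fun j => Subalgebra.map_mono (T j).H0_le
  i := PiTensorProduct.map fun j => (T j).i

/-- The tensor product: `Q₀⁺` is the set of the automorphisms `⨂ⱼ θⱼ` with `θⱼ ∈ Q₀ⱼ⁺`. -/
def RTAData.tensor (D : ∀ j, RTAData F (A j)) : RTAData F (⨂[F] j, A j) where
  toTriData := TriData.tensor fun j => (D j).toTriData
  Q0 := {θ | ∃ θ' : ∀ j, (D j).H0 ≃ₐ[F] (D j).H0, ∀ j, θ' j ∈ (D j).Q0 ∧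
    ∀ h : (D j).H0, θ (tensorIncl (fun j => (D j).H0) j h) =
      tensorIncl (fun j => (D j).H0) j (θ' j h)}

/-- The components of a weight of `H₁ = ⨂ⱼ H₁ⱼ`. -/
def RTAData.comp1 (D : ∀ j, RTAData F (A j)) (w : (RTAData.tensor D).H1 →ₐ[F] F) (j : ι) :
    (D j).H1 →ₐ[F] F :=
  AlgHom.comp w (tensorIncl (fun j => (D j).H1) j)

/-- The components of a weight of `H₀ = ⨂ⱼ H₀ⱼ`. -/
def RTAData.comp0 (D : ∀ j, RTAData F (A j)) (w : (RTAData.tensor D).H0 →ₐ[F] F) (j : ι) :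
    (D j).H0 →ₐ[F] F :=
  AlgHom.comp w (tensorIncl (fun j => (D j).H0) j)

/-- `V` is isomorphic, as a module over `⨂ⱼ Aⱼ`, to `⨂ⱼ Wⱼ` with the factorwise action. -/
def IsTensorModule (F : Type u) [Field F] (A : ι → Type u) [∀ j, Ring (A j)]
    [∀ j, Algebra F (A j)] (W : ι → Type u) [∀ j, AddCommGroup (W j)] [∀ j, Module F (W j)]
    [∀ j, Module (A j) (W j)] (V : Type u) [AddCommGroup V] [Module F V]
    [Module (⨂[F] j, A j) V] : Prop :=
  ∃ e : (⨂[F] j, W j) ≃ₗ[F] V, ∀ (a : ∀ j, A j) (x : ∀ j, W j),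
    e (PiTensorProduct.tprod F fun j => a j • x j) =
      PiTensorProduct.tprod F a • e (PiTensorProduct.tprod F x)

end Tensor

/-! ## Hopf regular triangular algebras -/

section Hopf

/-- The adjoint action `(ad h)(a) = ∑ h₁ a S(h₂)` of a Hopf algebra `K` mapping to `A`. -/
def ad {F K A : Type u} [Field F] [CommRing K] [HopfAlgebra F K] [Ring A] [Algebra F A]
    (f : K →ₐ[F] A) (h : K) (a : A) : A :=
  LinearMap.mul' F A (TensorProduct.map (LinearMap.mulRight F a ∘ₗ f.toLinearMap)
    (f.toLinearMap ∘ₗ HopfAlgebra.antipode F) (Coalgebra.comul (R := F) h))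

theorem ad_add {F K A : Type u} [Field F] [CommRing K] [HopfAlgebra F K] [Ring A] [Algebra F A]
    (f : K →ₐ[F] A) (h : K) (a b : A) : ad f h (a + b) = ad f h a + ad f h b := by
  have : LinearMap.mulRight F (a + b) ∘ₗ f.toLinearMap =
      LinearMap.mulRight F a ∘ₗ f.toLinearMap + LinearMap.mulRight F b ∘ₗ f.toLinearMap := by
    ext x
    simp [mul_add]
  simp only [ad, this, TensorProduct.map_add_left, LinearMap.add_apply, map_add]

theorem ad_smul {F K A : Type u} [Field F] [CommRing K] [HopfAlgebra F K] [Ring A] [Algebra F A]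
    (f : K →ₐ[F] A) (h : K) (c : F) (a : A) : ad f h (c • a) = c • ad f h a := by
  have : LinearMap.mulRight F (c • a) ∘ₗ f.toLinearMap =
      c • (LinearMap.mulRight F a ∘ₗ f.toLinearMap) := by
    ext x
    simp
  simp only [ad, this, TensorProduct.map_smul_left, LinearMap.smul_apply, map_smul]

/-- The weight spaces for the adjoint action. -/
def adWeightSpace {F K A : Type u} [Field F] [CommRing K] [HopfAlgebra F K] [Ring A]
    [Algebra F A] (f : K →ₐ[F] A) (w : K →ₐ[F] F) : Submodule F A where
  carrier := {a | ∀ h : K, ad f h a = w h • a}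
  add_mem' := fun ha hb h => by rw [ad_add, ha h, hb h, smul_add]
  zero_mem' := fun h => by simpa using ad_smul f h 0 0
  smul_mem' := fun c a ha h => by rw [ad_smul, ha h, smul_comm]

/-- The weight-to-root map `ρ(w)(h) = ∑ w⁻¹(h₁) h₂`. -/
def rho {F K : Type u} [Field F] [CommRing K] [HopfAlgebra F K] (w : WithConv (K →ₐ[F] F)) :
    K →ₐ[F] K :=
  (Algebra.TensorProduct.lift ((Algebra.ofId F K).comp (w⁻¹).ofConv) (.id F K)
    fun _ _ => Commute.all _ _).comp (Bialgebra.comulAlgHom F K)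

/-- The data of a Hopf RTA. The Hopf algebras `H₁ ⊇ H₀` are given by `K1`, `K0` and the maps
`K0 → K1 → A`, which are required to be injective below. (They may be taken commutative, since
`H₁` is fixed pointwise by an anti-involution.) The set `Q0` of weights of `H₀` lies in the group
of weights under convolution. -/
structure HRTAData (F A K1 K0 : Type u) [Field F] [Ring A] [Algebra F A] [CommRing K1]
    [HopfAlgebra F K1] [CommRing K0] [HopfAlgebra F K0] where
  Bm : Subalgebra F A
  Bp : Subalgebra F A
  incl1 : K1 →ₐ[F] A
  incl0 : K0 →ₐc[F] K1
  i : A →ₗ[F] A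
  Q0 : Set (WithConv (K0 →ₐ[F] F))

namespace HRTAData

variable {F A K1 K0 : Type u} [Field F] [Ring A] [Algebra F A] [CommRing K1]
  [HopfAlgebra F K1] [CommRing K0] [HopfAlgebra F K0] (E : HRTAData F A K1 K0)

/-- The map `H₀ → A`. -/
def incl : K0 →ₐ[F] A := E.incl1.comp (E.incl0 : K0 →ₐ[F] K1)

def toTri : TriData F A where
  Bm := E.Bm
  Bp := E.Bp
  H1 := E.incl1.range
  H0 := E.incl.range
  H0_le := by
    rintro _ ⟨x, rfl⟩
    exact ⟨E.incl0 x, rfl⟩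
  i := E.i

/-- The weights of `H₁` which restrict to an element of `Q0`. -/
def Q1 : Set (K1 →ₐ[F] F) :=
  {w | WithConv.toConv (w.comp (E.incl0 : K0 →ₐ[F] K1)) ∈ E.Q0}

/-- Hopf regular triangular algebra. -/
structure IsHRTA : Prop where
  injective1 : Function.Injective E.incl1
  injective0 : Function.Injective E.incl0
  triangular : E.toTri.IsTriangular
  positive : IsPositiveMonoid E.Q0
  decomp : IsDirectSum (fun w : E.Q1 => Subalgebra.toSubmodule E.Bp ⊓ adWeightSpace E.incl1 w)
    (Subalgebra.toSubmodule E.Bp)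
  weight_one : Subalgebra.toSubmodule E.Bp ⊓
    adWeightSpace E.incl (Bialgebra.counitAlgHom F K0) = Submodule.span F {1}
  finite : ∀ w ∈ E.Q0, FiniteDimensional F
    ↥(Subalgebra.toSubmodule E.Bp ⊓ adWeightSpace E.incl w.ofConv)

def IsStrict : Prop := E.toTri.H1 = E.toTri.H0

def IsBased : Prop := IsBasedMonoid E.Q0

def IsDiscretelyGraded : Prop := IsDiscreteMonoid E.Q0

/-- The RTA data of a Hopf RTA: `Q₀⁺` is the image of `Q0` under the weight-to-root map. -/
def toRTAData : RTAData F A where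
  toTriData := E.toTri
  Q0 := {θ | ∃ w ∈ E.Q0, ∀ h : K0,
    θ (E.incl.rangeRestrict h) = E.incl.rangeRestrict (rho w h)}

end HRTAData

/-- The tensor product of Hopf RTA data. -/
def HRTAData.tensor {ι : Type} [Fintype ι] [DecidableEq ι] {F : Type u} [Field F]
    {A K1 K0 : ι → Type u} [∀ j, Ring (A j)] [∀ j, Algebra F (A j)] [∀ j, CommRing (K1 j)]
    [∀ j, HopfAlgebra F (K1 j)] [∀ j, CommRing (K0 j)] [∀ j, HopfAlgebra F (K0 j)]
    (E : ∀ j, HRTAData F (A j) (K1 j) (K0 j)) :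
    HRTAData F (⨂[F] j, A j) (⨂[F] j, K1 j) (⨂[F] j, K0 j) where
  Bm := tensorSub fun j => (E j).Bm
  Bp := tensorSub fun j => (E j).Bp
  incl1 := PiTensorProduct.liftAlgHom
    ((PiTensorProduct.tprod F).compLinearMap fun j => (E j).incl1.toLinearMap)
    (by
      simp only [MultilinearMap.compLinearMap_apply, Pi.one_apply, AlgHom.toLinearMap_apply,
        map_one]
      rfl)
    (fun x y => by
      simp only [MultilinearMap.compLinearMap_apply, Pi.mul_apply, AlgHom.toLinearMap_apply,
        map_mul, PiTensorProduct.tprod_mul_tprod]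
      rfl)
  incl0 := piBialgHom fun j => (E j).incl0
  i := PiTensorProduct.map fun j => (E j).i
  Q0 := {w | ∀ j, WithConv.toConv
    (w.ofConv.comp (PiTensorProduct.singleAlgHom (R := F) (A := K0) j)) ∈ (E j).Q0}

end Hopf

end

end RTAlg

/-!
# Tensor products of regular triangular algebras

Two facts carry the whole argument.

The first is linear algebra. Evaluating functionals on all factors of `⨂ⱼ Wⱼ` except one
(`evalExcept`) detects membership in a subspace `⨂ⱼ Uⱼ` (`mem_tprodSpan_of_evalExcept`), and a family
of subspaces which is contained in an independent family and spans as much is equal to it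
(`eq_of_iSupIndep_of_le`). Weight spaces for distinct weights are independent, as joint eigenspaces
(`iSupIndep_jointEigen`), and so are root spaces in `B⁺` for distinct automorphisms of `H₀` or `H₁`,
because `H₁ ⊗ B⁺ → A` is injective (`iSupIndep_rootSpace`). Hence the root spaces of `⨂ⱼ Aⱼ` and the
weight spaces of `⨂ⱼ Vⱼ` are the tensor products of those of the factors (`BpRoot0_tensor`,
`weightSpace_tensor`), which makes `⨂ⱼ Aⱼ` a regular triangular algebra (`isRTA_tensor`). Being based
or discretely graded is a property of the product of the monoids alone (`isBasedMonoid_image_iff`,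
`isDiscreteMonoid_image_iff`).

The second is what freeness of a highest weight `λ` does. Only the root `1` leads from `λ` back to
`λ`, so the `H₀`-weight space of weight `λ` in a highest weight module is a line
(`weightSpace0_top`), and on finitely many vectors the projection onto that line is the action of an
element of `H₀` (`exists_hwFunctional`). This replaces a density theorem: a tensor product of simple
modules with such projections is simple (`isSimpleModule_tensor`), over any field. Conversely, a
simple object of `𝒪[free]` has a maximal vector (`exists_isMaxVec`), so it is some `L(λ)`, and `L(λ)`
is the tensor product of the `L(λⱼ)`; this describes the simple objects
(`inOFree_and_isSimpleModule_iff`). The factors are unique, since inserting vectors and evaluating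
functionals turns an isomorphism of tensor products into nonzero maps between the factors
(`factorMap`, `nonempty_equiv_of_tensor_equiv`).

The sets `Sᵐ`: the Verma module `M(λ)` is the tensor product of the `M(λⱼ)`
(`nonempty_equiv_verma`). As a module over one factor, a tensor product embeds into a power of the
corresponding module, so a simple subquotient of it gives simple subquotients of the factors
(`isSubquotient_of_tensor`). Thus `L(μ)` is a subquotient of `M(λ)` if and only if this holds in every
factor (`linked_tensor_iff`). The relation is reflexive on free weights, so it can be applied in one
coordinate at a time, and the generated equivalence relation is a product as well
(`eqvGen_of_forall`). For `S⁴`, the center of the tensor product is spanned by the tensors of central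
elements (`mem_S4_tensor_iff`).

Complete reducibility: if a finite-dimensional object is semisimple over each factor, it is generated
by vectors which are maximal for all factors (`span_Np_smul_eq_zero`), and a maximal vector of free
weight generates a quotient of a tensor product of simple modules, hence a simple module
(`isSimpleModule_span_singleton`). Conversely, a projection of `⨂ₖ Wₖ` onto a submodule
`N ⊗ ⨂_{k ≠ j} Wₖ` induces one of `Wⱼ` onto `N` (`isSemisimpleModule_of_tensor`).

For Hopf regular triangular algebras, a computation in the convolution algebra identifies the adjoint
weight space of weight `w` with the root space of the automorphism `ρ(w)` (`mem_adWeightSpace_iff`),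
and `ρ` is an injective homomorphism. So the underlying data form a regular triangular algebra
(`IsHRTA.isRTA`), their tensor product underlies the tensor product of the Hopf data
(`toRTAData_tensor`), and the claims follow from those already proved (`isHRTA_of_isRTA`).
-/


namespace RTAlg

noncomputable section

set_option linter.unusedSectionVars false

/-! ### Linear algebra of finite tensor products -/

section LinAlg

/-- The device by which root spaces and weight spaces are computed: a family of subspaces of an
independent family which spans as much must be the whole family. -/
theorem eq_of_iSupIndep_of_le {F M I : Type*} [Field F] [AddCommGroup M] [Module F M]
    {U V : I → Submodule F M} (hV : iSupIndep V) (hUV : ∀ i, U i ≤ V i)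
    (h : ∀ i, V i ≤ ⨆ j, U j) (i : I) : U i = V i := by
  refine le_antisymm (hUV i) fun x hx => ?_
  have h1 : (⨆ j, U j) ≤ U i ⊔ ⨆ (j) (_ : j ≠ i), V j := by
    refine iSup_le fun j => ?_
    by_cases hj : j = i
    · subst hj; exact le_sup_left
    · exact le_sup_of_le_right (le_iSup₂_of_le j hj (hUV j))
  obtain ⟨y, hy, z, hz, rfl⟩ := Submodule.mem_sup.1 (h1 (h i hx))
  have hz' : z ∈ V i := by
    have := (V i).sub_mem hx (hUV i hy)
    simpa using this
  have : z = 0 := by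
    have := Submodule.disjoint_def.1 (hV i) z hz' hz
    exact this
  simpa [this] using hy

/-- Finitely many distinct characters can be separated from a given one. -/
theorem exists_interpolation {F H : Type*} [Field F] [Ring H] [Algebra F H]
    (χ : H →ₐ[F] F) (s : Finset (H →ₐ[F] F)) :
    ∃ h : H, χ h = 1 ∧ ∀ ψ ∈ s, ψ ≠ χ → ψ h = 0 := by
  classical
  induction s using Finset.induction_on with
  | empty => exact ⟨1, by simp, by simp⟩
  | insert ψ s hs ih =>
    obtain ⟨h, h1, h2⟩ := ih
    by_cases hψ : ψ = χ
    · refine ⟨h, h1, fun ψ' hψ' hne => ?_⟩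
      rcases Finset.mem_insert.1 hψ' with rfl | h'
      · exact absurd hψ hne
      · exact h2 ψ' h' hne
    · obtain ⟨x, hx⟩ : ∃ x, ψ x ≠ χ x := by
        by_contra hc
        push Not at hc
        exact hψ (AlgHom.ext hc)
      have hne : χ x - ψ x ≠ 0 := sub_ne_zero.2 (Ne.symm hx)
      refine ⟨h * ((χ x - ψ x)⁻¹ • (x - algebraMap F H (ψ x))), ?_, fun ψ' hψ' hne' => ?_⟩
      · simp [h1, hne]
      · rcases Finset.mem_insert.1 hψ' with rfl | h'
        · simp
        · simp [h2 ψ' h' hne']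

/-- The joint eigenspaces of a family of operators, for distinct systems of eigenvalues, are
independent. The operators need not commute: systems of eigenvalues are characters of the free
algebra. -/
theorem iSupIndep_jointEigen {F M X I : Type*} [Field F] [AddCommGroup M] [Module F M]
    (T : X → Module.End F M) (χ : I → X → F) (hχ : Function.Injective χ) (E : I → Submodule F M)
    (hE : ∀ i, ∀ m ∈ E i, ∀ x, T x m = χ i x • m) : iSupIndep E := by
  classical
  let ρ : FreeAlgebra F X →ₐ[F] Module.End F M := FreeAlgebra.lift F T
  have hρ : ∀ i, ∀ m ∈ E i, ∀ r, ρ r m = FreeAlgebra.lift F (χ i) r • m := by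
    intro i m hm r
    induction r using FreeAlgebra.induction with
    | grade0 r => simp [ρ]
    | grade1 x => simpa [ρ] using hE i m hm x
    | mul a b ha hb =>
      rw [map_mul, Module.End.mul_apply, hb, map_smul, ha, map_mul, smul_smul, mul_comm]
    | add a b ha hb => rw [map_add, LinearMap.add_apply, ha, hb, map_add, add_smul]
  refine iSupIndep_def.2 fun i => Submodule.disjoint_def.2 fun x hx hx' => ?_
  rw [iSup_subtype'] at hx'
  obtain ⟨s, hs⟩ := Submodule.mem_iSup_iff_exists_finset.1 hx'
  obtain ⟨h, h1, h2⟩ := exists_interpolation (FreeAlgebra.lift F (χ i))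
    (s.image fun c => FreeAlgebra.lift F (χ c.1))
  have h3 : (⨆ c ∈ s, E c.1) ≤ LinearMap.ker (ρ h) := by
    refine iSup₂_le fun c hc m hm => ?_
    rw [LinearMap.mem_ker, hρ _ m hm, h2 _ (Finset.mem_image_of_mem _ hc), zero_smul]
    exact fun e => c.2 (hχ ((FreeAlgebra.lift F).injective e))
  have h4 := hρ i x hx h
  rw [h1, one_smul] at h4
  rw [← h4]
  exact h3 hs

end LinAlg

section PiTensor

variable {ι : Type} [Fintype ι] [DecidableEq ι] {F : Type u} [Field F] {W : ι → Type u}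
  [∀ j, AddCommGroup (W j)] [∀ j, Module F (W j)]

/-- The image of `⨂ⱼ Uⱼ` in `⨂ⱼ Wⱼ`. -/
def tprodSpan (U : ∀ j, Submodule F (W j)) : Submodule F (⨂[F] j, W j) :=
  Submodule.span F (PiTensorProduct.tprod F '' {x | ∀ j, x j ∈ U j})

theorem tprod_mem_tprodSpan {U : ∀ j, Submodule F (W j)} {x : ∀ j, W j} (hx : ∀ j, x j ∈ U j) :
    PiTensorProduct.tprod F x ∈ tprodSpan U :=
  Submodule.subset_span ⟨x, hx, rfl⟩

theorem tprodSpan_mono {U V : ∀ j, Submodule F (W j)} (h : ∀ j, U j ≤ V j) :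
    tprodSpan U ≤ tprodSpan V :=
  Submodule.span_mono (Set.image_mono fun _ hx j => h j (hx j))

theorem tprodSpan_eq_range (U : ∀ j, Submodule F (W j)) :
    tprodSpan U = LinearMap.range (PiTensorProduct.map fun j => (U j).subtype) := by
  rw [PiTensorProduct.map_range_eq_span_tprod, tprodSpan]
  congr 1
  ext y
  constructor
  · rintro ⟨x, hx, rfl⟩
    exact ⟨fun j => ⟨x j, hx j⟩, rfl⟩
  · rintro ⟨x, rfl⟩
    exact ⟨fun j => x j, fun j => (x j).2, rfl⟩

theorem finiteDimensional_tprodSpan {U : ∀ j, Submodule F (W j)}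
    (h : ∀ j, FiniteDimensional F (U j)) : FiniteDimensional F (tprodSpan U) := by
  rw [tprodSpan_eq_range]
  infer_instance

theorem tprod_mem_of_mem_span {S : Submodule F (⨂[F] j, W j)} {s : ∀ j, Set (W j)}
    (h : ∀ x : ∀ j, W j, (∀ j, x j ∈ s j) → PiTensorProduct.tprod F x ∈ S)
    (x : ∀ j, W j) (hx : ∀ j, x j ∈ Submodule.span F (s j)) : PiTensorProduct.tprod F x ∈ S := by
  suffices H : ∀ t : Finset ι, ∀ x : ∀ j, W j, (∀ j ∈ t, x j ∈ Submodule.span F (s j)) →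
      (∀ j ∉ t, x j ∈ s j) → PiTensorProduct.tprod F x ∈ S from
    H Finset.univ x (fun j _ => hx j) (fun j hj => absurd (Finset.mem_univ j) hj)
  intro t
  induction t using Finset.induction_on with
  | empty => exact fun x _ hx => h x fun j => hx j (Finset.notMem_empty j)
  | insert k t hk ih =>
    intro x hx1 hx2
    have key : ∀ y ∈ Submodule.span F (s k),
        PiTensorProduct.tprod F (Function.update x k y) ∈ S := by
      intro y hy
      induction hy using Submodule.span_induction with
      | mem y hy =>
        refine ih _ (fun j hj => ?_) (fun j hj => ?_)
        · have : j ≠ k := fun e => hk (e ▸ hj)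
          rw [Function.update_of_ne this]
          exact hx1 j (Finset.mem_insert_of_mem hj)
        · by_cases e : j = k
          · subst e; simpa using hy
          · rw [Function.update_of_ne e]
            exact hx2 j (by simp [e, hj])
      | zero => rw [MultilinearMap.map_update_zero]; exact S.zero_mem
      | add a b _ _ ha hb => rw [MultilinearMap.map_update_add]; exact S.add_mem ha hb
      | smul c a _ ha => rw [MultilinearMap.map_update_smul]; exact S.smul_mem c ha
    have := key (x k) (hx1 k (Finset.mem_insert_self k t))
    rwa [Function.update_eq_self] at this

theorem tprodSpan_le_iSup {κ : ι → Type*} {U : ∀ j, Submodule F (W j)}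
    (V : ∀ j, κ j → Submodule F (W j)) (h : ∀ j, U j ≤ ⨆ k, V j k) :
    tprodSpan U ≤ ⨆ p : ∀ j, κ j, tprodSpan fun j => V j (p j) := by
  refine Submodule.span_le.2 ?_
  rintro _ ⟨x, hx, rfl⟩
  refine tprod_mem_of_mem_span (s := fun j => ⋃ k, (V j k : Set (W j))) (fun y hy => ?_) x
    fun j => ?_
  · choose p hp using fun j => Set.mem_iUnion.1 (hy j)
    exact Submodule.mem_iSup_of_mem p (tprod_mem_tprodSpan hp)
  · have := h j (hx j)
    rwa [Submodule.iSup_eq_span] at this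

theorem tprodSpan_top : tprodSpan (fun j => (⊤ : Submodule F (W j))) = ⊤ := by
  rw [← PiTensorProduct.span_tprod_eq_top, tprodSpan]
  congr 1
  ext; simp

/-- The tensor product of functionals. -/
def tprodDual (ψ : ∀ j, Module.Dual F (W j)) : Module.Dual F (⨂[F] j, W j) :=
  PiTensorProduct.lift ((MultilinearMap.mkPiAlgebra F ι F).compLinearMap ψ)

@[simp] theorem tprodDual_tprod (ψ : ∀ j, Module.Dual F (W j)) (x : ∀ j, W j) :
    tprodDual ψ (PiTensorProduct.tprod F x) = ∏ j, ψ j (x j) := by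
  simp [tprodDual]

/-- Evaluation of all tensor factors except the `j`-th one by the functionals `ψₖ`. -/
def evalExcept (j : ι) (ψ : ∀ k, Module.Dual F (W k)) : (⨂[F] k, W k) →ₗ[F] W j :=
  PiTensorProduct.lift <| MultilinearMap.mk' (fun x => (∏ k ∈ Finset.univ.erase j, ψ k (x k)) • x j)
    (fun x i a b => by
      by_cases h : i = j
      · subst h
        have : ∀ y, ∏ k ∈ Finset.univ.erase i, ψ k (Function.update x i y k) =
            ∏ k ∈ Finset.univ.erase i, ψ k (x k) := fun y =>
          Finset.prod_congr rfl fun k hk => by rw [Function.update_of_ne (Finset.ne_of_mem_erase hk)]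
        simp [this]
      · have hi : i ∈ Finset.univ.erase j := by simp [h]
        have : ∀ y, ∏ k ∈ Finset.univ.erase j, ψ k (Function.update x i y k) =
            ψ i y * ∏ k ∈ (Finset.univ.erase j).erase i, ψ k (x k) := fun y => by
          rw [← Finset.mul_prod_erase _ _ hi, Function.update_self]
          congr 1
          exact Finset.prod_congr rfl fun k hk => by
            rw [Function.update_of_ne (Finset.ne_of_mem_erase hk)]
        simp only [this, map_add, add_mul, add_smul, Function.update_of_ne (Ne.symm h)])
    (fun x i c a => by
      by_cases h : i = j
      · subst h
        have : ∀ y, ∏ k ∈ Finset.univ.erase i, ψ k (Function.update x i y k) =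
            ∏ k ∈ Finset.univ.erase i, ψ k (x k) := fun y =>
          Finset.prod_congr rfl fun k hk => by rw [Function.update_of_ne (Finset.ne_of_mem_erase hk)]
        simp [this, smul_comm c]
      · have hi : i ∈ Finset.univ.erase j := by simp [h]
        have : ∀ y, ∏ k ∈ Finset.univ.erase j, ψ k (Function.update x i y k) =
            ψ i y * ∏ k ∈ (Finset.univ.erase j).erase i, ψ k (x k) := fun y => by
          rw [← Finset.mul_prod_erase _ _ hi, Function.update_self]
          congr 1
          exact Finset.prod_congr rfl fun k hk => by
            rw [Function.update_of_ne (Finset.ne_of_mem_erase hk)]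
        simp only [this, map_smul, smul_eq_mul, mul_assoc, mul_smul,
          Function.update_of_ne (Ne.symm h)])

@[simp] theorem evalExcept_tprod (j : ι) (ψ : ∀ k, Module.Dual F (W k)) (x : ∀ j, W j) :
    evalExcept j ψ (PiTensorProduct.tprod F x) =
      (∏ k ∈ Finset.univ.erase j, ψ k (x k)) • x j := by
  simp [evalExcept]

theorem evalExcept_congr (j : ι) {ψ ψ' : ∀ k, Module.Dual F (W k)} (h : ∀ k ≠ j, ψ k = ψ' k) :
    evalExcept j ψ = evalExcept j ψ' := by
  refine PiTensorProduct.ext (MultilinearMap.ext fun x => ?_)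
  simp only [LinearMap.compMultilinearMap_apply, evalExcept_tprod]
  congr 1
  exact Finset.prod_congr rfl fun k hk => by rw [h k (Finset.ne_of_mem_erase hk)]

theorem apply_evalExcept (j : ι) (ψ : ∀ k, Module.Dual F (W k)) (z : ⨂[F] k, W k) :
    ψ j (evalExcept j ψ z) = tprodDual ψ z := by
  suffices H : ψ j ∘ₗ evalExcept j ψ = tprodDual ψ from DFunLike.congr_fun H z
  refine PiTensorProduct.ext (MultilinearMap.ext fun x => ?_)
  simp only [LinearMap.compMultilinearMap_apply, LinearMap.comp_apply, evalExcept_tprod, map_smul,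
    smul_eq_mul, tprodDual_tprod]
  rw [mul_comm, Finset.mul_prod_erase _ (fun k => ψ k (x k)) (Finset.mem_univ j)]

theorem evalExcept_mem (j : ι) (ψ : ∀ k, Module.Dual F (W k)) {U : ∀ j, Submodule F (W j)}
    {z : ⨂[F] k, W k} (hz : z ∈ tprodSpan U) : evalExcept j ψ z ∈ U j := by
  suffices H : tprodSpan U ≤ (U j).comap (evalExcept j ψ) from H hz
  refine Submodule.span_le.2 ?_
  rintro _ ⟨x, hx, rfl⟩
  simpa using (U j).smul_mem _ (hx j)

/-- Coordinates with respect to a product basis are products of coordinate functionals. -/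
theorem piTensorProduct_repr {κ : ι → Type*} (b : ∀ j, Module.Basis (κ j) F (W j))
    (z : ⨂[F] k, W k) (p : ∀ j, κ j) :
    (Basis.piTensorProduct b).repr z p = tprodDual (fun j => (b j).coord (p j)) z := by
  suffices H : (Basis.piTensorProduct b).coord p = tprodDual (fun j => (b j).coord (p j)) from
    DFunLike.congr_fun H z
  refine PiTensorProduct.ext (MultilinearMap.ext fun x => ?_)
  simp

theorem exists_evalExcept_ne_zero (j : ι) {z : ⨂[F] k, W k} (hz : z ≠ 0) :
    ∃ ψ, evalExcept j ψ z ≠ 0 := by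
  by_contra hc
  push Not at hc
  refine hz ((Basis.piTensorProduct fun k => Module.Basis.ofVectorSpace F (W k)).ext_elem fun p => ?_)
  rw [piTensorProduct_repr, ← apply_evalExcept j, hc]
  simp

/-- Every subspace has a basis that extends to a basis of the whole space. -/
theorem exists_adapted_basis {M : Type u} [AddCommGroup M] [Module F M] (U : Submodule F M) :
    ∃ (κ : Type u) (b : Module.Basis κ F M) (s : Set κ),
      (∀ k ∈ s, b k ∈ U) ∧ ∀ k ∉ s, ∀ x ∈ U, b.repr x k = 0 := by
  obtain ⟨C, hC⟩ := U.exists_isCompl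
  let b1 := Module.Basis.ofVectorSpace F U
  let b2 := Module.Basis.ofVectorSpace F C
  let e := U.prodEquivOfIsCompl C hC
  refine ⟨_, (b1.prod b2).map e, Set.range Sum.inl, ?_, ?_⟩
  · rintro _ ⟨k, rfl⟩
    simp [e]
  · rintro (k | k) hk x hx
    · exact absurd ⟨k, rfl⟩ hk
    · have : e.symm x = (⟨x, hx⟩, 0) := by
        rw [LinearEquiv.symm_apply_eq]; simp [e]
      simp [this]

/-- An element lies in `⨂ⱼ Uⱼ` as soon as all its one-factor evaluations lie in `Uⱼ`. -/
theorem mem_tprodSpan_of_evalExcept {U : ∀ j, Submodule F (W j)} {z : ⨂[F] k, W k}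
    (h : ∀ j ψ, evalExcept j ψ z ∈ U j) : z ∈ tprodSpan U := by
  choose κ b s hs hs' using fun j => exists_adapted_basis (U j)
  rw [← (Basis.piTensorProduct b).linearCombination_repr z]
  refine Submodule.finsuppSum_mem _ _ _ _ fun p hp => Submodule.smul_mem _ _ ?_
  rw [Basis.piTensorProduct_apply]
  refine tprod_mem_tprodSpan fun j => hs j _ ?_
  by_contra hj
  refine hp ?_
  rw [piTensorProduct_repr, ← apply_evalExcept j]
  exact hs' j _ hj _ (h j _)

theorem exists_finiteDimensional_mem_tprodSpan (z : ⨂[F] k, W k) :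
    ∃ U : ∀ j, Submodule F (W j), (∀ j, FiniteDimensional F (U j)) ∧ z ∈ tprodSpan U := by
  induction z using PiTensorProduct.induction_on with
  | smul_tprod r x =>
    exact ⟨fun j => Submodule.span F {x j}, fun j => inferInstance, Submodule.smul_mem _ _
      (tprod_mem_tprodSpan fun j => Submodule.mem_span_singleton_self _)⟩
  | add x y hx hy =>
    obtain ⟨U, hU, hxU⟩ := hx
    obtain ⟨V, hV, hyV⟩ := hy
    exact ⟨fun j => U j ⊔ V j, fun j => Submodule.finiteDimensional_sup _ _, Submodule.add_mem _
      (tprodSpan_mono (fun j => le_sup_left) hxU) (tprodSpan_mono (fun j => le_sup_right) hyV)⟩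

/-- Tensor products of separating families of functionals are separating. -/
theorem tprodDual_separating {X : ι → Type*} (φ : ∀ j, X j → Module.Dual F (W j))
    (h : ∀ j x, (∀ i, φ j i x = 0) → x = 0) {z : ⨂[F] k, W k}
    (hz : ∀ p : ∀ j, X j, tprodDual (fun j => φ j (p j)) z = 0) : z = 0 := by
  classical
  obtain ⟨U, hU, hzU⟩ := exists_finiteDimensional_mem_tprodSpan z
  rw [tprodSpan_eq_range] at hzU
  obtain ⟨y, rfl⟩ := hzU
  -- the restrictions of the functionals span the dual of `Uⱼ`
  have hspan : ∀ j, Submodule.span F (Set.range fun i => (φ j i).comp (U j).subtype) = ⊤ := by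
    intro j
    have := hU j
    have h1 : (Submodule.span F (Set.range fun i => (φ j i).comp (U j).subtype)).dualCoannihilator
        = ⊥ := by
      refine (Submodule.eq_bot_iff _).2 fun x hx => Subtype.ext (h j _ fun i => ?_)
      exact (Submodule.mem_dualCoannihilator _).1 hx _ (Submodule.subset_span ⟨i, rfl⟩)
    rw [← Subspace.dualCoannihilator_dualAnnihilator_eq
      (W := Submodule.span F (Set.range fun i => (φ j i).comp (U j).subtype)), h1]
    simp
  -- hence all product functionals vanish on `y`
  have hall : ∀ ψ : ∀ j, Module.Dual F (U j), tprodDual ψ y = 0 := by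
    let G : MultilinearMap F (fun j => Module.Dual F (U j)) F :=
      ((LinearMap.applyₗ y).comp PiTensorProduct.dualDistrib).compMultilinearMap
        (PiTensorProduct.tprod F)
    have hG : ∀ ψ, G ψ = tprodDual ψ y := by
      intro ψ
      suffices H : PiTensorProduct.dualDistrib (PiTensorProduct.tprod F ψ) = tprodDual ψ from
        DFunLike.congr_fun H y
      refine PiTensorProduct.ext (MultilinearMap.ext fun x => ?_)
      simp
    have : G = 0 := by
      refine MultilinearMap.ext_of_span_eq_top
        (g := fun j (i : X j) => (φ j i).comp (U j).subtype) hspan fun p => ?_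
      rw [hG, zero_apply, ← hz p]
      suffices H : tprodDual (fun j => (φ j (p j)).comp (U j).subtype) =
          (tprodDual fun j => φ j (p j)).comp (PiTensorProduct.map fun j => (U j).subtype) from
        DFunLike.congr_fun H y
      refine PiTensorProduct.ext (MultilinearMap.ext fun x => ?_)
      simp
    intro ψ
    rw [← hG, this]; rfl
  have : y = 0 := by
    refine (Basis.piTensorProduct fun k => Module.Basis.ofVectorSpace F (U k)).ext_elem fun p => ?_
    rw [piTensorProduct_repr, hall]
    simp
  rw [this, map_zero]

/-- The kernel of a tensor product of linear maps `πⱼ` is contained in the kernel of every map that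
kills the pure tensors with a factor in some `ker πⱼ`. -/
theorem eq_zero_of_map_eq_zero {W' : ι → Type u} [∀ j, AddCommGroup (W' j)] [∀ j, Module F (W' j)]
    {M : Type*} [AddCommGroup M] [Module F M]
    (π : ∀ j, W j →ₗ[F] W' j) (hπ : ∀ j, Function.Surjective (π j)) (g : (⨂[F] j, W j) →ₗ[F] M)
    (hg : ∀ (x : ∀ j, W j) (j : ι), π j (x j) = 0 → g (PiTensorProduct.tprod F x) = 0)
    {z : ⨂[F] j, W j} (hz : PiTensorProduct.map π z = 0) : g z = 0 := by
  choose σ hσ using fun j => (π j).exists_rightInverse_of_surjective (LinearMap.range_eq_top.2 (hπ j))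
  have hσ' : ∀ j y, π j (σ j y) = y := fun j y => DFunLike.congr_fun (hσ j) y
  have key : g = (g.comp (PiTensorProduct.map σ)).comp (PiTensorProduct.map π) := by
    refine PiTensorProduct.ext (MultilinearMap.ext fun x => ?_)
    simp only [LinearMap.compMultilinearMap_apply, LinearMap.comp_apply, PiTensorProduct.map_tprod]
    have H : ∀ t : Finset ι, g (PiTensorProduct.tprod F x) =
        g (PiTensorProduct.tprod F fun j => if j ∈ t then σ j (π j (x j)) else x j) := by
      intro t
      induction t using Finset.induction_on with
      | empty => simp
      | insert k t hk ih =>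
        rw [ih, ← sub_eq_zero, ← map_sub]
        have h1 : (fun j => if j ∈ t then σ j (π j (x j)) else x j) = Function.update
            (fun j => if j ∈ t then σ j (π j (x j)) else x j) k (x k) := by
          rw [eq_comm, Function.update_eq_self_iff]; simp [hk]
        have h2 : (fun j => if j ∈ insert k t then σ j (π j (x j)) else x j) = Function.update
            (fun j => if j ∈ t then σ j (π j (x j)) else x j) k (σ k (π k (x k))) := by
          ext j
          by_cases e : j = k
          · subst e; simp
          · simp [e]
        rw [h1, h2, ← MultilinearMap.map_update_sub]
        refine hg _ k ?_
        simp [hσ']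
    simpa using H Finset.univ
  rw [key, LinearMap.comp_apply, hz, map_zero]

theorem piTensorProduct_map_injective {W' : ι → Type u} [∀ j, AddCommGroup (W' j)]
    [∀ j, Module F (W' j)] (f : ∀ j, W j →ₗ[F] W' j) (hf : ∀ j, Function.Injective (f j)) :
    Function.Injective (PiTensorProduct.map f) := by
  choose g hg using fun j => (f j).exists_leftInverse_of_injective (LinearMap.ker_eq_bot.2 (hf j))
  have : (PiTensorProduct.map g).comp (PiTensorProduct.map f) = LinearMap.id := by
    rw [← PiTensorProduct.map_comp]
    simp [hg]
  exact Function.LeftInverse.injective (g := PiTensorProduct.map g)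
    fun x => DFunLike.congr_fun this x

theorem piTensorProduct_map_surjective {W' : ι → Type u} [∀ j, AddCommGroup (W' j)]
    [∀ j, Module F (W' j)] (f : ∀ j, W j →ₗ[F] W' j) (hf : ∀ j, Function.Surjective (f j)) :
    Function.Surjective (PiTensorProduct.map f) := by
  choose g hg using fun j => (f j).exists_rightInverse_of_surjective (LinearMap.range_eq_top.2 (hf j))
  have : (PiTensorProduct.map f).comp (PiTensorProduct.map g) = LinearMap.id := by
    rw [← PiTensorProduct.map_comp]
    simp [hg]
  exact Function.RightInverse.surjective (g := PiTensorProduct.map g)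
    fun x => DFunLike.congr_fun this x

theorem tprod_ne_zero {x : ∀ j, W j} (hx : ∀ j, x j ≠ 0) : PiTensorProduct.tprod F x ≠ 0 := by
  choose ψ hψ using fun j => Module.Projective.exists_dual_eq_one F (hx j)
  intro h
  have := tprodDual_tprod ψ x
  simp [h, hψ] at this

end PiTensor

/-! ### Tensor products of subalgebras, their characters and automorphisms -/

section TensorSub

variable {ι : Type} [Fintype ι] [DecidableEq ι] {F : Type u} [Field F] {A : ι → Type u}
  [∀ j, Ring (A j)] [∀ j, Algebra F (A j)]

theorem singleAlgHom_eq (j : ι) (a : A j) :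
    PiTensorProduct.singleAlgHom (R := F) j a = PiTensorProduct.tprod F (Pi.mulSingle j a) := rfl

theorem single_mul_tprod (j : ι) (a : A j) (x : ∀ j, A j) :
    PiTensorProduct.singleAlgHom (R := F) j a * PiTensorProduct.tprod F x =
      PiTensorProduct.tprod F (Function.update x j (a * x j)) := by
  rw [singleAlgHom_eq, PiTensorProduct.tprod_mul_tprod]
  congr 1
  ext k
  by_cases h : k = j
  · subst h; simp
  · simp [h]

theorem tprod_mul_single (j : ι) (a : A j) (x : ∀ j, A j) :
    PiTensorProduct.tprod F x * PiTensorProduct.singleAlgHom (R := F) j a =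
      PiTensorProduct.tprod F (Function.update x j (x j * a)) := by
  rw [singleAlgHom_eq, PiTensorProduct.tprod_mul_tprod]
  congr 1
  ext k
  by_cases h : k = j
  · subst h; simp
  · simp [h]

/-- A subalgebra containing the factors `xⱼ` contains the pure tensor. -/
theorem tprod_mem_of_single_mem (S : Subalgebra F (⨂[F] j, A j)) (x : ∀ j, A j)
    (h : ∀ j, PiTensorProduct.singleAlgHom (R := F) j (x j) ∈ S) :
    PiTensorProduct.tprod F x ∈ S := by
  suffices H : ∀ t : Finset ι, PiTensorProduct.tprod F (fun j => if j ∈ t then x j else 1) ∈ S by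
    simpa using H Finset.univ
  intro t
  induction t using Finset.induction_on with
  | empty =>
    simp only [Finset.notMem_empty, if_false]
    exact S.one_mem
  | insert k t hk ih =>
    have := S.mul_mem (h k) ih
    rw [single_mul_tprod] at this
    convert! this using 2
    ext j
    by_cases e : j = k
    · subst e; simp [hk]
    · simp [e]

theorem toSubmodule_tensorSub (S : ∀ j, Subalgebra F (A j)) :
    Subalgebra.toSubmodule (tensorSub S) = tprodSpan fun j => Subalgebra.toSubmodule (S j) := by
  refine le_antisymm ?_ ?_
  · let P : Subalgebra F (⨂[F] j, A j) :=
      (tprodSpan fun j => Subalgebra.toSubmodule (S j)).toSubalgebra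
        (tprod_mem_tprodSpan fun j => (S j).one_mem)
        (fun a b ha hb => by
          refine Submodule.span_induction₂ (p := fun a b _ _ =>
            a * b ∈ tprodSpan fun j => Subalgebra.toSubmodule (S j)) ?_ ?_ ?_ ?_ ?_ ?_ ?_ ha hb
          · rintro _ _ ⟨x, hx, rfl⟩ ⟨y, hy, rfl⟩
            rw [PiTensorProduct.tprod_mul_tprod]
            exact tprod_mem_tprodSpan fun j => (S j).mul_mem (hx j) (hy j)
          · intro y _; rw [zero_mul]; exact Submodule.zero_mem _
          · intro y _; rw [mul_zero]; exact Submodule.zero_mem _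
          · intro x y z _ _ _ h1 h2; rw [add_mul]; exact Submodule.add_mem _ h1 h2
          · intro x y z _ _ _ h1 h2; rw [mul_add]; exact Submodule.add_mem _ h1 h2
          · intro r x y _ _ h; rw [smul_mul_assoc]; exact Submodule.smul_mem _ _ h
          · intro r x y _ _ h; rw [mul_smul_comm]; exact Submodule.smul_mem _ _ h)
    have : tensorSub S ≤ P := by
      refine iSup_le fun j => ?_
      rintro _ ⟨x, hx, rfl⟩
      refine tprod_mem_tprodSpan fun k => ?_
      by_cases h : k = j
      · subst h; simpa using hx
      · simp [h]
    exact this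
  · refine Submodule.span_le.2 ?_
    rintro _ ⟨x, hx, rfl⟩
    exact tprod_mem_of_single_mem (tensorSub S) x fun j => (tensorIncl S j ⟨x j, hx j⟩).2

theorem mem_tensorSub {S : ∀ j, Subalgebra F (A j)} {z : ⨂[F] j, A j} :
    z ∈ tensorSub S ↔ z ∈ tprodSpan fun j => Subalgebra.toSubmodule (S j) := by
  rw [← toSubmodule_tensorSub, Subalgebra.mem_toSubmodule]

theorem single_mem_tensorSub {S : ∀ j, Subalgebra F (A j)} {j : ι} {a : A j} (ha : a ∈ S j) :
    PiTensorProduct.singleAlgHom (R := F) j a ∈ tensorSub S :=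
  (tensorIncl S j ⟨a, ha⟩).2

theorem exists_dual_one (B : Type u) [Ring B] [Algebra F B] [Nontrivial B] :
    ∃ ψ : Module.Dual F B, ψ 1 = 1 :=
  Module.Projective.exists_dual_eq_one F one_ne_zero

theorem evalExcept_single (j : ι) (ψ : ∀ k, Module.Dual F (A k)) (hψ : ∀ k, ψ k 1 = 1) (a : A j) :
    evalExcept j ψ (PiTensorProduct.singleAlgHom (R := F) j a) = a := by
  rw [singleAlgHom_eq, evalExcept_tprod, Finset.prod_eq_one, one_smul, Pi.mulSingle_eq_same]
  intro k hk
  rw [Pi.mulSingle_eq_of_ne (Finset.ne_of_mem_erase hk), hψ]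

theorem singleAlgHom_injective [∀ j, Nontrivial (A j)] (j : ι) :
    Function.Injective (PiTensorProduct.singleAlgHom (R := F) (A := A) j) := by
  choose ψ hψ using fun k => exists_dual_one (F := F) (A k)
  exact Function.LeftInverse.injective (g := evalExcept j ψ) fun a => evalExcept_single j ψ hψ a

theorem tensorSub_le_iff [∀ j, Nontrivial (A j)] {S T : ∀ j, Subalgebra F (A j)} :
    tensorSub S ≤ tensorSub T ↔ ∀ j, S j ≤ T j := by
  choose ψ hψ using fun k => exists_dual_one (F := F) (A k)
  refine ⟨fun h j a ha => ?_, fun h => iSup_mono fun j => Subalgebra.map_mono (h j)⟩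
  have := evalExcept_mem j ψ (mem_tensorSub.1 (h (single_mem_tensorSub ha)))
  rwa [evalExcept_single j ψ hψ] at this

theorem tensorSub_eq_iff [∀ j, Nontrivial (A j)] {S T : ∀ j, Subalgebra F (A j)} :
    tensorSub S = tensorSub T ↔ ∀ j, S j = T j := by
  simp only [le_antisymm_iff, tensorSub_le_iff, forall_and]

/-- The tensor product of algebra maps. -/
def piMapAlgHom {B : ι → Type u} [∀ j, Ring (B j)] [∀ j, Algebra F (B j)]
    (f : ∀ j, A j →ₐ[F] B j) : (⨂[F] j, A j) →ₐ[F] ⨂[F] j, B j :=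
  PiTensorProduct.liftAlgHom
    ((PiTensorProduct.tprod F).compLinearMap fun j => (f j).toLinearMap)
    (by
      simp only [MultilinearMap.compLinearMap_apply, Pi.one_apply, AlgHom.toLinearMap_apply,
        map_one]
      rfl)
    (fun x y => by
      simp only [MultilinearMap.compLinearMap_apply, Pi.mul_apply, AlgHom.toLinearMap_apply,
        map_mul, PiTensorProduct.tprod_mul_tprod]
      rfl)

theorem piMapAlgHom_tprod {B : ι → Type u} [∀ j, Ring (B j)] [∀ j, Algebra F (B j)]
    (f : ∀ j, A j →ₐ[F] B j) (x : ∀ j, A j) :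
    piMapAlgHom f (PiTensorProduct.tprod F x) = PiTensorProduct.tprod F fun j => f j (x j) :=
  PiTensorProduct.lift.tprod _

theorem piMapAlgHom_single {B : ι → Type u} [∀ j, Ring (B j)] [∀ j, Algebra F (B j)]
    (f : ∀ j, A j →ₐ[F] B j) (j : ι) (a : A j) :
    piMapAlgHom f (PiTensorProduct.singleAlgHom j a) =
      PiTensorProduct.singleAlgHom (R := F) j (f j a) := by
  rw [singleAlgHom_eq, piMapAlgHom_tprod, singleAlgHom_eq]
  congr 1
  ext k
  by_cases h : k = j
  · subst h; simp
  · simp [h]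

theorem tprod_coe_mem_tensorSub (S : ∀ j, Subalgebra F (A j)) (x : ∀ j, S j) :
    PiTensorProduct.tprod F (fun j => (x j : A j)) ∈ tensorSub S :=
  mem_tensorSub.2 (tprod_mem_tprodSpan fun j => (x j).2)

/-- The isomorphism from the abstract tensor product of the subalgebras `Sⱼ` to the
subalgebra `⨂ⱼ Sⱼ` of `⨂ⱼ Aⱼ`. -/
def tensorSubEquiv (S : ∀ j, Subalgebra F (A j)) : (⨂[F] j, S j) ≃ₐ[F] tensorSub S :=
  AlgEquiv.ofBijective ((piMapAlgHom fun j => (S j).val).codRestrict (tensorSub S) fun z => by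
      induction z using PiTensorProduct.induction_on with
      | smul_tprod r x =>
        rw [map_smul, piMapAlgHom_tprod]
        exact Subalgebra.smul_mem _ (tprod_coe_mem_tensorSub S x) r
      | add x y hx hy => rw [map_add]; exact Subalgebra.add_mem _ hx hy)
    ⟨(AlgHom.injective_codRestrict _ _ _).2 (piTensorProduct_map_injective
        (fun j => (S j).val.toLinearMap) fun j => Subtype.val_injective), fun ⟨z, hz⟩ => by
      rw [mem_tensorSub, tprodSpan_eq_range] at hz
      obtain ⟨y, rfl⟩ := hz
      exact ⟨y, rfl⟩⟩

theorem coe_tensorSubEquiv (S : ∀ j, Subalgebra F (A j)) (z : ⨂[F] j, S j) :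
    (tensorSubEquiv S z : ⨂[F] j, A j) = piMapAlgHom (fun j => (S j).val) z := rfl

theorem tensorSubEquiv_single (S : ∀ j, Subalgebra F (A j)) (j : ι) (x : S j) :
    tensorSubEquiv S (PiTensorProduct.singleAlgHom j x) = tensorIncl S j x :=
  Subtype.ext (by rw [coe_tensorSubEquiv, piMapAlgHom_single]; rfl)

theorem tensorSubEquiv_tprod (S : ∀ j, Subalgebra F (A j)) (x : ∀ j, S j) :
    tensorSubEquiv S (PiTensorProduct.tprod F x) = ⟨_, tprod_coe_mem_tensorSub S x⟩ :=
  Subtype.ext (by rw [coe_tensorSubEquiv, piMapAlgHom_tprod]; rfl)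

theorem tensorSub_algHom_ext {S : ∀ j, Subalgebra F (A j)} {R : Type*} [Semiring R] [Algebra F R]
    {f g : tensorSub S →ₐ[F] R} (h : ∀ j x, f (tensorIncl S j x) = g (tensorIncl S j x)) :
    f = g := by
  have : f.comp (tensorSubEquiv S).toAlgHom = g.comp (tensorSubEquiv S).toAlgHom := by
    refine PiTensorProduct.algHom_ext fun j => AlgHom.ext fun x => ?_
    have := h j x
    rw [← tensorSubEquiv_single] at this
    exact this
  ext x
  obtain ⟨y, rfl⟩ := (tensorSubEquiv S).surjective x
  exact DFunLike.congr_fun this y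

/-- The character `⨂ⱼ wⱼ` of `⨂ⱼ Kⱼ`. -/
def piWeight {K : ι → Type u} [∀ j, Ring (K j)] [∀ j, Algebra F (K j)] (w : ∀ j, K j →ₐ[F] F) :
    (⨂[F] j, K j) →ₐ[F] F :=
  PiTensorProduct.liftAlgHom
    ((MultilinearMap.mkPiAlgebra F ι F).compLinearMap fun j => (w j).toLinearMap)
    (by simp) (fun x y => by simp [Finset.prod_mul_distrib])

theorem piWeight_tprod {K : ι → Type u} [∀ j, Ring (K j)] [∀ j, Algebra F (K j)]
    (w : ∀ j, K j →ₐ[F] F) (x : ∀ j, K j) :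
    piWeight w (PiTensorProduct.tprod F x) = ∏ j, w j (x j) :=
  PiTensorProduct.lift.tprod _

theorem piWeight_single {K : ι → Type u} [∀ j, Ring (K j)] [∀ j, Algebra F (K j)]
    (w : ∀ j, K j →ₐ[F] F) (j : ι) (x : K j) :
    piWeight w (PiTensorProduct.singleAlgHom j x) = w j x := by
  rw [singleAlgHom_eq, piWeight_tprod, Finset.prod_eq_single j]
  · simp
  · intro k _ hk; simp [hk]
  · simp

/-- The character of the subalgebra `⨂ⱼ Sⱼ` with components `wⱼ`. -/
def tensorWeight (S : ∀ j, Subalgebra F (A j)) (w : ∀ j, S j →ₐ[F] F) : tensorSub S →ₐ[F] F :=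
  (piWeight w).comp (tensorSubEquiv S).symm.toAlgHom

theorem tensorWeight_incl (S : ∀ j, Subalgebra F (A j)) (w : ∀ j, S j →ₐ[F] F) (j : ι) (x : S j) :
    tensorWeight S w (tensorIncl S j x) = w j x := by
  rw [← tensorSubEquiv_single]
  exact (congrArg (piWeight w) ((tensorSubEquiv S).symm_apply_apply _)).trans (piWeight_single w j x)

theorem apply_tprod_coe (S : ∀ j, Subalgebra F (A j)) (w : tensorSub S →ₐ[F] F) (x : ∀ j, S j) :
    w ⟨_, tprod_coe_mem_tensorSub S x⟩ = ∏ j, w (tensorIncl S j (x j)) := by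
  have : w = tensorWeight S fun j => w.comp (tensorIncl S j) :=
    tensorSub_algHom_ext fun j x =>
      (tensorWeight_incl S (fun j => w.comp (tensorIncl S j)) j x).symm
  conv_lhs => rw [this, ← tensorSubEquiv_tprod]
  exact (congrArg (piWeight _) ((tensorSubEquiv S).symm_apply_apply _)).trans (piWeight_tprod _ x)

/-- The characters of `⨂ⱼ Sⱼ` are the tuples of characters of the `Sⱼ`. -/
theorem bijective_comp_tensorIncl (S : ∀ j, Subalgebra F (A j)) :
    Function.Bijective fun (w : tensorSub S →ₐ[F] F) j => AlgHom.comp w (tensorIncl S j) :=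
  ⟨fun _ _ h => tensorSub_algHom_ext fun j x => DFunLike.congr_fun (congrFun h j) x,
    fun w => ⟨tensorWeight S w, funext fun j => AlgHom.ext fun x => tensorWeight_incl S w j x⟩⟩

theorem tensorIncl_injective [∀ j, Nontrivial (A j)] (S : ∀ j, Subalgebra F (A j)) (j : ι) :
    Function.Injective (tensorIncl S j) := fun _ _ h =>
  Subtype.ext (singleAlgHom_injective (F := F) j (congrArg Subtype.val h))

/-- The tensor product of algebra automorphisms of abstract algebras. -/
def piAut {K : ι → Type u} [∀ j, Ring (K j)] [∀ j, Algebra F (K j)] (θ : ∀ j, K j ≃ₐ[F] K j) :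
    (⨂[F] j, K j) ≃ₐ[F] ⨂[F] j, K j :=
  AlgEquiv.ofAlgHom (piMapAlgHom fun j => (θ j).toAlgHom) (piMapAlgHom fun j => (θ j).symm.toAlgHom)
    (PiTensorProduct.algHom_ext fun j => AlgHom.ext fun x => by
      rw [AlgHom.comp_apply, AlgHom.comp_apply, piMapAlgHom_single, piMapAlgHom_single]
      exact congrArg _ ((θ j).apply_symm_apply x))
    (PiTensorProduct.algHom_ext fun j => AlgHom.ext fun x => by
      rw [AlgHom.comp_apply, AlgHom.comp_apply, piMapAlgHom_single, piMapAlgHom_single]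
      exact congrArg _ ((θ j).symm_apply_apply x))

theorem tensorSub_aut_ext {S : ∀ j, Subalgebra F (A j)} {θ θ' : tensorSub S ≃ₐ[F] tensorSub S}
    (h : ∀ j x, θ (tensorIncl S j x) = θ' (tensorIncl S j x)) : θ = θ' := by
  have := tensorSub_algHom_ext (f := θ.toAlgHom) (g := θ'.toAlgHom) h
  ext x
  exact congrArg Subtype.val (DFunLike.congr_fun this x)

/-- The automorphism of the subalgebra `⨂ⱼ Sⱼ` with components `θⱼ`, as a group homomorphism. -/
def tensorAut (S : ∀ j, Subalgebra F (A j)) :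
    (∀ j, S j ≃ₐ[F] S j) →* (tensorSub S ≃ₐ[F] tensorSub S) :=
  MonoidHom.mk' (fun θ => (tensorSubEquiv S).symm.trans ((piAut θ).trans (tensorSubEquiv S)))
    fun θ θ' => tensorSub_aut_ext fun j x => by
      simp only [← tensorSubEquiv_single, AlgEquiv.trans_apply, AlgEquiv.symm_apply_apply,
        AlgEquiv.mul_apply, piAut, AlgEquiv.ofAlgHom_apply, piMapAlgHom_single]
      rfl

theorem tensorAut_incl (S : ∀ j, Subalgebra F (A j)) (θ : ∀ j, S j ≃ₐ[F] S j) (j : ι) (x : S j) :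
    tensorAut S θ (tensorIncl S j x) = tensorIncl S j (θ j x) := by
  simp only [tensorAut, MonoidHom.mk'_apply, ← tensorSubEquiv_single, AlgEquiv.trans_apply,
    AlgEquiv.symm_apply_apply, piAut, AlgEquiv.ofAlgHom_apply, piMapAlgHom_single]
  rfl

theorem coe_tensorAut_tprod (S : ∀ j, Subalgebra F (A j)) (θ : ∀ j, S j ≃ₐ[F] S j) (x : ∀ j, S j) :
    (tensorAut S θ ⟨_, tprod_coe_mem_tensorSub S x⟩ : ⨂[F] j, A j) =
      PiTensorProduct.tprod F fun j => (θ j (x j) : A j) := by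
  rw [← tensorSubEquiv_tprod]
  simp only [tensorAut, MonoidHom.mk'_apply, AlgEquiv.trans_apply,
    AlgEquiv.symm_apply_apply, piAut, AlgEquiv.ofAlgHom_apply, piMapAlgHom_tprod]
  rw [tensorSubEquiv_tprod]
  rfl

theorem tensorAut_injective [∀ j, Nontrivial (A j)] (S : ∀ j, Subalgebra F (A j)) :
    Function.Injective (tensorAut S) := fun θ θ' h => funext fun j => AlgEquiv.ext fun x =>
  tensorIncl_injective S j (by rw [← tensorAut_incl, h, tensorAut_incl])

end TensorSub

/-! ### Weight spaces and root spaces -/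

section Weights

variable {F A : Type u} [Field F] [Ring A] [Algebra F A]

section Module

variable {V : Type u} [AddCommGroup V] [Module F V] [Module A V] [IsScalarTower F A V]

theorem mem_weightSpace {H : Subalgebra F A} {w : H →ₐ[F] F} {x : V} :
    x ∈ weightSpace H V w ↔ ∀ h : H, (h : A) • x = w h • x := Iff.rfl

theorem iSupIndep_weightSpace (H : Subalgebra F A) : iSupIndep fun w => weightSpace H V w :=
  iSupIndep_jointEigen (fun h : H => Algebra.lsmul F F V (h : A))
    (fun (w : H →ₐ[F] F) (h : H) => w h) (fun _ _ h => AlgHom.ext (congrFun h))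
    (fun w => weightSpace H V w) fun _ _ hm h => mem_weightSpace.1 hm h

/-- An `H`-stable subspace contains the weight components of its elements. -/
theorem mem_iSup_inf_weightSpace (H : Subalgebra F A) (N : Submodule F V)
    (hN : ∀ h : H, ∀ x ∈ N, (h : A) • x ∈ N) {x : V} (hx : x ∈ N)
    (hx' : x ∈ ⨆ w, weightSpace H V w) : x ∈ ⨆ w, N ⊓ weightSpace H V w := by
  classical
  obtain ⟨s, hs⟩ := Submodule.mem_iSup_iff_exists_finset.1 hx'
  obtain ⟨μ, rfl⟩ := (Submodule.mem_iSup_finset_iff_exists_sum _ _).1 hs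
  refine Submodule.sum_mem _ fun w hw => Submodule.mem_iSup_of_mem w ⟨?_, (μ w).2⟩
  obtain ⟨h, h1, h2⟩ := exists_interpolation w s
  have := hN h _ hx
  rw [Finset.smul_sum, Finset.sum_eq_single w] at this
  · rwa [mem_weightSpace.1 (μ w).2 h, h1, one_smul] at this
  · intro χ hχ hne
    rw [mem_weightSpace.1 (μ χ).2 h, h2 χ hχ hne, zero_smul]
  · exact fun h => absurd hw h

theorem exists_weight_vector {H : Subalgebra F A} {N : Submodule F V}
    (hN : ∀ h : H, ∀ x ∈ N, (h : A) • x ∈ N) (hne : N ≠ ⊥) (hV : N ≤ ⨆ w, weightSpace H V w) :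
    ∃ w, ∃ x ∈ N, x ≠ 0 ∧ x ∈ weightSpace H V w := by
  by_contra hc
  push Not at hc
  refine hne ((Submodule.eq_bot_iff _).2 fun x hx => ?_)
  have := mem_iSup_inf_weightSpace H N hN hx (hV hx)
  have h0 : ∀ w, N ⊓ weightSpace H V w = ⊥ := fun w =>
    (Submodule.eq_bot_iff _).2 fun y hy => by
      by_contra h
      exact hc w y hy.1 h hy.2
  simpa [h0] using this

end Module

theorem TriData.mulMap_tmul (T : TriData F A) (b : T.Bm) (h : T.H1) (c : T.Bp) :
    T.mulMap (b ⊗ₜ (h ⊗ₜ c)) = (b : A) * (h * c) := by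
  simp [TriData.mulMap]

namespace TriData.IsTriangular

variable {T : TriData F A} (hT : T.IsTriangular)
include hT

/-- Linear maps out of `A` can be prescribed on products `b * (h * c)`. -/
theorem exists_lift {V : Type u} [AddCommGroup V] [Module F V]
    (f : T.Bm →ₗ[F] T.H1 →ₗ[F] T.Bp →ₗ[F] V) :
    ∃ P : A →ₗ[F] V, ∀ (b : T.Bm) (h : T.H1) (c : T.Bp), P ((b : A) * (h * c)) = f b h c := by
  let e := LinearEquiv.ofBijective T.mulMap hT.bijective
  refine ⟨(TensorProduct.lift ((TensorProduct.lift.equiv (RingHom.id F) T.H1 T.Bp V).toLinearMap.comp f)).comp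
    e.symm.toLinearMap, fun b h c => ?_⟩
  rw [← T.mulMap_tmul]
  change TensorProduct.lift _ (e.symm (e _)) = _
  rw [e.symm_apply_apply]
  simp

theorem induction_on {p : A → Prop} (hmul : ∀ (b : T.Bm) (h : T.H1) (c : T.Bp), p ((b : A) * (h * c)))
    (hadd : ∀ a b, p a → p b → p (a + b)) (a : A) : p a := by
  obtain ⟨x, rfl⟩ := hT.bijective.2 a
  induction x using TensorProduct.induction_on with
  | zero => simpa using hmul 0 0 0
  | add x y hx hy => rw [map_add]; exact hadd _ _ hx hy
  | tmul b y =>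
    induction y using TensorProduct.induction_on with
    | zero => simpa using hmul 0 0 0
    | add x y hx hy => rw [TensorProduct.tmul_add, map_add]; exact hadd _ _ hx hy
    | tmul h c => rw [T.mulMap_tmul]; exact hmul b h c

/-- Root spaces of `B⁺` for distinct automorphisms are independent, because `H₁ ⊗ B⁺ → A` is
injective. -/
theorem iSupIndep_rootSpace (H : Subalgebra F A) (hH : H ≤ T.H1) :
    iSupIndep fun θ : H ≃ₐ[F] H => Subalgebra.toSubmodule T.Bp ⊓ rootSpace H θ := by
  have := hT.nontrivial
  -- for a functional `φ` on `H₁` there is a map `P φ` on `A` with `P φ (h * c) = φ h • c`; the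
  -- operators `a ↦ P φ (a * h)` act on the root space of `θ` as the scalars `φ (θ h)`, and these
  -- scalars determine `θ`
  obtain ⟨ψ, hψ⟩ := exists_dual_one (F := F) T.Bm
  have hP : ∀ φ : Module.Dual F T.H1, ∃ P : A →ₗ[F] A, ∀ (h : T.H1) (c : T.Bp),
      P ((h : A) * c) = φ h • (c : A) := by
    intro φ
    obtain ⟨P, hP⟩ := hT.exists_lift (V := A) (LinearMap.mk₂ F
      (fun b h => (ψ b * φ h) • T.Bp.val.toLinearMap)
      (fun a b c => by rw [map_add, add_mul, add_smul])
      (fun r a b => by rw [map_smul, smul_smul, smul_eq_mul, mul_assoc])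
      (fun a b c => by rw [map_add, mul_add, add_smul])
      (fun r a b => by rw [map_smul, smul_smul, smul_eq_mul, mul_left_comm]))
    refine ⟨P, fun h c => ?_⟩
    have := hP 1 h c
    simpa [hψ] using this
  choose P hP using hP
  refine iSupIndep_jointEigen
    (fun x : Module.Dual F T.H1 × H => (P x.1).comp (LinearMap.mulRight F (x.2 : A)))
    (fun θ x => x.1 (Subalgebra.inclusion hH (θ x.2))) ?_ _ ?_
  · intro θ θ' h
    ext x
    refine congrArg Subtype.val (Subalgebra.inclusion_injective hH ?_)
    rw [← sub_eq_zero, ← Module.forall_dual_apply_eq_zero_iff F]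
    intro φ
    rw [map_sub, sub_eq_zero]
    exact congrFun h (φ, x)
  · rintro θ a ⟨ha, ha'⟩ ⟨φ, h⟩
    have e : a * (h : A) = (θ h : A) * a := ha' h
    simp only [LinearMap.comp_apply, LinearMap.mulRight_apply, e]
    exact hP φ (Subalgebra.inclusion hH (θ h)) ⟨a, ha⟩

end TriData.IsTriangular

end Weights

/-! ### Structure of a regular triangular algebra -/

namespace RTAData

variable {F A : Type u} [Field F] [Ring A] [Algebra F A] {D : RTAData F A}

/-- `θ₁` restricts to `θ₀`. -/
def Restricts (D : RTAData F A) (θ₁ : D.H1 ≃ₐ[F] D.H1) (θ₀ : D.H0 ≃ₐ[F] D.H0) : Prop :=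
  ∀ h : D.H0, θ₁ (Subalgebra.inclusion D.H0_le h) = Subalgebra.inclusion D.H0_le (θ₀ h)

theorem BpRoot1_le {θ₁ : D.H1 ≃ₐ[F] D.H1} {θ₀ : D.H0 ≃ₐ[F] D.H0} (h : D.Restricts θ₁ θ₀) :
    D.BpRoot1 θ₁ ≤ D.BpRoot0 θ₀ := by
  rintro a ⟨ha, ha'⟩
  refine ⟨ha, fun x => ?_⟩
  have h1 : a * (x : A) = _ := ha' (Subalgebra.inclusion D.H0_le x)
  rw [h x] at h1
  exact h1

theorem mul_mem_BpRoot0 {θ θ' : D.H0 ≃ₐ[F] D.H0} {a b : A} (ha : a ∈ D.BpRoot0 θ)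
    (hb : b ∈ D.BpRoot0 θ') : a * b ∈ D.BpRoot0 (θ * θ') := by
  refine ⟨D.Bp.mul_mem ha.1 hb.1, fun h => ?_⟩
  have h1 : b * (h : A) = θ' h * b := hb.2 h
  have h2 : a * (θ' h : A) = θ (θ' h) * a := ha.2 (θ' h)
  rw [mul_assoc, h1, ← mul_assoc, h2, mul_assoc]
  rfl

namespace IsRTA

variable (hD : D.IsRTA)
include hD

theorem iSupIndep_BpRoot0 : iSupIndep fun θ => D.BpRoot0 θ :=
  hD.triangular.iSupIndep_rootSpace D.H0 D.H0_le

/-- An `H₀`-root space is the sum of the `H₁`-root spaces in it. -/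
theorem BpRoot0_eq (θ₀ : D.H0 ≃ₐ[F] D.H0) :
    D.BpRoot0 θ₀ = ⨆ (θ₁ : D.Q1) (_ : D.Restricts θ₁ θ₀), D.BpRoot1 θ₁ := by
  refine (eq_of_iSupIndep_of_le (U := fun θ₀ => ⨆ (θ₁ : D.Q1) (_ : D.Restricts θ₁ θ₀), D.BpRoot1 θ₁)
    hD.iSupIndep_BpRoot0 (fun θ₀ => iSup₂_le fun θ₁ h => BpRoot1_le h) (fun θ₀ => ?_) θ₀).symm
  refine le_trans (inf_le_left.trans hD.decomp.2.ge) (iSup_le fun θ₁ => ?_)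
  obtain ⟨θ₀, h0, h1⟩ := θ₁.2
  exact le_iSup_of_le θ₀ (le_iSup₂_of_le θ₁ h1 le_rfl)

theorem Bp_le : Subalgebra.toSubmodule D.Bp ≤ Submodule.span F {1} ⊔ D.Np := by
  refine hD.decomp.2.ge.trans (iSup_le fun θ₁ => ?_)
  obtain ⟨θ₀, h0, h1⟩ := θ₁.2
  refine (BpRoot1_le h1).trans ?_
  by_cases h : θ₀ = 1
  · rw [h, hD.root_one]; exact le_sup_left
  · exact le_sup_of_le_right (le_iSup (fun θ : {θ : D.H0 ≃ₐ[F] D.H0 // θ ∈ D.Q0 ∧ θ ≠ 1} =>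
      D.BpRoot0 θ) ⟨θ₀, h0, h⟩)

omit hD in
theorem Np_le : D.Np ≤ Subalgebra.toSubmodule D.Bp := iSup_le fun _ => inf_le_left

theorem mul_mem_Np {b n : A} (hb : b ∈ D.Bp) (hn : n ∈ D.Np) : b * n ∈ D.Np := by
  have h2 : ∀ m ∈ D.Np, m * n ∈ D.Np := by
    intro m hm
    have : D.Np * D.Np ≤ D.Np := by
      conv_lhs => rw [Np, Submodule.iSup_mul]
      refine iSup_le fun θ => ?_
      rw [Np, Submodule.mul_iSup]
      refine iSup_le fun θ' => Submodule.mul_le.2 fun a ha b hb => ?_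
      exact Submodule.mem_iSup_of_mem (p := fun θ : {θ : D.H0 ≃ₐ[F] D.H0 // θ ∈ D.Q0 ∧ θ ≠ 1} =>
        D.BpRoot0 θ) ⟨θ.1 * θ'.1, hD.positive.mul_mem _ θ.2.1 _ θ'.2.1,
          hD.positive.mul_ne_one _ θ.2.1 _ θ'.2.1 θ.2.2 θ'.2.2⟩ (mul_mem_BpRoot0 ha hb)
    exact this (Submodule.mul_mem_mul hm hn)
  obtain ⟨y, hy, z, hz, rfl⟩ := Submodule.mem_sup.1 (hD.Bp_le hb)
  obtain ⟨c, rfl⟩ := Submodule.mem_span_singleton.1 hy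
  rw [add_mul, smul_mul_assoc, one_mul]
  exact D.Np.add_mem (D.Np.smul_mem c hn) (h2 z hz)

/-- The projection of `B⁺` onto `F · 1` along `N⁺`. -/
theorem exists_counit : ∃ ε : Module.Dual F A, ε 1 = 1 ∧ ∀ n ∈ D.Np, ε n = 0 := by
  have := hD.triangular.nontrivial
  have h1 : (1 : A) ∉ D.Np := by
    intro h
    have h2 : D.Np ≤ ⨆ (θ) (_ : θ ≠ 1), D.BpRoot0 θ :=
      iSup_le fun θ => le_iSup₂_of_le θ.1 θ.2.2 le_rfl
    have h3 : (1 : A) ∈ D.BpRoot0 1 := by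
      rw [hD.root_one]; exact Submodule.mem_span_singleton_self 1
    exact one_ne_zero (Submodule.disjoint_def.1 (hD.iSupIndep_BpRoot0 1) 1 h3 (h2 h))
  obtain ⟨f, hf, hf'⟩ := Submodule.exists_dual_map_eq_bot_of_notMem h1 inferInstance
  refine ⟨(f 1)⁻¹ • f, by simp [hf], fun n hn => ?_⟩
  have : f n ∈ D.Np.map f := ⟨n, hn, rfl⟩
  rw [hf', Submodule.mem_bot] at this
  simp [this]

end IsRTA

/-! ### Maximal vectors and Verma modules -/

section Module

variable {V : Type u} [AddCommGroup V] [Module F V] [Module A V] [IsScalarTower F A V]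

/-- `v` is a vector of weight `w` which is killed by `N⁺`. -/
structure IsMaxVec (D : RTAData F A) (w : D.H1 →ₐ[F] F) (v : V) : Prop where
  weight : v ∈ weightSpace D.H1 V w
  np : ∀ n ∈ D.Np, n • v = 0

theorem isMaxVec_mk (w : D.H1 →ₐ[F] F) :
    D.IsMaxVec w (Submodule.Quotient.mk (1 : A) : D.Verma w) where
  weight h := by
    rw [← Submodule.Quotient.mk_smul, ← Submodule.Quotient.mk_smul, Submodule.Quotient.eq]
    refine Submodule.mem_sup_right (Submodule.subset_span ⟨h - algebraMap F D.H1 (w h), ?_, ?_⟩)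
    · simp
    · simp [Algebra.algebraMap_eq_smul_one]
  np n hn := by
    rw [← Submodule.Quotient.mk_smul, Submodule.Quotient.mk_eq_zero]
    refine Submodule.mem_sup_left ?_
    rw [smul_eq_mul, mul_one]
    exact Submodule.subset_span hn

theorem IsMaxVec.vermaIdeal_le {w : D.H1 →ₐ[F] F} {v : V} (hv : D.IsMaxVec w v) :
    D.vermaIdeal w ≤ LinearMap.ker (LinearMap.toSpanSingleton A V v) := by
  refine sup_le (Submodule.span_le.2 fun n hn => ?_) (Submodule.span_le.2 ?_)
  · exact hv.np n hn
  · rintro _ ⟨h, hh, rfl⟩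
    exact (hv.weight h).trans (by rw [hh, zero_smul])

/-- The universal property of the Verma module. -/
def vermaMap {w : D.H1 →ₐ[F] F} {v : V} (hv : D.IsMaxVec w v) : D.Verma w →ₗ[A] V :=
  Submodule.liftQ _ (LinearMap.toSpanSingleton A V v) hv.vermaIdeal_le

theorem vermaMap_mk {w : D.H1 →ₐ[F] F} {v : V} (hv : D.IsMaxVec w v) (a : A) :
    vermaMap hv (Submodule.Quotient.mk a) = a • v := rfl

theorem mk_eq_smul_mk_one (w : D.H1 →ₐ[F] F) (a : A) :
    (Submodule.Quotient.mk a : D.Verma w) = a • Submodule.Quotient.mk (1 : A) := by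
  rw [← Submodule.Quotient.mk_smul, smul_eq_mul, mul_one]

theorem IsMaxVec.map {V' : Type u} [AddCommGroup V'] [Module F V'] [Module A V']
    [IsScalarTower F A V'] {w : D.H1 →ₐ[F] F} {v : V} (hv : D.IsMaxVec w v) (f : V →ₗ[A] V') :
    D.IsMaxVec w (f v) where
  weight h := by
    rw [← map_smul, hv.weight h, ← algebraMap_smul A (w h) v, map_smul, algebraMap_smul]
  np n hn := by rw [← map_smul, hv.np n hn, map_zero]

variable (hD : D.IsRTA)
include hD

/-- A module generated by a maximal vector is generated by it over `B⁻`. -/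
theorem IsRTA.exists_Bm_smul_eq {w : D.H1 →ₐ[F] F} {v : V} (hv : D.IsMaxVec w v) (a : A) :
    ∃ b ∈ D.Bm, a • v = b • v := by
  induction a using hD.triangular.induction_on with
  | hmul b h c =>
    obtain ⟨y, hy, z, hz, hc⟩ := Submodule.mem_sup.1 (hD.Bp_le c.2)
    obtain ⟨r, rfl⟩ := Submodule.mem_span_singleton.1 hy
    refine ⟨(w h * r) • (b : A), D.Bm.smul_mem b.2 _, ?_⟩
    rw [← hc, mul_smul, mul_smul, add_smul, hv.np z hz, add_zero, smul_assoc r (1 : A) v, one_smul,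
      smul_algebra_smul_comm, hv.weight h, smul_algebra_smul_comm, smul_algebra_smul_comm, smul_assoc,
      smul_smul, mul_comm]
  | hadd x y hx hy =>
    obtain ⟨b, hb, e⟩ := hx
    obtain ⟨b', hb', e'⟩ := hy
    exact ⟨b + b', D.Bm.add_mem hb hb', by rw [add_smul, add_smul, e, e']⟩

/-- The map `B⁻ → M(w)`, `b ↦ b · 1`, is injective. -/
theorem IsRTA.eq_zero_of_mk_eq_zero {w : D.H1 →ₐ[F] F} {b : A} (hb : b ∈ D.Bm)
    (h : (Submodule.Quotient.mk b : D.Verma w) = 0) : b = 0 := by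
  obtain ⟨ε, hε, hε'⟩ := hD.exists_counit
  -- `K` is the projection `b * (h * c) ↦ ε(c) w(h) b` of `A` onto `B⁻`; it kills the left ideal which
  -- defines the Verma module
  obtain ⟨K, hK⟩ := hD.triangular.exists_lift (V := A) (LinearMap.mk₂ F
    (fun b h => ((ε.comp D.Bp.val.toLinearMap).smulRight (w h • (b : A))))
      (fun a b c => by ext; simp)
      (fun r a b => LinearMap.ext fun c => by
        change ε c • w b • (r • (a : A)) = r • (ε c • w b • (a : A))
        module)
      (fun a b c => by ext; simp [add_smul])
      (fun r a b => LinearMap.ext fun c => by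
        change ε c • w (r • b) • (a : A) = r • (ε c • w b • (a : A))
        rw [map_smul, smul_eq_mul]
        module))
  replace hK : ∀ (b : D.Bm) (h : D.H1) (c : A), c ∈ D.Bp →
      K ((b : A) * (h * c)) = ε c • w h • (b : A) := fun b h c hc => by
    simpa using hK b h ⟨c, hc⟩
  have hK1 : ∀ n ∈ D.Np, ∀ a : A, K (a * n) = 0 := by
    intro n hn a
    induction a using hD.triangular.induction_on with
    | hmul b h c =>
      have : (c : A) * n ∈ D.Np := hD.mul_mem_Np c.2 hn
      rw [mul_assoc, mul_assoc, hK b h _ (IsRTA.Np_le this), hε' _ this, zero_smul]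
    | hadd x y hx hy => rw [add_mul, map_add, hx, hy, add_zero]
  have hK2 : ∀ k : D.H1, w k = 0 → ∀ a : A, K (a * k) = 0 := by
    intro k hk a
    induction a using hD.triangular.induction_on with
    | hmul b h c =>
      have : Subalgebra.toSubmodule D.Bp ≤ LinearMap.ker (K.comp
          ((LinearMap.mulLeft F ((b : A) * h)).comp (LinearMap.mulRight F (k : A)))) := by
        rw [← hD.decomp.2]
        refine iSup_le fun θ c hc => ?_
        rw [LinearMap.mem_ker, LinearMap.comp_apply, LinearMap.comp_apply, LinearMap.mulRight_apply,
          LinearMap.mulLeft_apply, mul_assoc]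
        obtain ⟨θ₀, h0, h1⟩ := θ.2
        by_cases e : θ₀ = 1
        · have := BpRoot1_le h1 hc
          rw [e, hD.root_one] at this
          obtain ⟨r, rfl⟩ := Submodule.mem_span_singleton.1 this
          have := hK b (h * k) (r • 1) (D.Bp.smul_mem D.Bp.one_mem r)
          rw [map_mul w, hk, mul_zero, zero_smul, smul_zero] at this
          rw [← this]
          simp
        · have e1 : c * (k : A) = θ.1 k * c := hc.2 k
          have e2 : ε c = 0 := hε' c (Submodule.mem_iSup_of_mem
            (p := fun θ : {θ : D.H0 ≃ₐ[F] D.H0 // θ ∈ D.Q0 ∧ θ ≠ 1} => D.BpRoot0 θ)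
            ⟨θ₀, h0, e⟩ (BpRoot1_le h1 hc))
          have := hK b (h * θ.1 k) c hc.1
          rw [e2, zero_smul] at this
          rw [e1, ← this]
          simp [mul_assoc]
      have := this c.2
      rw [LinearMap.mem_ker] at this
      simpa [mul_assoc] using this
    | hadd x y hx hy => rw [add_mul, map_add, hx, hy, add_zero]
  have hKv : ∀ x ∈ D.vermaIdeal w, K x = 0 := by
    intro x hx
    obtain ⟨y, hy, z, hz, rfl⟩ := Submodule.mem_sup.1 hx
    have h1 : K y = 0 := by
      refine Submodule.span_induction (p := fun y _ => ∀ a : A, K (a * y) = 0) ?_ ?_ ?_ ?_ hy 1 |>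
        fun h => by simpa using h
      · exact fun n hn => hK1 n hn
      · simp
      · intro x y _ _ hx hy a; rw [mul_add, map_add, hx, hy, add_zero]
      · intro c x _ hx a; rw [smul_eq_mul, ← mul_assoc]; exact hx _
    have h2 : K z = 0 := by
      refine Submodule.span_induction (p := fun y _ => ∀ a : A, K (a * y) = 0) ?_ ?_ ?_ ?_ hz 1 |>
        fun h => by simpa using h
      · rintro _ ⟨k, hk, rfl⟩; exact hK2 k hk
      · simp
      · intro x y _ _ hx hy a; rw [mul_add, map_add, hx, hy, add_zero]
      · intro c x _ hx a; rw [smul_eq_mul, ← mul_assoc]; exact hx _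
    rw [map_add, h1, h2, add_zero]
  have h1 := hK ⟨b, hb⟩ 1 1 D.Bp.one_mem
  rw [hε, map_one w, one_smul, one_smul] at h1
  change K (b * (1 * 1)) = b at h1
  rw [← h1]
  refine hKv _ ?_
  simpa using (Submodule.Quotient.mk_eq_zero _).1 h

end Module

end RTAData

/-! ### Highest weight modules -/

namespace RTAData

variable {F A : Type u} [Field F] [Ring A] [Algebra F A] {D : RTAData F A}
  {V : Type u} [AddCommGroup V] [Module F V] [Module A V] [IsScalarTower F A V]

theorem act_inv (θ : D.H0 ≃ₐ[F] D.H0) (χ : D.H0 →ₐ[F] F) :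
    D.act θ⁻¹ χ = χ.comp θ.toAlgHom := by
  rw [act, inv_inv]

theorem act_mul (θ θ' : D.H0 ≃ₐ[F] D.H0) (χ : D.H0 →ₐ[F] F) :
    D.act (θ * θ') χ = D.act θ (D.act θ' χ) := by
  rw [act, mul_inv_rev]; rfl

theorem act_one (χ : D.H0 →ₐ[F] F) : D.act 1 χ = χ := by
  rw [act, inv_one]; rfl

theorem mem_free0_of_act {θ : D.H0 ≃ₐ[F] D.H0} (hθ : θ ∈ Subgroup.closure D.Q0)
    {χ : D.H0 →ₐ[F] F} (h : D.act θ χ ∈ D.free0) : χ ∈ D.free0 := by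
  intro σ hσ e
  have h1 := h (θ * σ * θ⁻¹) (Subgroup.mul_mem _ (Subgroup.mul_mem _ hθ hσ) (Subgroup.inv_mem _ hθ))
    (by rw [← act_mul, inv_mul_cancel_right, act_mul, e])
  have h2 : θ * σ = θ := by simpa using congrArg (· * θ) h1
  simpa using h2

theorem mem_closure {θ : D.H0 ≃ₐ[F] D.H0} (hθ : θ ∈ D.Q0) : θ ∈ Subgroup.closure D.Q0 :=
  Subgroup.subset_closure hθ

theorem weightSpace_le_res (w : D.H1 →ₐ[F] F) :
    weightSpace D.H1 V w ≤ weightSpace D.H0 V (D.res w) :=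
  fun _ hx h => hx (Subalgebra.inclusion D.H0_le h)

/-- The map `c ↦ i(c) v`. -/
def iAct (D : RTAData F A) (v : V) : A →ₗ[F] V :=
  ((LinearMap.toSpanSingleton A V v).restrictScalars F).comp D.i

theorem iAct_apply (v : V) (c : A) : D.iAct v c = D.i c • v := rfl

section

variable (hD : D.IsRTA) {w : D.H1 →ₐ[F] F} {v : V} (hv : D.IsMaxVec w v)
include hD hv

/-- A highest weight module is spanned by the vectors `i(c) v` with `c ∈ B⁺`, since
`B⁻ ⊆ i(B⁺) H₁`. -/
theorem smul_mem_iAct (a : A) : a • v ∈ (Subalgebra.toSubmodule D.Bp).map (D.iAct v) := by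
  obtain ⟨b, hb, e⟩ := hD.exists_Bm_smul_eq hv a
  rw [e, ← hD.triangular.i_i b]
  refine Submodule.mul_induction_on (C := fun y => D.i y • v ∈ (Subalgebra.toSubmodule D.Bp).map
    (D.iAct v)) (hD.triangular.i_Bm b hb) (fun h hh c hc => ?_) (fun x y hx hy => ?_)
  · refine ⟨w ⟨h, hh⟩ • c, Submodule.smul_mem _ _ hc, ?_⟩
    have h1 : h • v = w ⟨h, hh⟩ • v := hv.weight ⟨h, hh⟩
    rw [map_smul, iAct_apply, hD.triangular.i_mul, hD.triangular.i_fix h hh, mul_smul, h1,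
      smul_algebra_smul_comm]
  · rw [map_add, add_smul]; exact Submodule.add_mem _ hx hy

theorem iAct_mem_weightSpace0 {θ : D.H0 ≃ₐ[F] D.H0} {c : A} (hc : c ∈ D.BpRoot0 θ) :
    D.iAct v c ∈ weightSpace D.H0 V ((D.res w).comp θ.toAlgHom) := by
  intro h
  have h1 : c * (h : A) = θ h * c := hc.2 h
  have h2 : ((θ h : D.H0) : A) • v = (D.res w) (θ h) • v := weightSpace_le_res w hv.weight (θ h)
  have h3 : ∀ h : D.H0, D.i h = h := fun h => hD.triangular.i_fix h (D.H0_le h.2)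
  rw [iAct_apply, ← mul_smul]
  nth_rewrite 1 [← h3 h]
  rw [← hD.triangular.i_mul, h1, hD.triangular.i_mul, h3, mul_smul, h2, smul_algebra_smul_comm]
  rfl

theorem iAct_mem_weightSpace1 {θ : D.H1 ≃ₐ[F] D.H1} {c : A} (hc : c ∈ D.BpRoot1 θ) :
    D.iAct v c ∈ weightSpace D.H1 V (w.comp θ.toAlgHom) := by
  intro h
  have h1 : c * (h : A) = θ h * c := hc.2 h
  have h2 : ((θ h : D.H1) : A) • v = w (θ h) • v := hv.weight (θ h)
  have h3 : ∀ h : D.H1, D.i h = h := fun h => hD.triangular.i_fix h h.2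
  rw [iAct_apply, ← mul_smul]
  nth_rewrite 1 [← h3 h]
  rw [← hD.triangular.i_mul, h1, hD.triangular.i_mul, h3, mul_smul, h2, smul_algebra_smul_comm]
  rfl

variable (hgen : ∀ x : V, ∃ a : A, x = a • v)
include hgen

theorem iSup_weightSpace1_eq_top : ⨆ χ, weightSpace D.H1 V χ = ⊤ := by
  refine eq_top_iff.2 fun x _ => ?_
  obtain ⟨a, rfl⟩ := hgen x
  have h1 := smul_mem_iAct hD hv a
  rw [← hD.decomp.2, Submodule.map_iSup] at h1
  refine (iSup_le fun θ => ?_ : _ ≤ ⨆ χ, weightSpace D.H1 V χ) h1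
  rintro _ ⟨c, hc, rfl⟩
  exact Submodule.mem_iSup_of_mem _ (iAct_mem_weightSpace1 hD hv hc)

/-- The `H₀`-weight spaces of a highest weight module. -/
theorem weightSpace0_eq (χ : D.H0 →ₐ[F] F) : weightSpace D.H0 V χ =
    ⨆ (θ : D.Q0) (_ : (D.res w).comp θ.1.toAlgHom = χ), (D.BpRoot0 θ).map (D.iAct v) := by
  refine (eq_of_iSupIndep_of_le (U := fun χ => ⨆ (θ : D.Q0)
    (_ : (D.res w).comp θ.1.toAlgHom = χ), (D.BpRoot0 θ).map (D.iAct v))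
    (iSupIndep_weightSpace (V := V) D.H0) (fun χ => iSup₂_le ?_) (fun χ x _ => ?_) χ).symm
  · rintro θ rfl _ ⟨c, hc, rfl⟩
    exact iAct_mem_weightSpace0 hD hv hc
  · obtain ⟨a, rfl⟩ := hgen x
    have h1 := smul_mem_iAct hD hv a
    rw [← hD.decomp.2, Submodule.map_iSup] at h1
    refine (show (⨆ θ : D.Q1, (D.BpRoot1 θ.1).map (D.iAct v)) ≤ _ from
      iSup_le fun θ => ?_) h1
    obtain ⟨θ₀, h0, h1⟩ := θ.2
    refine le_trans (Submodule.map_mono (BpRoot1_le h1)) ?_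
    exact le_iSup_of_le ((D.res w).comp θ₀.toAlgHom) (le_iSup₂_of_le ⟨θ₀, h0⟩ rfl le_rfl)

theorem exists_eq_comp_of_weightSpace0_ne_bot {χ : D.H0 →ₐ[F] F} (h : weightSpace D.H0 V χ ≠ ⊥) :
    ∃ θ ∈ D.Q0, χ = (D.res w).comp θ.toAlgHom := by
  by_contra hc
  push Not at hc
  refine h ?_
  rw [weightSpace0_eq hD hv hgen, eq_bot_iff]
  exact iSup₂_le fun θ hθ => absurd hθ.symm (hc θ.1 θ.2)

/-- If the highest weight is free, its `H₀`-weight space is a line: only the root `θ = 1` leads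
back to the highest weight, and the root space of `1` is `F · 1`. -/
theorem weightSpace0_top (hw : w ∈ D.free1) :
    weightSpace D.H0 V (D.res w) = Submodule.span F {v} := by
  refine le_antisymm ?_ ?_
  · rw [weightSpace0_eq hD hv hgen]
    refine iSup₂_le fun θ hθ => ?_
    have : θ.1⁻¹ = 1 := hw _ (Subgroup.inv_mem _ (mem_closure θ.2)) (by rw [act_inv, hθ])
    rw [inv_eq_one.1 this, hD.root_one, Submodule.map_span, Set.image_singleton, iAct_apply,
      hD.triangular.i_fix 1 D.H1.one_mem, one_smul]
  · rw [Submodule.span_singleton_le_iff_mem]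
    exact weightSpace_le_res w hv.weight

/-- In a highest weight module with free highest weight, the coordinate `φ` along the highest weight
vector `v` is realized, on any finite set of vectors, by the action of an element of the algebra. -/
theorem exists_hwFunctional (hw : w ∈ D.free1) (hv0 : v ≠ 0) :
    ∃ φ : Module.Dual F V, φ v = 1 ∧ ∀ s : Finset V, ∃ a : A, ∀ x ∈ s, a • x = φ x • v := by
  classical
  have htop : ∀ x : V, x ∈ ⨆ χ, weightSpace D.H0 V χ := by
    intro x
    have : x ∈ ⨆ χ, weightSpace D.H1 V χ := by
      rw [iSup_weightSpace1_eq_top hD hv hgen]; trivial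
    exact (iSup_le fun χ => le_iSup_of_le (D.res χ) (weightSpace_le_res χ) :
      _ ≤ ⨆ χ, weightSpace D.H0 V χ) this
  -- `φ` is the projection along the other weight spaces, and the algebra element is the one of `H₀`
  -- which separates the highest weight from the other weights of the given vectors
  have hvR : v ∉ ⨆ (χ) (_ : χ ≠ D.res w), weightSpace D.H0 V χ := fun h =>
    hv0 (Submodule.disjoint_def.1 (iSupIndep_weightSpace (V := V) D.H0 (D.res w)) v
      (weightSpace_le_res w hv.weight) h)
  obtain ⟨f, hf, hf'⟩ := Submodule.exists_dual_map_eq_bot_of_notMem hvR inferInstance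
  have hfR : ∀ χ ≠ D.res w, ∀ x ∈ weightSpace D.H0 V χ, f x = 0 := by
    intro χ hχ x hx
    have : f x ∈ (⨆ (χ) (_ : χ ≠ D.res w), weightSpace D.H0 V χ).map f :=
      ⟨x, (le_iSup₂_of_le χ hχ le_rfl : weightSpace D.H0 V χ ≤ _) hx, rfl⟩
    rwa [hf', Submodule.mem_bot] at this
  refine ⟨(f v)⁻¹ • f, by simp [hf], fun s => ?_⟩
  choose t ht using fun x : V => Submodule.mem_iSup_iff_exists_finset.1 (htop x)
  obtain ⟨h, h1, h2⟩ := exists_interpolation (D.res w) (s.biUnion t)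
  refine ⟨h, fun x hx => ?_⟩
  have key : (⨆ χ ∈ t x, weightSpace D.H0 V χ) ≤ LinearMap.ker
      (Algebra.lsmul F F V (h : A) - ((f v)⁻¹ • f).smulRight v) := by
    refine iSup₂_le fun χ hχ y hy => ?_
    have e : (h : A) • y = χ h • y := hy h
    by_cases hc : χ = D.res w
    · subst hc
      rw [weightSpace0_top hD hv hgen hw] at hy
      obtain ⟨r, rfl⟩ := Submodule.mem_span_singleton.1 hy
      rw [h1, one_smul] at e
      simp only [LinearMap.mem_ker, LinearMap.sub_apply, Algebra.lsmul_coe, e]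
      simp [hf]
    · rw [h2 χ (Finset.mem_biUnion.2 ⟨x, hx, hχ⟩) hc, zero_smul] at e
      simp only [LinearMap.mem_ker, LinearMap.sub_apply, Algebra.lsmul_coe, e]
      simp [hfR χ hc y hy]
  have := key (ht x)
  simpa [sub_eq_zero] using this

/-- A highest weight module with free highest weight has a greatest proper submodule. -/
theorem exists_greatest_proper (hw : w ∈ D.free1) (hv0 : v ≠ 0) :
    ∃ K : Submodule A V, K ≠ ⊤ ∧ ∀ N : Submodule A V, N ≠ ⊤ → N ≤ K := by
  obtain ⟨φ, hφ, hφ'⟩ := exists_hwFunctional hD hv hgen hw hv0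
  -- the greatest submodule contained in the kernel of `φ`: a submodule on which `φ` does not vanish
  -- contains the highest weight vector
  refine ⟨⟨⟨⟨{x | ∀ a : A, φ (a • x) = 0}, ?_⟩, ?_⟩, ?_⟩, ?_, ?_⟩
  · intro x y hx hy a
    rw [smul_add, map_add, hx a, hy a, add_zero]
  · intro a; simp
  · intro c x hx a
    rw [← mul_smul]; exact hx _
  · intro h
    have : v ∈ (⊤ : Submodule A V) := trivial
    rw [← h] at this
    have := this 1
    rw [one_smul, hφ] at this
    exact one_ne_zero this
  · intro N hN x hx a
    by_contra hne
    refine hN (eq_top_iff.2 fun y _ => ?_)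
    obtain ⟨b, hb⟩ := hφ' {a • x}
    have h1 : v ∈ N := by
      have h2 : φ (a • x) • v ∈ N := by
        rw [← hb _ (Finset.mem_singleton_self _)]
        exact N.smul_mem b (N.smul_mem a hx)
      have h3 := N.smul_mem (algebraMap F A (φ (a • x))⁻¹) h2
      rwa [algebraMap_smul, smul_smul, inv_mul_cancel₀ hne, one_smul] at h3
    obtain ⟨c, rfl⟩ := hgen y
    exact N.smul_mem c h1

/-- A semisimple highest weight module with free highest weight is simple. -/
theorem isSimpleModule_of_isSemisimple (hw : w ∈ D.free1) (hv0 : v ≠ 0) [IsSemisimpleModule A V] :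
    IsSimpleModule A V := by
  obtain ⟨K, hK, hK'⟩ := exists_greatest_proper hD hv hgen hw hv0
  obtain ⟨C, hC⟩ := exists_isCompl K
  have hCtop : C = ⊤ := by
    by_contra h
    have := hC.disjoint.eq_bot_of_ge (hK' C h)
    refine hK ?_
    have h2 := hC.codisjoint.eq_top
    rwa [this, sup_bot_eq] at h2
  have hKbot : K = ⊥ := by
    have := hC.disjoint.eq_bot
    rwa [hCtop, inf_top_eq] at this
  have : Nontrivial V := ⟨v, 0, hv0⟩
  exact (isSimpleModule_iff A V).2
    { eq_bot_or_eq_top := fun N => or_iff_not_imp_right.2 fun h =>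
        eq_bot_iff.2 ((hK' N h).trans hKbot.le) }

end

section Simple

variable (hD : D.IsRTA) {w : D.H1 →ₐ[F] F}
include hD

theorem mk_one_ne_zero : (Submodule.Quotient.mk (1 : A) : D.Verma w) ≠ 0 := fun h => by
  have := hD.triangular.nontrivial
  exact one_ne_zero (hD.eq_zero_of_mk_eq_zero D.Bm.one_mem h)

omit hD in
theorem exists_eq_smul_mk_one (x : D.Verma w) : ∃ a : A, x = a • Submodule.Quotient.mk (1 : A) := by
  obtain ⟨a, rfl⟩ := Submodule.Quotient.mk_surjective _ x
  exact ⟨a, mk_eq_smul_mk_one w a⟩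

theorem isCoatom_radVerma (hw : w ∈ D.free1) : IsCoatom (D.radVerma w) := by
  obtain ⟨K, hK, hK'⟩ := exists_greatest_proper hD (isMaxVec_mk w) exists_eq_smul_mk_one hw
    (mk_one_ne_zero hD)
  have : D.radVerma w = K := le_antisymm (sSup_le hK') (le_sSup hK)
  rw [this]
  exact ⟨hK, fun N hN => by
    by_contra h
    exact absurd (hK' N h) (not_le_of_gt hN)⟩

theorem isSimpleModule_simple (hw : w ∈ D.free1) : IsSimpleModule A (D.Simple w) :=
  isSimpleModule_iff_isCoatom.2 (isCoatom_radVerma hD hw)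

omit hD in
theorem isMaxVec_simple :
    D.IsMaxVec w ((D.radVerma w).mkQ (Submodule.Quotient.mk (1 : A))) :=
  (isMaxVec_mk w).map _

omit hD in
theorem exists_eq_smul_simple (x : D.Simple w) :
    ∃ a : A, x = a • (D.radVerma w).mkQ (Submodule.Quotient.mk (1 : A)) := by
  obtain ⟨y, rfl⟩ := (D.radVerma w).mkQ_surjective x
  obtain ⟨a, rfl⟩ := exists_eq_smul_mk_one y
  exact ⟨a, map_smul _ _ _⟩

theorem simple_mk_one_ne_zero (hw : w ∈ D.free1) :
    (D.radVerma w).mkQ (Submodule.Quotient.mk (1 : A)) ≠ 0 := by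
  intro h
  have := isSimpleModule_simple hD hw
  have := IsSimpleModule.nontrivial A (D.Simple w)
  obtain ⟨x, hx⟩ := exists_ne (0 : D.Simple w)
  obtain ⟨a, rfl⟩ := exists_eq_smul_simple x
  rw [h, smul_zero] at hx
  exact hx rfl

omit hD in
theorem exists_eq_smul_of_isSimple [IsSimpleModule A V] {v : V} (hv0 : v ≠ 0) (x : V) :
    ∃ a : A, x = a • v := by
  obtain ⟨a, ha⟩ := IsSimpleModule.toSpanSingleton_surjective A hv0 x
  exact ⟨a, ha.symm⟩

/-- A simple module is determined by a free weight of a maximal vector. -/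
theorem nonempty_equiv_simple (hw : w ∈ D.free1) [IsSimpleModule A V] {v : V} (hv0 : v ≠ 0)
    (hv : D.IsMaxVec w v) : Nonempty (D.Simple w ≃ₗ[A] V) := by
  have hsurj : Function.Surjective (vermaMap hv) := fun x => by
    obtain ⟨a, rfl⟩ := exists_eq_smul_of_isSimple (A := A) hv0 x
    exact ⟨Submodule.Quotient.mk a, rfl⟩
  have hker : LinearMap.ker (vermaMap hv) = D.radVerma w := by
    have h1 : IsCoatom (LinearMap.ker (vermaMap hv)) := by
      have := LinearMap.quotKerEquivOfSurjective _ hsurj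
      exact isSimpleModule_iff_isCoatom.1 (IsSimpleModule.congr this)
    exact ((h1.le_iff.1 (le_sSup h1.1)).resolve_left (isCoatom_radVerma hD hw).1).symm
  exact ⟨(Submodule.quotEquivOfEq _ _ hker.symm).trans
    (LinearMap.quotKerEquivOfSurjective _ hsurj)⟩

/-- If `L(a)` is a subquotient of `M(b)` and `a` is free, then `b` is free: `a` is a weight of
`M(b)`, so the restrictions of `a` and `b` to `H₀` are in the same orbit. -/
theorem mem_free1_of_linked {a b : D.H1 →ₐ[F] F} (h : D.Linked a b) : b ∈ D.free1 := by
  obtain ⟨ha, N, f, hf⟩ := h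
  -- a preimage of the highest weight vector of `L(a)` has a component of the weight of `a`
  obtain ⟨x, hx⟩ := hf ((D.radVerma a).mkQ (Submodule.Quotient.mk (1 : A)))
  have hxtop : (x : D.Verma b) ∈ ⨆ χ, weightSpace D.H0 (D.Verma b) χ := by
    have : (x : D.Verma b) ∈ ⨆ χ, weightSpace D.H1 (D.Verma b) χ := by
      rw [iSup_weightSpace1_eq_top hD (isMaxVec_mk b) exists_eq_smul_mk_one]; trivial
    exact (iSup_le fun χ => le_iSup_of_le (D.res χ) (weightSpace_le_res χ) :
      _ ≤ ⨆ χ, weightSpace D.H0 (D.Verma b) χ) this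
  have hne : weightSpace D.H0 (D.Verma b) (D.res a) ≠ ⊥ := by
    intro hbot
    have h1 := mem_iSup_inf_weightSpace D.H0 (N.restrictScalars F) (fun h x hx => N.smul_mem _ hx)
      x.2 hxtop
    have h2 : (⨆ χ, N.restrictScalars F ⊓ weightSpace D.H0 (D.Verma b) χ) ≤
        ((⨆ (χ) (_ : χ ≠ D.res a), weightSpace D.H0 (D.Simple a) χ).comap
          (f.restrictScalars F)).map (N.subtype.restrictScalars F) := by
      refine iSup_le fun χ y hy => ?_
      by_cases hχ : χ = D.res a
      · subst hχ
        have : y = 0 := by simpa [hbot] using hy.2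
        rw [this]; exact Submodule.zero_mem _
      · refine ⟨⟨y, hy.1⟩, ?_, rfl⟩
        refine (le_iSup₂_of_le χ hχ le_rfl : weightSpace D.H0 (D.Simple a) χ ≤ _) fun h => ?_
        have e : (h : A) • y = χ h • y := hy.2 h
        have e' : (h : A) • (⟨y, hy.1⟩ : N) = algebraMap F A (χ h) • (⟨y, hy.1⟩ : N) :=
          Subtype.ext (by rw [Submodule.coe_smul, Submodule.coe_smul, e, algebraMap_smul])
        rw [LinearMap.restrictScalars_apply, ← map_smul, e', map_smul, algebraMap_smul]
    obtain ⟨y, hy, e⟩ := h2 h1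
    have : y = x := Subtype.ext e
    subst this
    rw [SetLike.mem_coe, Submodule.mem_comap, LinearMap.restrictScalars_apply, hx] at hy
    exact simple_mk_one_ne_zero hD ha (Submodule.disjoint_def.1
      (iSupIndep_weightSpace (V := D.Simple a) D.H0 (D.res a)) _
      (weightSpace_le_res a isMaxVec_simple.weight) hy)
  obtain ⟨θ, hθ, e⟩ := exists_eq_comp_of_weightSpace0_ne_bot hD (isMaxVec_mk b)
    exists_eq_smul_mk_one hne
  refine mem_free0_of_act (θ := θ⁻¹) (Subgroup.inv_mem _ (mem_closure hθ)) ?_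
  rw [act_inv, ← e]
  exact ha

theorem mem_free1_iff_of_eqvGen {a b : D.H1 →ₐ[F] F} (h : Relation.EqvGen D.Linked a b) :
    a ∈ D.free1 ↔ b ∈ D.free1 := by
  induction h with
  | rel a b h => exact ⟨fun _ => mem_free1_of_linked hD h, fun _ => h.1⟩
  | refl a => rfl
  | symm a b _ ih => exact ih.symm
  | trans a b c _ _ h1 h2 => exact h1.trans h2

/-- A vector killed by the `H₁`-root vectors of non-trivial roots is killed by `N⁺`, since
`H₀`-root spaces are sums of `H₁`-root spaces. -/
theorem Np_smul_eq_zero_of_root1 {x : V} (h : ∀ θ₁ θ₀, θ₀ ∈ D.Q0 → θ₀ ≠ 1 → D.Restricts θ₁ θ₀ →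
    ∀ c ∈ D.BpRoot1 θ₁, c • x = 0) : ∀ n ∈ D.Np, n • x = 0 := by
  have : D.Np ≤ LinearMap.ker ((LinearMap.toSpanSingleton A V x).restrictScalars F) := by
    refine iSup_le fun θ => ?_
    rw [hD.BpRoot0_eq]
    exact iSup₂_le fun θ₁ hθ₁ c hc => h θ₁.1 θ.1 θ.2.1 θ.2.2 hθ₁ c hc
  exact fun n hn => this hn

/-- The vectors killed by `N⁺` form an `H₁`-stable subspace. -/
theorem Np_smul_smul_eq_zero {x : V} (hx : ∀ n ∈ D.Np, n • x = 0) (h : D.H1) :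
    ∀ n ∈ D.Np, n • (h : A) • x = 0 := by
  refine Np_smul_eq_zero_of_root1 hD fun θ₁ θ₀ h0 hne hres c hc => ?_
  have e : c * (h : A) = θ₁ h * c := hc.2 h
  have hcN : c ∈ D.Np := Submodule.mem_iSup_of_mem
    (p := fun θ : {θ : D.H0 ≃ₐ[F] D.H0 // θ ∈ D.Q0 ∧ θ ≠ 1} => D.BpRoot0 θ) ⟨θ₀, h0, hne⟩
    (BpRoot1_le hres hc)
  rw [← mul_smul, e, mul_smul, hx c hcN, smul_zero]

/-- Nonzero submodules of modules in `𝒪[free]` contain maximal vectors. For a weight vector `m` of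
free weight, distinct roots move `m` into distinct weight spaces, so local finiteness of `B⁺` leaves
only finitely many roots which do not kill `m`. -/
theorem exists_isMaxVec (hV : ⨆ χ, weightSpace D.H1 V χ = ⊤)
    (hfree : ∀ χ, weightSpace D.H1 V χ ≠ ⊥ → χ ∈ D.free1)
    (hfin : ∀ m : V, FiniteDimensional F (Submodule.span F {x : V | ∃ b ∈ D.Bp, x = b • m}))
    {N : Submodule A V} (hN : N ≠ ⊥) :
    ∃ w ∈ D.free1, ∃ v ∈ N, v ≠ 0 ∧ D.IsMaxVec w v := by
  classical
  obtain ⟨μ, m, hm, hm0, hmμ⟩ := exists_weight_vector (H := D.H1) (N := N.restrictScalars F)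
    (fun h x hx => N.smul_mem _ hx) (by simpa using hN) (by rw [hV]; exact le_top)
  have hμ : μ ∈ D.free1 := hfree μ fun h => hm0 (by simpa [h] using hmμ)
  have hw0 : ∀ θ, ∀ c ∈ D.BpRoot0 θ, c • m ∈ weightSpace D.H0 V (D.act θ (D.res μ)) := by
    intro θ c hc h
    have e : c * (θ⁻¹ h : D.H0) = θ (θ⁻¹ h) * c := hc.2 (θ⁻¹ h)
    have e2 : θ (θ⁻¹ h) = h := θ.apply_symm_apply h
    have e3 : ((θ⁻¹ h : D.H0) : A) • m = D.res μ (θ⁻¹ h) • m := weightSpace_le_res μ hmμ _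
    rw [e2] at e
    rw [← mul_smul, ← e, mul_smul, e3, smul_algebra_smul_comm]
    rfl
  have hw1 : ∀ θ, ∀ c ∈ D.BpRoot1 θ, c • m ∈ weightSpace D.H1 V (μ.comp (θ⁻¹ : D.H1 ≃ₐ[F] D.H1).toAlgHom) := by
    intro θ c hc h
    have e : c * (θ⁻¹ h : D.H1) = θ (θ⁻¹ h) * c := hc.2 (θ⁻¹ h)
    have e2 : θ (θ⁻¹ h) = h := θ.apply_symm_apply h
    have e3 : ((θ⁻¹ h : D.H1) : A) • m = μ (θ⁻¹ h) • m := hmμ _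
    rw [e2] at e
    rw [← mul_smul, ← e, mul_smul, e3, smul_algebra_smul_comm]
    rfl
  -- the finitely many roots which act non-trivially on `m`
  let T : Set (D.H0 ≃ₐ[F] D.H0) := {θ | θ ∈ D.Q0 ∧ ∃ c ∈ D.BpRoot0 θ, c • m ≠ 0}
  have hT : T.Finite := by
    have := hfin m
    choose c hc hc0 using fun θ : T => θ.2.2
    have hinj : Function.Injective fun θ : T => D.act θ.1 (D.res μ) := by
      intro θ θ' h
      have h1 := hμ (θ'.1⁻¹ * θ.1) (Subgroup.mul_mem _ (Subgroup.inv_mem _ (mem_closure θ'.2.1))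
        (mem_closure θ.2.1)) (by
          rw [act_mul]
          rw [show D.act θ.1 (D.res μ) = D.act θ'.1 (D.res μ) from h, ← act_mul, inv_mul_cancel,
            act_one])
      exact Subtype.ext (inv_mul_eq_one.1 h1).symm
    have hind : LinearIndependent F fun θ : T => c θ • m :=
      ((iSupIndep_weightSpace (V := V) D.H0).comp hinj).linearIndependent _
        (fun θ => hw0 θ.1 _ (hc θ)) hc0
    have hind' : LinearIndependent F fun θ : T =>
        (⟨c θ • m, Submodule.subset_span ⟨c θ, (hc θ).1, rfl⟩⟩ :
          Submodule.span F {x : V | ∃ b ∈ D.Bp, x = b • m}) :=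
      LinearIndependent.of_comp (Submodule.subtype _) hind
    have := hind'.finite
    exact Set.toFinite T
  -- a maximal one among them yields a maximal vector
  have hwf : WellFounded fun a b : T => ∃ q ∈ D.Q0, q ≠ 1 ∧ a.1 = q * b.1 := by
    have := hT.to_subtype
    refine @Finite.wellFounded_of_trans_of_irrefl T this _ ⟨?_⟩ ⟨?_⟩
    · rintro a b c ⟨q, hq, hq1, e⟩ ⟨q', hq', hq1', e'⟩
      exact ⟨q * q', hD.positive.mul_mem _ hq _ hq', hD.positive.mul_ne_one _ hq _ hq' hq1 hq1',
        by rw [e, e', mul_assoc]⟩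
    · rintro a ⟨q, _, hq1, e⟩
      exact hq1 (by simpa using e)
  have h1T : (1 : D.H0 ≃ₐ[F] D.H0) ∈ T := by
    refine ⟨hD.positive.one_mem, 1, ?_, by simpa using hm0⟩
    rw [hD.root_one]
    exact Submodule.mem_span_singleton_self 1
  obtain ⟨⟨θ, hθ, c, hc, hc0⟩, -, hmax⟩ := hwf.has_min Set.univ ⟨⟨1, h1T⟩, trivial⟩
  obtain ⟨θ₁, hθ₁, c₁, hc₁, hc₁0⟩ : ∃ θ₁, D.Restricts θ₁ θ ∧ ∃ c₁ ∈ D.BpRoot1 θ₁, c₁ • m ≠ 0 := by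
    by_contra hcon
    push Not at hcon
    rw [hD.BpRoot0_eq] at hc
    refine hc0 ((show (⨆ (θ₁ : D.Q1) (_ : D.Restricts θ₁ θ), D.BpRoot1 θ₁.1) ≤
      LinearMap.ker ((LinearMap.toSpanSingleton A V m).restrictScalars F) from ?_) hc)
    exact iSup₂_le fun θ₁ hθ₁ c₁ hc₁ => hcon θ₁.1 hθ₁ c₁ hc₁
  refine ⟨_, hfree _ fun h => hc₁0 ?_, c₁ • m, N.smul_mem _ hm, hc₁0, hw1 θ₁ c₁ hc₁, ?_⟩
  · have := hw1 θ₁ c₁ hc₁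
    rwa [h, Submodule.mem_bot] at this
  · refine Np_smul_eq_zero_of_root1 hD fun q₁ q h0 hne hres n hn => ?_
    by_contra hcon
    have h2 := mul_mem_BpRoot0 (BpRoot1_le hres hn) (BpRoot1_le hθ₁ hc₁)
    exact hmax ⟨q * θ, hD.positive.mul_mem _ h0 _ hθ, _, h2, by rwa [mul_smul]⟩ trivial
      ⟨q, h0, hne, rfl⟩

end Simple

end RTAData

/-! ### The tensor product of regular triangular algebras -/

theorem isPositiveMonoid_image {ι : Type*} {G : ι → Type*} [∀ j, Group (G j)] {Γ : Type*} [Group Γ]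
    {Φ : (∀ j, G j) →* Γ} (hΦ : Function.Injective Φ) {Q : ∀ j, Set (G j)}
    (hQ : ∀ j, IsPositiveMonoid (Q j)) : IsPositiveMonoid (Φ '' {θ | ∀ j, θ j ∈ Q j}) := by
  refine ⟨⟨1, fun j => (hQ j).one_mem, map_one _⟩, ?_, ?_⟩
  · rintro _ ⟨θ, h, rfl⟩ _ ⟨θ', h', rfl⟩
    exact ⟨θ * θ', fun j => (hQ j).mul_mem _ (h j) _ (h' j), map_mul _ _ _⟩
  · rintro _ ⟨θ, h, rfl⟩ _ ⟨θ', h', rfl⟩ hne hne' e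
    rw [← map_mul, map_eq_one_iff _ hΦ] at e
    refine hne ?_
    have hθ : θ = 1 := by
      funext j
      by_contra h1
      refine (hQ j).mul_ne_one _ (h j) _ (h' j) h1 (fun h2 => h1 ?_) (congrFun e j)
      have := congrFun e j
      rwa [Pi.mul_apply, h2, mul_one] at this
    rw [hθ]
    exact map_one _

section Tensor

open scoped Pointwise

variable {ι : Type} [Fintype ι] [DecidableEq ι] {F : Type u} [Field F] {A : ι → Type u}
  [∀ j, Ring (A j)] [∀ j, Algebra F (A j)]

theorem tensorSub_induction {S : ∀ j, Subalgebra F (A j)} {p : tensorSub S → Prop}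
    (tprod : ∀ x : ∀ j, S j, p ⟨_, tprod_coe_mem_tensorSub S x⟩)
    (smul : ∀ (r : F) x, p x → p (r • x)) (add : ∀ x y, p x → p y → p (x + y))
    (x : tensorSub S) : p x := by
  obtain ⟨y, rfl⟩ := (tensorSubEquiv S).surjective x
  induction y using PiTensorProduct.induction_on with
  | smul_tprod r x =>
    rw [map_smul, tensorSubEquiv_tprod]
    exact smul _ _ (tprod x)
  | add x y hx hy => rw [map_add]; exact add _ _ hx hy

theorem nontrivial_piTensorProduct [∀ j, Nontrivial (A j)] : Nontrivial (⨂[F] j, A j) :=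
  ⟨PiTensorProduct.tprod F 1, 0, tprod_ne_zero fun _ => one_ne_zero⟩

theorem tprod_mem_rootSpace {S : ∀ j, Subalgebra F (A j)} {θ : ∀ j, S j ≃ₐ[F] S j} {x : ∀ j, A j}
    (hx : ∀ j, x j ∈ rootSpace (S j) (θ j)) :
    PiTensorProduct.tprod F x ∈ rootSpace (tensorSub S) (tensorAut S θ) := by
  intro h
  induction h using tensorSub_induction with
  | tprod y =>
    rw [coe_tensorAut_tprod, PiTensorProduct.tprod_mul_tprod, PiTensorProduct.tprod_mul_tprod]
    congr 1
    ext j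
    exact hx j (y j)
  | smul r y h =>
    rw [map_smul, Subalgebra.coe_smul, Subalgebra.coe_smul, mul_smul_comm, h, smul_mul_assoc]
  | add y z hy hz =>
    rw [map_add, Subalgebra.coe_add, Subalgebra.coe_add, mul_add, hy, hz, add_mul]

theorem tensorAut_inclusion {S T : ∀ j, Subalgebra F (A j)} (hST : ∀ j, S j ≤ T j)
    (hle : tensorSub S ≤ tensorSub T) {θ : ∀ j, S j ≃ₐ[F] S j} {θ' : ∀ j, T j ≃ₐ[F] T j}
    (h : ∀ j x, θ' j (Subalgebra.inclusion (hST j) x) = Subalgebra.inclusion (hST j) (θ j x))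
    (x : tensorSub S) : tensorAut T θ' (Subalgebra.inclusion hle x) =
      Subalgebra.inclusion hle (tensorAut S θ x) := by
  have : (tensorAut T θ').toAlgHom.comp (Subalgebra.inclusion hle) =
      (Subalgebra.inclusion hle).comp (tensorAut S θ).toAlgHom := by
    refine tensorSub_algHom_ext fun j x => ?_
    have h1 : ∀ x, Subalgebra.inclusion hle (tensorIncl S j x) =
        tensorIncl T j (Subalgebra.inclusion (hST j) x) := fun x => rfl
    change tensorAut T θ' (Subalgebra.inclusion hle (tensorIncl S j x)) =
      Subalgebra.inclusion hle (tensorAut S θ (tensorIncl S j x))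
    rw [h1, tensorAut_incl, h, tensorAut_incl, h1]
  exact DFunLike.congr_fun this x

/-- The basis of `⨂ⱼ Sⱼ ⊆ ⨂ⱼ Aⱼ` formed from bases of the `Sⱼ`. -/
def tensorSubBasis {S : ∀ j, Subalgebra F (A j)} {κ : ι → Type*}
    (b : ∀ j, Module.Basis (κ j) F (S j)) : Module.Basis (∀ j, κ j) F (tensorSub S) :=
  (Basis.piTensorProduct b).map (tensorSubEquiv S).toLinearEquiv

theorem coe_tensorSubBasis {S : ∀ j, Subalgebra F (A j)} {κ : ι → Type*}
    (b : ∀ j, Module.Basis (κ j) F (S j)) (p : ∀ j, κ j) :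
    (tensorSubBasis b p : ⨂[F] j, A j) = PiTensorProduct.tprod F fun j => (b j (p j) : A j) := by
  rw [tensorSubBasis, Module.Basis.map_apply, Basis.piTensorProduct_apply,
    AlgEquiv.toLinearEquiv_apply, tensorSubEquiv_tprod]

/-- The product basis shows that multiplication `B⁻ ⊗ H₁ ⊗ B⁺ → A` is bijective for the tensor
product. -/
theorem bijective_mulMap_tensor {T : ∀ j, TriData F (A j)}
    (hT : ∀ j, Function.Bijective (T j).mulMap) :
    Function.Bijective (TriData.tensor T).mulMap := by
  let b1 := fun j => Module.Basis.ofVectorSpace F (T j).Bm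
  let b2 := fun j => Module.Basis.ofVectorSpace F (T j).H1
  let b3 := fun j => Module.Basis.ofVectorSpace F (T j).Bp
  let c1 : Module.Basis _ F (TriData.tensor T).Bm := tensorSubBasis b1
  let c2 : Module.Basis _ F (TriData.tensor T).H1 := tensorSubBasis b2
  let c3 : Module.Basis _ F (TriData.tensor T).Bp := tensorSubBasis b3
  let b : Module.Basis _ F ((TriData.tensor T).Bm ⊗[F] ((TriData.tensor T).H1 ⊗[F]
    (TriData.tensor T).Bp)) := c1.tensorProduct (c2.tensorProduct c3)
  let c : Module.Basis _ F (⨂[F] j, A j) := Basis.piTensorProduct fun j =>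
    ((b1 j).tensorProduct ((b2 j).tensorProduct (b3 j))).map (LinearEquiv.ofBijective _ (hT j))
  let e := b.equiv c ⟨fun p j => (p.1 j, p.2.1 j, p.2.2 j),
    fun p => (fun j => (p j).1, fun j => (p j).2.1, fun j => (p j).2.2), fun _ => rfl, fun _ => rfl⟩
  have h : (TriData.tensor T).mulMap = e.toLinearMap := by
    refine b.ext fun p => ?_
    refine Eq.trans ?_ (b.equiv_apply p c _).symm
    have hb : b p = (c1 p.1) ⊗ₜ ((c2 p.2.1) ⊗ₜ (c3 p.2.2)) := by
      refine (Module.Basis.tensorProduct_apply' _ _ _).trans ?_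
      rw [Module.Basis.tensorProduct_apply']
    have h1 : ((c1 p.1 : (TriData.tensor T).Bm) : ⨂[F] j, A j) =
        PiTensorProduct.tprod F fun j => (b1 j (p.1 j) : A j) :=
      coe_tensorSubBasis b1 _
    have h2 : ((c2 p.2.1 : (TriData.tensor T).H1) : ⨂[F] j, A j) =
        PiTensorProduct.tprod F fun j => (b2 j (p.2.1 j) : A j) :=
      coe_tensorSubBasis b2 _
    have h3 : ((c3 p.2.2 : (TriData.tensor T).Bp) : ⨂[F] j, A j) =
        PiTensorProduct.tprod F fun j => (b3 j (p.2.2 j) : A j) :=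
      coe_tensorSubBasis b3 _
    rw [hb, TriData.mulMap_tmul, h1, h2, h3]
    simp only [c, Module.Basis.tensorProduct_apply', Module.Basis.map_apply,
      Basis.piTensorProduct_apply, LinearEquiv.ofBijective_apply, TriData.mulMap_tmul]
    rw [PiTensorProduct.tprod_mul_tprod, PiTensorProduct.tprod_mul_tprod]
    rfl
  rw [h]
  exact e.bijective

theorem isTriangular_tensor {T : ∀ j, TriData F (A j)} (hT : ∀ j, (T j).IsTriangular) :
    (TriData.tensor T).IsTriangular := by
  have := fun j => (hT j).nontrivial
  have hi : ∀ x, (TriData.tensor T).i (PiTensorProduct.tprod F x) =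
      PiTensorProduct.tprod F fun j => (T j).i (x j) := PiTensorProduct.map_tprod _
  have hmem : ∀ S S' S'' : ∀ j, Subalgebra F (A j),
      (∀ j, ∀ b ∈ S j, (T j).i b ∈ Subalgebra.toSubmodule (S' j) * Subalgebra.toSubmodule (S'' j)) →
      ∀ b ∈ tensorSub S, (TriData.tensor T).i b ∈
        Subalgebra.toSubmodule (tensorSub S') * Subalgebra.toSubmodule (tensorSub S'') := by
    intro S S' S'' h b hb
    rw [mem_tensorSub] at hb
    suffices H : tprodSpan (fun j => Subalgebra.toSubmodule (S j)) ≤ (Subalgebra.toSubmodule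
        (tensorSub S') * Subalgebra.toSubmodule (tensorSub S'')).comap (TriData.tensor T).i from H hb
    refine Submodule.span_le.2 ?_
    rintro _ ⟨x, hx, rfl⟩
    rw [SetLike.mem_coe, Submodule.mem_comap, hi]
    refine tprod_mem_of_mem_span (s := fun j => (Subalgebra.toSubmodule (S' j) : Set (A j)) *
      (Subalgebra.toSubmodule (S'' j) : Set (A j))) (fun y hy => ?_) _ fun j => ?_
    · choose p hp q hq hpq using fun j => Set.mem_mul.1 (hy j)
      have : y = p * q := (funext hpq).symm
      rw [this, ← PiTensorProduct.tprod_mul_tprod]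
      exact Submodule.mul_mem_mul (mem_tensorSub.2 (tprod_mem_tprodSpan hp))
        (mem_tensorSub.2 (tprod_mem_tprodSpan hq))
    · rw [← Submodule.mul_eq_span_mul_set]
      exact h j _ (hx j)
  refine ⟨nontrivial_piTensorProduct (F := F), bijective_mulMap_tensor fun j => (hT j).bijective,
    fun a b => ?_, fun a => ?_, fun h hh => ?_, hmem _ _ _ fun j => (hT j).i_Bp,
    hmem _ _ _ fun j => (hT j).i_Bm⟩
  · induction a using PiTensorProduct.induction_on with
    | add x y hx hy => rw [add_mul, map_add, map_add, hx, hy, mul_add]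
    | smul_tprod r x =>
      induction b using PiTensorProduct.induction_on with
      | add y z hy hz => rw [mul_add, map_add, map_add, hy, hz, add_mul]
      | smul_tprod s y =>
        rw [smul_mul_smul_comm, map_smul, map_smul, map_smul, smul_mul_smul_comm,
          PiTensorProduct.tprod_mul_tprod, hi, hi, hi, PiTensorProduct.tprod_mul_tprod, mul_comm s]
        congr 2
        ext j
        exact (hT j).i_mul _ _
  · induction a using PiTensorProduct.induction_on with
    | add x y hx hy => rw [map_add, map_add, hx, hy]
    | smul_tprod r x =>
      rw [map_smul, map_smul, hi, hi]
      congr 2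
      ext j
      exact (hT j).i_i _
  · rw [show (TriData.tensor T).H1 = tensorSub fun j => (T j).H1 from rfl, mem_tensorSub] at hh
    refine Submodule.span_induction ?_ (map_zero _) (fun x y _ _ hx hy => by rw [map_add, hx, hy])
      (fun r x _ hx => by rw [map_smul, hx]) hh
    rintro _ ⟨x, hx, rfl⟩
    rw [hi]
    congr 1
    ext j
    exact (hT j).i_fix _ (hx j)

variable {D : ∀ j, RTAData F (A j)}

variable (D) in
/-- The tensor product of automorphisms of the `H₀ⱼ`. -/
def RTAData.tensorAut0 : (∀ j, (D j).H0 ≃ₐ[F] (D j).H0) →*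
    ((RTAData.tensor D).H0 ≃ₐ[F] (RTAData.tensor D).H0) :=
  tensorAut fun j => (D j).H0

theorem Q0_tensor : (RTAData.tensor D).Q0 =
    RTAData.tensorAut0 D '' {θ | ∀ j, θ j ∈ (D j).Q0} := by
  ext θ
  constructor
  · rintro ⟨θ', h⟩
    refine ⟨θ', fun j => (h j).1, tensorSub_aut_ext fun j x => ?_⟩
    exact (tensorAut_incl _ _ _ _).trans ((h j).2 x).symm
  · rintro ⟨θ', h, rfl⟩
    exact ⟨θ', fun j => ⟨h j, fun x => tensorAut_incl _ _ _ _⟩⟩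

section

variable (hD : ∀ j, (D j).IsRTA)
include hD

theorem isTriangular_tensor_of_isRTA : (RTAData.tensor D).toTriData.IsTriangular :=
  isTriangular_tensor fun j => (hD j).triangular

theorem nontrivial_of_isRTA (j : ι) : Nontrivial (A j) := (hD j).triangular.nontrivial

theorem tensorAut0_injective : Function.Injective (RTAData.tensorAut0 D) :=
  have := nontrivial_of_isRTA hD
  tensorAut_injective _

/-- The `H₀`-root spaces of a tensor product are the tensor products of root spaces. -/
theorem BpRoot0_tensor (θ : ∀ j, (D j).H0 ≃ₐ[F] (D j).H0) :
    (RTAData.tensor D).BpRoot0 (RTAData.tensorAut0 D θ) =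
      tprodSpan fun j => (D j).BpRoot0 (θ j) := by
  have := nontrivial_of_isRTA hD
  have key := eq_of_iSupIndep_of_le (V := fun σ => (RTAData.tensor D).BpRoot0 σ)
    (U := fun σ => ⨆ (θ) (_ : RTAData.tensorAut0 D θ = σ),
      tprodSpan fun j => (D j).BpRoot0 (θ j))
    ((isTriangular_tensor_of_isRTA hD).iSupIndep_rootSpace _ (RTAData.tensor D).H0_le) ?_ ?_
    (RTAData.tensorAut0 D θ)
  · rw [← key]
    refine le_antisymm (iSup₂_le fun θ' h => ?_) (le_iSup₂_of_le θ rfl le_rfl)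
    rw [tensorAut0_injective hD h]
  · refine fun σ => iSup₂_le ?_
    rintro θ rfl
    refine Submodule.span_le.2 ?_
    rintro _ ⟨x, hx, rfl⟩
    exact ⟨mem_tensorSub.2 (tprod_mem_tprodSpan fun j => (hx j).1),
      tprod_mem_rootSpace fun j => (hx j).2⟩
  · refine fun σ => inf_le_left.trans ?_
    refine (toSubmodule_tensorSub _).le.trans ((tprodSpan_le_iSup
      (fun j (θ : (D j).Q1) => (D j).BpRoot1 θ.1) fun j => (hD j).decomp.2.ge).trans ?_)
    refine iSup_le fun p => ?_
    choose θ₀ h0 h1 using fun j => (p j).2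
    exact le_iSup_of_le (RTAData.tensorAut0 D θ₀) (le_iSup₂_of_le θ₀ rfl
      (tprodSpan_mono fun j => RTAData.BpRoot1_le (h1 j)))

theorem isRTA_tensor : (RTAData.tensor D).IsRTA := by
  have := nontrivial_of_isRTA hD
  have hT := isTriangular_tensor_of_isRTA hD
  refine ⟨hT, ?_, ⟨?_, ?_⟩, ?_, ?_⟩
  · rw [Q0_tensor]
    exact isPositiveMonoid_image (tensorAut0_injective hD) fun j => (hD j).positive
  · exact (hT.iSupIndep_rootSpace _ le_rfl).comp Subtype.val_injective
  · refine le_antisymm (iSup_le fun _ => inf_le_left) ?_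
    refine (toSubmodule_tensorSub _).le.trans ((tprodSpan_le_iSup
      (fun j (θ : (D j).Q1) => (D j).BpRoot1 θ.1) fun j => (hD j).decomp.2.ge).trans ?_)
    refine iSup_le fun p => ?_
    choose θ₀ h0 h1 using fun j => (p j).2
    have hQ : tensorAut (fun j => (D j).H1) (fun j => (p j).1) ∈ (RTAData.tensor D).Q1 := by
      refine ⟨RTAData.tensorAut0 D θ₀, ?_, fun x => tensorAut_inclusion (fun j => (D j).H0_le) _ h1 x⟩
      rw [Q0_tensor]
      exact ⟨θ₀, h0, rfl⟩
    refine le_iSup_of_le ⟨_, hQ⟩ (Submodule.span_le.2 ?_)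
    rintro _ ⟨x, hx, rfl⟩
    exact ⟨mem_tensorSub.2 (tprod_mem_tprodSpan fun j => (hx j).1),
      tprod_mem_rootSpace fun j => (hx j).2⟩
  · have h1 := BpRoot0_tensor hD 1
    rw [map_one] at h1
    refine h1.trans ?_
    simp only [Pi.one_apply, (hD _).root_one]
    refine le_antisymm (Submodule.span_le.2 ?_) ?_
    · rintro _ ⟨x, hx, rfl⟩
      choose c hc using fun j => Submodule.mem_span_singleton.1 (hx j)
      rw [← funext hc, MultilinearMap.map_smul_univ]
      exact Submodule.smul_mem _ _ (Submodule.mem_span_singleton_self _)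
    · rw [Submodule.span_singleton_le_iff_mem]
      exact tprod_mem_tprodSpan fun j => Submodule.mem_span_singleton_self _
  · rw [Q0_tensor]
    rintro _ ⟨θ, h, rfl⟩
    rw [BpRoot0_tensor hD]
    exact finiteDimensional_tprodSpan fun j => (hD j).finite _ (h j)

theorem isStrict_tensor_iff : (RTAData.tensor D).IsStrict ↔ ∀ j, (D j).IsStrict := by
  have := nontrivial_of_isRTA hD
  exact tensorSub_eq_iff

end

end Tensor

/-! ### Based and discretely graded monoids in a product of groups -/

section Monoids

variable {G Γ : Type*} [Group G] [Group Γ]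

theorem noncommProd_map_eq {M α : Type*} [CommMonoid M] (f : M →* G) (s : Finset α) (g : α → M)
    (h : (s : Set α).Pairwise (Function.onFun Commute fun a => f (g a))) :
    s.noncommProd (fun a => f (g a)) h = f (∏ a ∈ s, g a) := by
  rw [← Finset.noncommProd_eq_prod]
  exact (Finset.map_noncommProd s g _ f).symm

/-- The image of the positive cone of a free abelian group is generated by the images of the
basis elements. -/
theorem closure_range_single {κ : Type*} (f : Multiplicative (κ →₀ ℤ) →* G) :
    (Submonoid.closure (Set.range fun k => f (.ofAdd (.single k 1))) : Set G) =
      f '' {x | ∀ k, 0 ≤ x.toAdd k} := by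
  classical
  apply subset_antisymm
  · let P : Submonoid (Multiplicative (κ →₀ ℤ)) :=
      { carrier := {x | ∀ k, 0 ≤ x.toAdd k}
        one_mem' := fun k => le_rfl
        mul_mem' := fun hx hy k => add_nonneg (hx k) (hy k) }
    suffices H : Submonoid.closure (Set.range fun k => f (.ofAdd (.single k 1))) ≤ P.map f from H
    rw [Submonoid.closure_le]
    rintro _ ⟨k, rfl⟩
    refine ⟨_, fun l => ?_, rfl⟩
    simp only [toAdd_ofAdd, Finsupp.single_apply]
    split_ifs <;> simp
  · rintro _ ⟨x, hx, rfl⟩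
    have h : x = ∏ k ∈ x.toAdd.support,
        (Multiplicative.ofAdd (Finsupp.single k (1 : ℤ))) ^ (x.toAdd k).toNat := by
      refine Multiplicative.toAdd.injective ?_
      rw [toAdd_prod]
      conv_lhs => rw [← Finsupp.sum_single x.toAdd]
      refine Finset.sum_congr rfl fun k _ => ?_
      rw [toAdd_pow, toAdd_ofAdd, Finsupp.smul_single, nsmul_eq_mul, mul_one,
        Int.toNat_of_nonneg (hx k)]
    suffices H : x ∈ (Submonoid.closure (Set.range fun k => f (.ofAdd (.single k 1)))).comap f
      from H
    rw [h]
    refine Submonoid.prod_mem _ fun k _ => Submonoid.pow_mem _ ?_ _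
    exact Submonoid.subset_closure ⟨k, rfl⟩

/-- A monoid is based if it is the image of the positive cone of a free abelian group under an
injective homomorphism; `exists_hom_of_isBasedMonoid` is the converse. -/
theorem isBasedMonoid_of_hom {Q : Set G} {κ : Type*} (f : Multiplicative (κ →₀ ℤ) →* G)
    (hf : Function.Injective f) (hQ : f '' {x | ∀ k, 0 ≤ x.toAdd k} = Q) : IsBasedMonoid Q := by
  classical
  have hclos := (closure_range_single f).trans hQ
  refine ⟨Set.range fun k => f (.ofAdd (.single k 1)), ?_, ?_, ?_, hclos⟩
  · rintro _ ⟨k, rfl⟩ _ ⟨l, rfl⟩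
    exact (Commute.all _ _).map f
  · rw [← hclos]
    exact Submonoid.subset_closure
  · intro s hs c h a ha
    have hs' : ∀ a : G, ∃ k : κ, a ∈ s → f (.ofAdd (.single k 1)) = a := by
      intro b
      by_cases hb : b ∈ s
      · exact (hs b hb).imp fun _ h _ => h
      · exact (hs a ha).imp fun _ _ h => (hb h).elim
    choose k hk using hs'
    have h1 : f (∏ a ∈ s, (Multiplicative.ofAdd (Finsupp.single (k a) (1 : ℤ))) ^ c a) = 1 := by
      rw [← noncommProd_map_eq f _ _ fun _ _ _ _ _ => (Commute.all _ _).map f, ← h]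
      refine Finset.noncommProd_congr rfl (fun b hb => ?_) _
      rw [map_zpow, hk b hb]
    have h2 := congrArg (fun x => x.toAdd (k a)) ((map_eq_one_iff f hf).1 h1)
    simp only [toAdd_prod, toAdd_zpow, toAdd_ofAdd, Finsupp.smul_single, toAdd_one,
      Finsupp.finsetSum_apply, Finsupp.coe_zero, Pi.zero_apply] at h2
    rw [Finset.sum_eq_single a] at h2
    · simpa using h2
    · intro b hb hne
      refine Finsupp.single_eq_of_ne ?_
      intro e
      exact hne (by rw [← hk b hb, ← hk a ha, e])
    · exact fun h => (h ha).elim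

/-- A based monoid is the positive cone of a copy of `κ →₀ ℤ` in the group. -/
theorem exists_hom_of_isBasedMonoid {Q : Set G} (h : IsBasedMonoid Q) :
    ∃ (κ : Set G) (f : Multiplicative (κ →₀ ℤ) →* G), Function.Injective f ∧
      f '' {x | ∀ k, 0 ≤ x.toAdd k} = Q := by
  classical
  obtain ⟨Δ, hcomm, hΔ, hind, hQ⟩ := h
  have := Subgroup.isMulCommutative_closure hcomm
  let : CommGroup (Subgroup.closure Δ) :=
    { (inferInstance : Group (Subgroup.closure Δ)) with mul_comm := mul_comm' }
  let g : (Δ →₀ ℤ) →+ Additive (Subgroup.closure Δ) := Finsupp.liftAddHom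
    (M := ℤ) (N := Additive (Subgroup.closure Δ)) fun a : Δ => zmultiplesHom (Additive (Subgroup.closure Δ))
      (Additive.ofMul (⟨a.1, Subgroup.subset_closure a.2⟩ : Subgroup.closure Δ))
  let f : Multiplicative (Δ →₀ ℤ) →* G :=
    (Subgroup.closure Δ).subtype.comp (AddMonoidHom.toMultiplicativeLeft g)
  have hsingle : ∀ a : Δ, f (.ofAdd (.single a 1)) = a := by
    intro a
    simp [f, g]
  refine ⟨Δ, f, ?_, ?_⟩
  · rw [injective_iff_map_eq_one]
    intro x hx
    let c : G → ℤ := fun a => if h : a ∈ Δ then x.toAdd ⟨a, h⟩ else 0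
    let P : G → Multiplicative (Δ →₀ ℤ) := fun a => if h : a ∈ Δ then .ofAdd (.single ⟨a, h⟩ 1) else 1
    have hc : ∀ a : Δ, c a = x.toAdd a := fun a => dif_pos a.2
    have hP : ∀ a : Δ, P a = .ofAdd (.single a 1) := fun a => dif_pos a.2
    let s : Finset G := x.toAdd.support.map (Function.Embedding.subtype _)
    have hs : ∀ a ∈ s, a ∈ Δ := by
      intro a ha
      obtain ⟨b, _, rfl⟩ := Finset.mem_map.1 ha
      exact b.2
    have h1 : ∏ a ∈ s, P a ^ c a = x := by
      rw [Finset.prod_map]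
      simp only [Function.Embedding.subtype_apply, hc, hP]
      refine Multiplicative.toAdd.injective ?_
      rw [toAdd_prod]
      conv_rhs => rw [← Finsupp.sum_single x.toAdd]
      refine Finset.sum_congr rfl fun k _ => ?_
      rw [toAdd_zpow, toAdd_ofAdd, Finsupp.smul_single, smul_eq_mul, mul_one]
    have h2 := hind s hs c (by
      rw [← hx, ← h1, ← noncommProd_map_eq f _ _ fun _ _ _ _ _ => (Commute.all _ _).map f]
      refine Finset.noncommProd_congr rfl (fun b hb => ?_) _
      rw [map_zpow, hP ⟨b, hs b hb⟩, hsingle])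
    refine Multiplicative.toAdd.injective (Finsupp.ext fun a => ?_)
    by_contra h
    exact h ((hc a).symm.trans (h2 a (Finset.mem_map.2 ⟨a, Finsupp.mem_support_iff.2 h, rfl⟩)))
  · rw [← hQ, ← closure_range_single, funext hsingle, Subtype.range_coe]

end Monoids

section Pi
variable {ι : Type*} [Fintype ι] [DecidableEq ι] {G : ι → Type*} [∀ j, Group (G j)]
  {Γ : Type*} [Group Γ] {Φ : (∀ j, G j) →* Γ} (hΦ : Function.Injective Φ) {Q : ∀ j, Set (G j)}
  (hQ : ∀ j, IsPositiveMonoid (Q j))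
include hΦ hQ

theorem isDiscreteMonoid_image_iff :
    IsDiscreteMonoid (Φ '' {θ | ∀ j, θ j ∈ Q j}) ↔ ∀ j, IsDiscreteMonoid (Q j) := by
  constructor
  · intro h j y hy
    have hm : ∀ x ∈ Q j, Φ (Pi.mulSingle j x) ∈ Φ '' {θ | ∀ j, θ j ∈ Q j} := by
      refine fun x hx => ⟨_, fun k => ?_, rfl⟩
      by_cases hk : k = j
      · subst hk
        rwa [Pi.mulSingle_eq_same]
      · rw [Pi.mulSingle_eq_of_ne hk]
        exact (hQ k).one_mem
    refine Set.Finite.of_injOn (f := fun x => Φ (Pi.mulSingle j x)) ?_ ?_ (h _ (hm y hy))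
    · rintro x ⟨hx, q, hq, rfl⟩
      exact ⟨hm x hx, _, hm q hq, by rw [Pi.mulSingle_mul, map_mul]⟩
    · exact (hΦ.comp (Pi.mulSingle_injective j)).injOn
  · rintro h _ ⟨y, hy, rfl⟩
    refine ((Set.Finite.pi' fun j => h j (y j) (hy j)).image Φ).subset ?_
    rintro _ ⟨⟨x, hx, rfl⟩, _, ⟨q, hq, rfl⟩, e⟩
    rw [← map_mul] at e
    exact ⟨x, fun j => ⟨hx j, q j, hq j, congrFun (hΦ e) j⟩, rfl⟩

/-- A product of positive monoids is based if and only if the factors are. A basis of the product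
is the disjoint union of bases of the factors; conversely, positivity forces the elements of a
basis of the product which occur in an element of the `j`-th factor to lie in that factor. -/
theorem isBasedMonoid_image_iff :
    IsBasedMonoid (Φ '' {θ | ∀ j, θ j ∈ Q j}) ↔ ∀ j, IsBasedMonoid (Q j) := by
  classical
  constructor
  · intro h j
    obtain ⟨κ, f, hf, hfQ⟩ := exists_hom_of_isBasedMonoid h
    have hrange : ∀ x, f x ∈ Φ.range := by
      intro x
      induction x using Multiplicative.rec with | _ x
      induction x using Finsupp.induction_linear with
      | zero => exact ⟨1, (map_one Φ).trans (map_one f).symm⟩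
      | add x y hx hy => rw [ofAdd_add, map_mul]; exact mul_mem hx hy
      | single k n =>
        have h1 : Multiplicative.ofAdd (Finsupp.single k n) = .ofAdd (.single k 1) ^ n := by
          rw [← ofAdd_zsmul, Finsupp.smul_single, smul_eq_mul, mul_one]
        rw [h1, map_zpow]
        refine zpow_mem ?_ _
        have h0 : ∀ l, 0 ≤ (Finsupp.single k (1 : ℤ)) l := fun l => by
          rw [Finsupp.single_apply]
          split_ifs <;> simp
        obtain ⟨θ, -, e⟩ := hfQ.le ⟨.ofAdd (.single k 1), h0, rfl⟩
        exact ⟨θ, e⟩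
    let φ : Multiplicative (κ →₀ ℤ) →* ∀ j, G j :=
      (MonoidHom.ofInjective hΦ).symm.toMonoidHom.comp (f.codRestrict _ hrange)
    have hφ : ∀ x, Φ (φ x) = f x := fun x =>
      congrArg Subtype.val ((MonoidHom.ofInjective hΦ).apply_symm_apply ⟨f x, hrange x⟩)
    have hφinj : Function.Injective φ := fun x y e => hf (by rw [← hφ, ← hφ, e])
    have hφQ : ∀ x : Multiplicative (κ →₀ ℤ), (∀ k, 0 ≤ x.toAdd k) → ∀ j, φ x j ∈ Q j := by
      intro x hx
      obtain ⟨θ, hθ, e⟩ := hfQ.le ⟨x, hx, rfl⟩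
      rw [← hφ] at e
      rw [← hΦ e]
      exact hθ
    have hφQ' : ∀ θ : ∀ j, G j, (∀ j, θ j ∈ Q j) →
        ∃ x : Multiplicative (κ →₀ ℤ), (∀ k, 0 ≤ x.toAdd k) ∧ φ x = θ := by
      intro θ hθ
      obtain ⟨x, hx, e⟩ := hfQ.ge ⟨θ, hθ, rfl⟩
      exact ⟨x, hx, hΦ (by rw [hφ, e])⟩
    -- the basis elements which lie in the `j`-th factor
    let κj := {k : κ // ∀ i, i ≠ j → φ (.ofAdd (.single k 1)) i = 1}
    let E : Multiplicative (κj →₀ ℤ) →* Multiplicative (κ →₀ ℤ) :=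
      AddMonoidHom.toMultiplicative (Finsupp.mapDomain.addMonoidHom Subtype.val)
    have hE : Function.Injective E := Finsupp.mapDomain_injective Subtype.val_injective
    have hE1 : ∀ x i, i ≠ j → φ (E x) i = 1 := by
      intro x i hi
      have : ((Pi.evalMonoidHom G i).comp (φ.comp E)) = 1 := by
        refine MonoidHom.toAdditiveRight.injective ?_
        refine Finsupp.addHom_ext' fun k => ?_
        ext
        change φ (E (.ofAdd (.single k 1))) i = 1
        have : E (.ofAdd (.single k 1)) = .ofAdd (.single k.1 1) := Finsupp.mapDomain_single
        rw [this]
        exact k.2 i hi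
      exact DFunLike.congr_fun this x
    refine isBasedMonoid_of_hom ((Pi.evalMonoidHom G j).comp (φ.comp E)) ?_ ?_
    · rw [injective_iff_map_eq_one]
      intro x hx
      refine (map_eq_one_iff E hE).1 ((map_eq_one_iff φ hφinj).1 ?_)
      funext i
      by_cases hi : i = j
      · subst hi
        exact hx
      · exact hE1 x i hi
    · apply subset_antisymm
      · rintro _ ⟨x, hx, rfl⟩
        refine hφQ _ (fun k => ?_) j
        change 0 ≤ (Finsupp.mapDomain Subtype.val x.toAdd) k
        rw [Finsupp.mapDomain, Finsupp.sum_apply]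
        refine Finset.sum_nonneg fun l _ => ?_
        dsimp only
        rw [Finsupp.single_apply]
        split_ifs
        exacts [hx l, le_rfl]
      · intro y hy
        obtain ⟨z, hz, e⟩ := hφQ' (Pi.mulSingle j y) (fun k => by
          by_cases hk : k = j
          · subst hk
            rwa [Pi.mulSingle_eq_same]
          · rw [Pi.mulSingle_eq_of_ne hk]
            exact (hQ k).one_mem)
        -- by positivity, every basis element occurring in `z` lies in the `j`-th factor
        have hsupp : ∀ k ∈ z.toAdd.support, ∀ i, i ≠ j → φ (.ofAdd (.single k 1)) i = 1 := by
          intro k hk i hi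
          have hk' : 1 ≤ z.toAdd k :=
            Int.add_one_le_iff.2 (lt_of_le_of_ne (hz k) (Finsupp.mem_support_iff.1 hk).symm)
          have e1 : z = .ofAdd (.single k 1) * .ofAdd (z.toAdd - .single k 1) := by
            rw [← ofAdd_add, add_sub_cancel, ofAdd_toAdd]
          have e2 : φ (.ofAdd (.single k 1)) i * φ (.ofAdd (z.toAdd - .single k 1)) i = 1 := by
            rw [← Pi.mul_apply, ← map_mul, ← e1, e, Pi.mulSingle_eq_of_ne hi]
          have q1 := hφQ (.ofAdd (.single k 1)) (fun l => by
            simp only [toAdd_ofAdd, Finsupp.single_apply]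
            split_ifs <;> simp) i
          have q2 := hφQ (.ofAdd (z.toAdd - .single k 1)) (fun l => by
            simp only [toAdd_ofAdd, Finsupp.sub_apply, Finsupp.single_apply]
            split_ifs with hl
            · subst hl
              omega
            · simpa using hz l) i
          by_contra h1
          refine (hQ i).mul_ne_one _ q1 _ q2 h1 (fun h2 => h1 ?_) e2
          rwa [h2, mul_one] at e2
        refine ⟨.ofAdd (z.toAdd.comapDomain Subtype.val Subtype.val_injective.injOn),
          fun k => hz k.1, ?_⟩
        have : E (.ofAdd (z.toAdd.comapDomain Subtype.val Subtype.val_injective.injOn)) = z := by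
          refine Finsupp.mapDomain_comapDomain _ Subtype.val_injective _ fun k hk => ?_
          exact ⟨⟨k, hsupp k hk⟩, rfl⟩
        change φ (E _) j = y
        rw [this, e, Pi.mulSingle_eq_same]
  · intro h
    choose κ f hf hfQ using fun j => exists_hom_of_isBasedMonoid (h j)
    let E : ((Σ j, κ j) →₀ ℤ) ≃+ ∀ j, κ j →₀ ℤ := Finsupp.sigmaFinsuppAddEquivPiFinsupp
    have hE : ∀ x j k, E x j k = x ⟨j, k⟩ := fun _ _ _ => rfl
    let g : Multiplicative ((Σ j, κ j) →₀ ℤ) →* ∀ j, G j :=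
      MonoidHom.pi fun j => (f j).comp (AddMonoidHom.toMultiplicative
        ((Pi.evalAddMonoidHom (fun j => κ j →₀ ℤ) j).comp E.toAddMonoidHom))
    have hg : ∀ x j, g x j = f j (.ofAdd (E x.toAdd j)) := fun x j => rfl
    refine isBasedMonoid_of_hom (Φ.comp g) (hΦ.comp fun x y e => ?_) ?_
    · refine Multiplicative.toAdd.injective (E.injective (funext fun j => ?_))
      exact Multiplicative.ofAdd.injective (hf j (congrFun e j))
    · rw [MonoidHom.coe_comp, Set.image_comp]
      congr 1
      apply subset_antisymm
      · rintro _ ⟨x, hx, rfl⟩ j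
        rw [← hfQ j, hg]
        exact ⟨_, fun k => hx ⟨j, k⟩, rfl⟩
      · intro θ hθ
        have : ∀ j, ∃ x : Multiplicative (κ j →₀ ℤ), (∀ k, 0 ≤ x.toAdd k) ∧ f j x = θ j := by
          intro j
          have := hθ j
          rw [← hfQ j] at this
          exact this
        choose x hx e using this
        refine ⟨.ofAdd (E.symm fun j => (x j).toAdd), fun k => ?_, funext fun j => ?_⟩
        · exact hx k.1 k.2
        · rw [hg, toAdd_ofAdd, AddEquiv.apply_symm_apply, ofAdd_toAdd, e]

end Pi

section Tensor

variable {ι : Type} [Fintype ι] [DecidableEq ι] {F : Type u} [Field F] {A : ι → Type u}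
  [∀ j, Ring (A j)] [∀ j, Algebra F (A j)] {D : ∀ j, RTAData F (A j)} (hD : ∀ j, (D j).IsRTA)
include hD

theorem isBased_tensor_iff : (RTAData.tensor D).IsBased ↔ ∀ j, (D j).IsBased := by
  refine Iff.trans ?_ (isBasedMonoid_image_iff (tensorAut0_injective hD)
    fun j => (hD j).positive)
  rw [← Q0_tensor]
  rfl

theorem isDiscretelyGraded_tensor_iff :
    (RTAData.tensor D).IsDiscretelyGraded ↔ ∀ j, (D j).IsDiscretelyGraded := by
  refine Iff.trans ?_ (isDiscreteMonoid_image_iff (tensorAut0_injective hD)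
    fun j => (hD j).positive)
  rw [← Q0_tensor]
  rfl

end Tensor

/-! ### Tensor products of modules -/

section TensorModule

variable {ι : Type} [Fintype ι] [DecidableEq ι] {F : Type u} [Field F] {A : ι → Type u}
  [∀ j, Ring (A j)] [∀ j, Algebra F (A j)]
  {W : ι → Type u} [∀ j, AddCommGroup (W j)] [∀ j, Module F (W j)] [∀ j, Module (A j) (W j)]
  [∀ j, IsScalarTower F (A j) (W j)]
  {W' : ι → Type u} [∀ j, AddCommGroup (W' j)] [∀ j, Module F (W' j)] [∀ j, Module (A j) (W' j)]
  [∀ j, IsScalarTower F (A j) (W' j)]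
  {V : Type u} [AddCommGroup V] [Module F V] [Module (⨂[F] j, A j) V]
  [IsScalarTower F (⨂[F] j, A j) V]

/-- The factorwise action of `⨂ⱼ Aⱼ` on `⨂ⱼ Wⱼ`. -/
def tensorAction : (⨂[F] j, A j) →ₐ[F] Module.End F (⨂[F] j, W j) :=
  PiTensorProduct.liftAlgHom
    ((PiTensorProduct.mapMultilinear F W W).compLinearMap fun j =>
      (Algebra.lsmul F F (W j) : A j →ₐ[F] _).toLinearMap)
    (by
      refine PiTensorProduct.ext (MultilinearMap.ext fun x => ?_)
      simp)
    (fun a b => by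
      refine PiTensorProduct.ext (MultilinearMap.ext fun x => ?_)
      simp)

/-- The `⨂ⱼ Aⱼ`-module structure of `⨂ⱼ Wⱼ`. -/
abbrev tensorModule : Module (⨂[F] j, A j) (⨂[F] j, W j) :=
  Module.compHom _ (tensorAction (A := A) (W := W)).toRingHom

attribute [local instance] tensorModule

theorem tensor_smul_def (a : ⨂[F] j, A j) (z : ⨂[F] j, W j) : a • z = tensorAction a z := rfl

theorem tprod_smul_tprod (a : ∀ j, A j) (x : ∀ j, W j) :
    PiTensorProduct.tprod F a • PiTensorProduct.tprod F x =
      PiTensorProduct.tprod F fun j => a j • x j := by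
  rw [tensor_smul_def, tensorAction]
  refine (DFunLike.congr_fun (PiTensorProduct.lift.tprod a) _).trans ?_
  simp

theorem isScalarTower_tensor : IsScalarTower F (⨂[F] j, A j) (⨂[F] j, W j) :=
  ⟨fun c a z => by rw [tensor_smul_def, map_smul]; rfl⟩

attribute [local instance] isScalarTower_tensor

theorem single_smul_tprod (j : ι) (a : A j) (x : ∀ j, W j) :
    PiTensorProduct.singleAlgHom (R := F) j a • PiTensorProduct.tprod F x =
      PiTensorProduct.tprod F (Function.update x j (a • x j)) := by
  rw [singleAlgHom_eq, tprod_smul_tprod]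
  congr 1
  funext k
  by_cases hk : k = j
  · subst hk
    simp
  · simp [hk]

/-- An `F`-linear map which is compatible with the action of pure tensors is linear over
`⨂ⱼ Aⱼ`. -/
def linearOfTprod {V' : Type u} [AddCommGroup V'] [Module F V'] [Module (⨂[F] j, A j) V']
    [IsScalarTower F (⨂[F] j, A j) V'] (g : V' →ₗ[F] V)
    (h : ∀ (a : ∀ j, A j) z, g (PiTensorProduct.tprod F a • z) = PiTensorProduct.tprod F a • g z) :
    V' →ₗ[⨂[F] j, A j] V where
  toFun := g
  map_add' := map_add g
  map_smul' := fun a z => by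
    induction a using PiTensorProduct.induction_on with
    | smul_tprod r a => rw [smul_assoc, map_smul, h, RingHom.id_apply, smul_assoc]
    | add a b ha hb =>
      rw [RingHom.id_apply] at ha hb ⊢
      rw [add_smul, map_add, ha, hb, add_smul]

theorem map_tprod_smul {g : (⨂[F] j, W j) →ₗ[F] V}
    (h : ∀ (a : ∀ j, A j) (x : ∀ j, W j), g (PiTensorProduct.tprod F fun j => a j • x j) =
      PiTensorProduct.tprod F a • g (PiTensorProduct.tprod F x)) (a : ∀ j, A j) (z : ⨂[F] j, W j) :
    g (PiTensorProduct.tprod F a • z) = PiTensorProduct.tprod F a • g z := by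
  induction z using PiTensorProduct.induction_on with
  | smul_tprod r x => rw [smul_comm, map_smul, tprod_smul_tprod, h, map_smul, smul_comm]
  | add y z hy hz => rw [smul_add, map_add, hy, hz, map_add, smul_add]

/-- A module isomorphic to `⨂ⱼ Wⱼ` in the sense of pure tensors is isomorphic to it as a module
over `⨂ⱼ Aⱼ`. -/
theorem isTensorModule_iff :
    IsTensorModule F A W V ↔ Nonempty ((⨂[F] j, W j) ≃ₗ[⨂[F] j, A j] V) := by
  constructor
  · rintro ⟨e, he⟩
    exact ⟨LinearEquiv.ofBijective (linearOfTprod e.toLinearMap (map_tprod_smul he)) e.bijective⟩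
  · rintro ⟨e⟩
    refine ⟨e.restrictScalars F, fun a x => ?_⟩
    rw [← tprod_smul_tprod]
    exact e.map_smul _ _

/-- The tensor product of module maps. -/
def tensorMap (f : ∀ j, W j →ₗ[A j] W' j) : (⨂[F] j, W j) →ₗ[⨂[F] j, A j] ⨂[F] j, W' j :=
  linearOfTprod (PiTensorProduct.map fun j => (f j).restrictScalars F) (map_tprod_smul fun a x => by
    simp only [PiTensorProduct.map_tprod, tprod_smul_tprod, LinearMap.restrictScalars_apply,
      map_smul])

theorem tensorMap_tprod (f : ∀ j, W j →ₗ[A j] W' j) (x : ∀ j, W j) :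
    tensorMap (F := F) f (PiTensorProduct.tprod F x) = PiTensorProduct.tprod F fun j => f j (x j) :=
  PiTensorProduct.map_tprod _ _

theorem tensorMap_injective {f : ∀ j, W j →ₗ[A j] W' j} (hf : ∀ j, Function.Injective (f j)) :
    Function.Injective (tensorMap (F := F) f) :=
  piTensorProduct_map_injective (fun j => (f j).restrictScalars F) hf

theorem tensorMap_surjective {f : ∀ j, W j →ₗ[A j] W' j} (hf : ∀ j, Function.Surjective (f j)) :
    Function.Surjective (tensorMap (F := F) f) :=
  piTensorProduct_map_surjective (fun j => (f j).restrictScalars F) hf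

theorem exists_eq_smul_tprod {v : ∀ j, W j} (hv : ∀ j x, ∃ a : A j, x = a • v j)
    (z : ⨂[F] j, W j) : ∃ a : ⨂[F] j, A j, z = a • PiTensorProduct.tprod F v := by
  induction z using PiTensorProduct.induction_on with
  | smul_tprod r x =>
    choose a ha using fun j => hv j (x j)
    refine ⟨r • PiTensorProduct.tprod F a, ?_⟩
    rw [smul_assoc, tprod_smul_tprod, ← funext ha]
  | add y z hy hz =>
    obtain ⟨a, rfl⟩ := hy
    obtain ⟨b, rfl⟩ := hz
    exact ⟨a + b, (add_smul _ _ _).symm⟩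

theorem evalExcept_single_smul (j : ι) (ψ : ∀ k, Module.Dual F (W k)) (a : A j)
    (z : ⨂[F] j, W j) :
    evalExcept j ψ (PiTensorProduct.singleAlgHom (R := F) j a • z) = a • evalExcept j ψ z := by
  induction z using PiTensorProduct.induction_on with
  | smul_tprod r x =>
    rw [smul_comm, map_smul (evalExcept j ψ), map_smul (evalExcept j ψ), single_smul_tprod,
      evalExcept_tprod, evalExcept_tprod, smul_comm a r, Function.update_self, smul_comm a]
    congr 2
    refine Finset.prod_congr rfl fun k hk => ?_
    rw [Function.update_of_ne (Finset.ne_of_mem_erase hk)]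
  | add y z hy hz => rw [smul_add, map_add, map_add, hy, hz, smul_add]

/-- The map `y ↦ v₁ ⊗ ⋯ ⊗ y ⊗ ⋯ ⊗ vₙ` inserting a vector at the `j`-th place. -/
def insertAt (v : ∀ j, W j) (j : ι) : W j →ₗ[F] ⨂[F] j, W j :=
  (PiTensorProduct.tprod F).toLinearMap v j

theorem insertAt_apply (v : ∀ j, W j) (j : ι) (y : W j) :
    insertAt (F := F) v j y = PiTensorProduct.tprod F (Function.update v j y) := rfl

theorem single_smul_insertAt (v : ∀ j, W j) (j : ι) (a : A j) (y : W j) :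
    PiTensorProduct.singleAlgHom (R := F) j a • insertAt (F := F) v j y = insertAt v j (a • y) := by
  rw [insertAt_apply, single_smul_tprod, Function.update_self, Function.update_idem,
    insertAt_apply]

theorem evalExcept_insertAt (v : ∀ j, W j) (j : ι) (y : W j) (ψ : ∀ k, Module.Dual F (W k))
    (h : ∀ k ≠ j, ψ k (v k) = 1) : evalExcept j ψ (insertAt v j y) = y := by
  rw [insertAt_apply, evalExcept_tprod, Function.update_self, Finset.prod_eq_one, one_smul]
  intro k hk
  rw [Function.update_of_ne (Finset.ne_of_mem_erase hk), h k (Finset.ne_of_mem_erase hk)]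

theorem insertAt_injective {v : ∀ j, W j} {j : ι} (hv : ∀ k ≠ j, v k ≠ 0) :
    Function.Injective (insertAt (F := F) v j) := by
  have : ∀ k, ∃ ψ : Module.Dual F (W k), k ≠ j → ψ (v k) = 1 := by
    intro k
    by_cases hk : k = j
    · exact ⟨0, fun h => (h hk).elim⟩
    · exact (Module.Projective.exists_dual_eq_one F (hv k hk)).imp fun _ h _ => h
  choose ψ hψ using this
  exact Function.LeftInverse.injective (g := evalExcept j ψ) fun y =>
    evalExcept_insertAt v j y ψ hψ

/-- If the left ideals `Iⱼ` annihilate a vector `v`, then `⨂ⱼ Aⱼ / Iⱼ` maps to the submodule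
generated by `v`. -/
theorem exists_linearMap_quotient (I : ∀ j, Submodule (A j) (A j)) {v : V}
    (hv : ∀ j, ∀ a ∈ I j, PiTensorProduct.singleAlgHom (R := F) j a • v = 0) :
    ∃ g : (⨂[F] j, A j ⧸ I j) →ₗ[⨂[F] j, A j] V,
      g (PiTensorProduct.tprod F fun j => (I j).mkQ 1) = v := by
  let π := fun j => (I j).mkQ.restrictScalars F
  have hπ : Function.Surjective (PiTensorProduct.map π) :=
    piTensorProduct_map_surjective π fun j => (I j).mkQ_surjective
  let G : (⨂[F] j, A j) →ₗ[F] V := (LinearMap.toSpanSingleton (⨂[F] j, A j) V v).restrictScalars F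
  have hG : ∀ z, PiTensorProduct.map π z = 0 → G z = 0 := by
    refine fun z => eq_zero_of_map_eq_zero π (fun j => (I j).mkQ_surjective) G fun x j hx => ?_
    have : PiTensorProduct.tprod F x =
        PiTensorProduct.tprod F (Function.update x j 1) *
          PiTensorProduct.singleAlgHom (R := F) j (x j) := by
      rw [tprod_mul_single]
      simp
    change PiTensorProduct.tprod F x • v = 0
    rw [this, mul_smul, hv j _ ((Submodule.Quotient.mk_eq_zero _).1 hx), smul_zero]
  have := Module.Free.of_divisionRing F (⨂[F] j, A j ⧸ I j)
  obtain ⟨s, hs⟩ := (PiTensorProduct.map π).exists_rightInverse_of_surjective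
    (LinearMap.range_eq_top.2 hπ)
  have key : ∀ z, G (s (PiTensorProduct.map π z)) = z • v := by
    intro z
    rw [← sub_eq_zero]
    refine (map_sub G _ _).symm.trans (hG _ ?_)
    rw [map_sub, ← LinearMap.comp_apply, hs, LinearMap.id_apply, sub_self]
  refine ⟨linearOfTprod (A := A) (V' := ⨂[F] j, A j ⧸ I j) (G.comp s) fun a z => ?_, ?_⟩
  · obtain ⟨y, rfl⟩ := hπ z
    have : PiTensorProduct.tprod F a • PiTensorProduct.map π y =
        PiTensorProduct.map π (PiTensorProduct.tprod F a * y) := by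
      induction y using PiTensorProduct.induction_on with
      | smul_tprod r x =>
        rw [map_smul, PiTensorProduct.map_tprod, smul_comm, tprod_smul_tprod, mul_smul_comm,
          PiTensorProduct.tprod_mul_tprod, map_smul, PiTensorProduct.map_tprod]
        rfl
      | add y z hy hz => rw [map_add, smul_add, hy, hz, mul_add, map_add]
    rw [LinearMap.comp_apply, LinearMap.comp_apply, this, key, key, mul_smul]
  · have : (PiTensorProduct.tprod F fun j => (I j).mkQ 1) = PiTensorProduct.map π 1 := by
      rw [PiTensorProduct.one_def, PiTensorProduct.map_tprod]
      rfl
    rw [this]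
    exact (key 1).trans (one_smul _ v)

/-- A tensor product of simple modules is simple, provided that in every factor there are a vector
`v` and a functional `φ` such that the operator `x ↦ φ x • v` can be realised on every finite set
by an element of the algebra. -/
theorem isSimpleModule_tensor (hW : ∀ j, IsSimpleModule (A j) (W j)) {v : ∀ j, W j}
    {φ : ∀ j, Module.Dual F (W j)} (hφ : ∀ j, φ j (v j) = 1)
    (h : ∀ j (s : Finset (W j)), ∃ a : A j, ∀ x ∈ s, a • x = φ j x • v j) :
    IsSimpleModule (⨂[F] j, A j) (⨂[F] j, W j) := by
  have hv : ∀ j, v j ≠ 0 := fun j h0 => by simpa [h0] using hφ j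
  rw [isSimpleModule_iff_toSpanSingleton_surjective]
  refine ⟨⟨_, 0, tprod_ne_zero hv⟩, fun z hz y => ?_⟩
  -- some pure tensor moves `z` out of the kernel of the functional `⨂ φⱼ`
  obtain ⟨a, ha⟩ : ∃ a : ∀ j, A j, tprodDual φ (PiTensorProduct.tprod F a • z) ≠ 0 := by
    by_contra! H
    refine hz (tprodDual_separating (X := A)
      (fun j a => φ j ∘ₗ (Algebra.lsmul F F (W j) a)) (fun j x hx => ?_) fun p => ?_)
    · by_contra hx0
      obtain ⟨b, hb⟩ := RTAData.exists_eq_smul_of_isSimple (A := A j) hx0 (v j)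
      have := hx b
      change φ j (b • x) = 0 at this
      rw [← hb, hφ] at this
      exact one_ne_zero this
    · rw [← H p]
      clear H hz
      induction z using PiTensorProduct.induction_on with
      | smul_tprod r x => simp [smul_comm _ r, tprod_smul_tprod]
      | add y z hy hz => rw [smul_add, map_add, map_add, hy, hz]
  -- `⨂ bⱼ`, with `bⱼ` acting on a finite-dimensional `Uⱼ` as `x ↦ φⱼ x • vⱼ`, then takes the
  -- resulting element of `⨂ Uⱼ` to a nonzero multiple of the generator `⨂ vⱼ`
  obtain ⟨U, hU, hzU⟩ := exists_finiteDimensional_mem_tprodSpan (PiTensorProduct.tprod F a • z)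
  have : ∀ j, ∃ b : A j, ∀ x ∈ U j, b • x = φ j x • v j := by
    intro j
    obtain ⟨s, hs⟩ := (Submodule.fg_iff_finiteDimensional _).2 (hU j)
    obtain ⟨b, hb⟩ := h j s
    refine ⟨b, fun x hx => ?_⟩
    rw [← hs] at hx
    induction hx using Submodule.span_induction with
    | mem x hx => exact hb x hx
    | zero => simp
    | add x y _ _ hx hy => rw [smul_add, hx, hy, map_add, add_smul]
    | smul r x _ hx => rw [smul_comm, hx, map_smul, smul_assoc]
  choose b hb using this
  have key : ∀ y ∈ tprodSpan U, PiTensorProduct.tprod F b • y =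
      tprodDual φ y • PiTensorProduct.tprod F v := by
    intro y hy
    induction hy using Submodule.span_induction with
    | mem y hy =>
      obtain ⟨x, hx, rfl⟩ := hy
      rw [tprod_smul_tprod, tprodDual_tprod, ← MultilinearMap.map_smul_univ]
      congr 1
      exact funext fun j => hb j _ (hx j)
    | zero => simp
    | add x y _ _ hx hy => rw [smul_add, hx, hy, map_add, add_smul]
    | smul r x _ hx => rw [smul_comm, hx, map_smul, smul_assoc]
  obtain ⟨c, rfl⟩ := exists_eq_smul_tprod (fun j x =>
    RTAData.exists_eq_smul_of_isSimple (A := A j) (hv j) x) y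
  set t := tprodDual φ (PiTensorProduct.tprod F a • z)
  refine ⟨t⁻¹ • (c * (PiTensorProduct.tprod F b * PiTensorProduct.tprod F a)), ?_⟩
  rw [LinearMap.toSpanSingleton_apply, smul_assoc, mul_smul, mul_smul, key _ hzU, smul_comm c,
    inv_smul_smul₀ ha]

end TensorModule

/-! ### Weights and highest weight modules of a tensor product -/

section TensorWeights

variable {ι : Type} [Fintype ι] [DecidableEq ι] {F : Type u} [Field F] {A : ι → Type u}
  [∀ j, Ring (A j)] [∀ j, Algebra F (A j)]
  {W : ι → Type u} [∀ j, AddCommGroup (W j)] [∀ j, Module F (W j)] [∀ j, Module (A j) (W j)]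
  [∀ j, IsScalarTower F (A j) (W j)]
  {V : Type u} [AddCommGroup V] [Module F V] [Module (⨂[F] j, A j) V]
  [IsScalarTower F (⨂[F] j, A j) V] {D : ∀ j, RTAData F (A j)}

attribute [local instance] tensorModule isScalarTower_tensor

open RTAData

theorem comp1_bijective : Function.Bijective (comp1 D) :=
  bijective_comp_tensorIncl _

theorem comp0_bijective : Function.Bijective (comp0 D) :=
  bijective_comp_tensorIncl _

theorem comp0_res (w : (RTAData.tensor D).H1 →ₐ[F] F) (j : ι) :
    comp0 D ((RTAData.tensor D).res w) j = (D j).res (comp1 D w j) := rfl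

theorem mem_free1_iff {F A : Type u} [Field F] [Ring A] [Algebra F A] {D : RTAData F A}
    {w : D.H1 →ₐ[F] F} : w ∈ D.free1 ↔ D.res w ∈ D.free0 := Iff.rfl

theorem comp0_act (θ : ∀ j, (D j).H0 ≃ₐ[F] (D j).H0) (w : (RTAData.tensor D).H0 →ₐ[F] F) (j : ι) :
    comp0 D ((RTAData.tensor D).act (tensorAut0 D θ) w) j =
      (D j).act (θ j) (comp0 D w j) := by
  ext x
  change w ((tensorAut0 D θ)⁻¹ (tensorIncl (fun j => (D j).H0) j x)) =
    w (tensorIncl (fun j => (D j).H0) j ((θ j)⁻¹ x))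
  rw [← map_inv]
  exact congrArg w (tensorAut_incl _ _ _ _)

theorem act_tensorAut_eq_iff {θ : ∀ j, (D j).H0 ≃ₐ[F] (D j).H0}
    {v w : (RTAData.tensor D).H0 →ₐ[F] F} :
    (RTAData.tensor D).act (tensorAut0 D θ) v = w ↔
      ∀ j, (D j).act (θ j) (comp0 D v j) = comp0 D w j := by
  rw [← comp0_bijective.1.eq_iff, funext_iff]
  simp only [comp0_act]

theorem le0_tensor_iff {v w : (RTAData.tensor D).H0 →ₐ[F] F} :
    (RTAData.tensor D).le0 v w ↔ ∀ j, (D j).le0 (comp0 D v j) (comp0 D w j) := by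
  constructor
  · rintro ⟨θ, hθ, h⟩ j
    rw [Q0_tensor] at hθ
    obtain ⟨θ', hθ', rfl⟩ := hθ
    exact ⟨θ' j, hθ' j, ((act_tensorAut_eq_iff.1 h.symm) j).symm⟩
  · intro h
    choose θ hθ e using h
    refine ⟨tensorAut0 D θ, ?_, (act_tensorAut_eq_iff.2 fun j => (e j).symm).symm⟩
    rw [Q0_tensor]
    exact ⟨θ, hθ, rfl⟩

section

variable (hD : ∀ j, (D j).IsRTA)
include hD

theorem mem_free0_tensor_iff {w : (RTAData.tensor D).H0 →ₐ[F] F} :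
    w ∈ (RTAData.tensor D).free0 ↔ ∀ j, comp0 D w j ∈ (D j).free0 := by
  have := nontrivial_of_isRTA hD
  constructor
  · intro h j θ hθ e
    let f : ((D j).H0 ≃ₐ[F] (D j).H0) →* ((RTAData.tensor D).H0 ≃ₐ[F] (RTAData.tensor D).H0) :=
      (tensorAut0 D).comp (MonoidHom.mulSingle (fun j => (D j).H0 ≃ₐ[F] (D j).H0) j)
    have hf : Function.Injective f := (tensorAut0_injective hD).comp (Pi.mulSingle_injective (M := fun j => (D j).H0 ≃ₐ[F] (D j).H0) j)
    refine (map_eq_one_iff f hf).1 (h (f θ) ?_ ?_)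
    · suffices H : (Subgroup.closure (D j).Q0).map f ≤ Subgroup.closure (RTAData.tensor D).Q0 from
        H ⟨θ, hθ, rfl⟩
      rw [MonoidHom.map_closure]
      refine Subgroup.closure_mono ?_
      rintro _ ⟨σ, hσ, rfl⟩
      rw [Q0_tensor]
      refine ⟨_, fun k => ?_, rfl⟩
      by_cases hk : k = j
      · subst hk
        rwa [MonoidHom.mulSingle_apply, Pi.mulSingle_eq_same]
      · rw [MonoidHom.mulSingle_apply, Pi.mulSingle_eq_of_ne hk]
        exact (hD k).positive.one_mem
    · refine act_tensorAut_eq_iff.2 fun k => ?_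
      by_cases hk : k = j
      · subst hk
        rwa [MonoidHom.mulSingle_apply, Pi.mulSingle_eq_same]
      · rw [MonoidHom.mulSingle_apply, Pi.mulSingle_eq_of_ne hk, act_one]
  · intro h θ hθ e
    have : Subgroup.closure (RTAData.tensor D).Q0 ≤
        (Subgroup.pi Set.univ fun j => Subgroup.closure (D j).Q0).map
          (tensorAut0 D) := by
      rw [Subgroup.closure_le, Q0_tensor]
      rintro _ ⟨σ, hσ, rfl⟩
      exact ⟨σ, fun j _ => mem_closure (hσ j), rfl⟩
    obtain ⟨σ, hσ, rfl⟩ := this hθ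
    have h1 : σ = 1 := funext fun j =>
      h j (σ j) (hσ j trivial) (act_tensorAut_eq_iff.1 e j)
    rw [h1]
    exact map_one _

theorem mem_free1_tensor_iff {w : (RTAData.tensor D).H1 →ₐ[F] F} :
    w ∈ (RTAData.tensor D).free1 ↔ ∀ j, comp1 D w j ∈ (D j).free1 :=
  mem_free1_iff.trans ((mem_free0_tensor_iff hD).trans
    (forall_congr' fun j => by rw [comp0_res, mem_free1_iff]))

end

theorem tprod_mem_weightSpace {S : ∀ j, Subalgebra F (A j)} {w : tensorSub S →ₐ[F] F}
    {x : ∀ j, W j} (hx : ∀ j, x j ∈ weightSpace (S j) (W j) (w.comp (tensorIncl S j))) :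
    PiTensorProduct.tprod F x ∈ weightSpace (tensorSub S) (⨂[F] j, W j) w := by
  intro h
  induction h using tensorSub_induction with
  | tprod y =>
    refine (tprod_smul_tprod (W := W) _ _).trans ?_
    rw [apply_tprod_coe, ← MultilinearMap.map_smul_univ]
    congr 1
    exact funext fun j => hx j (y j)
  | smul r y h => rw [Subalgebra.coe_smul, smul_assoc, h, map_smul, smul_assoc]
  | add y z hy hz => rw [Subalgebra.coe_add, add_smul, hy, hz, map_add, add_smul]

/-- Tensor products of weight spaces exhaust `⨂ⱼ Wⱼ` if every factor is the sum of its weight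
spaces. -/
theorem weightSpace_tensor {S : ∀ j, Subalgebra F (A j)}
    (hW : ∀ j, ⨆ χ, weightSpace (S j) (W j) χ = ⊤) (w : tensorSub S →ₐ[F] F) :
    weightSpace (tensorSub S) (⨂[F] j, W j) w =
      tprodSpan fun j => weightSpace (S j) (W j) (w.comp (tensorIncl S j)) := by
  refine (eq_of_iSupIndep_of_le (U := fun w : tensorSub S →ₐ[F] F => tprodSpan fun j =>
    weightSpace (S j) (W j) (w.comp (tensorIncl S j))) (iSupIndep_weightSpace (V := ⨂[F] j, W j) (tensorSub S)) (fun w => ?_) ?_ w).symm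
  · refine Submodule.span_le.2 ?_
    rintro _ ⟨x, hx, rfl⟩
    exact tprod_mem_weightSpace hx
  · intro w
    refine le_top.trans (tprodSpan_top.symm.le.trans ((tprodSpan_le_iSup
      (fun j χ => weightSpace (S j) (W j) χ) fun j => (hW j).ge).trans (iSup_le fun p => ?_)))
    obtain ⟨w', rfl⟩ := (bijective_comp_tensorIncl S).2 p
    exact le_iSup_of_le w' le_rfl

theorem iSup_weightSpace_tensor {S : ∀ j, Subalgebra F (A j)}
    (hW : ∀ j, ⨆ χ, weightSpace (S j) (W j) χ = ⊤) :
    ⨆ χ, weightSpace (tensorSub S) (⨂[F] j, W j) χ = ⊤ := by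
  refine top_le_iff.1 (tprodSpan_top.symm.le.trans ((tprodSpan_le_iSup
    (fun j χ => weightSpace (S j) (W j) χ) fun j => (hW j).ge).trans (iSup_le fun p => ?_)))
  obtain ⟨w, rfl⟩ := (bijective_comp_tensorIncl S).2 p
  refine le_iSup_of_le w (Submodule.span_le.2 ?_)
  rintro _ ⟨x, hx, rfl⟩
  exact tprod_mem_weightSpace hx

section

variable (hD : ∀ j, (D j).IsRTA)
include hD

/-- Criterion for being annihilated by `N⁺`: it is enough that the `N⁺` of every factor acts by
zero. -/
theorem Np_tensor_smul_eq_zero {m : V}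
    (h : ∀ j, ∀ n ∈ (D j).Np, PiTensorProduct.singleAlgHom (R := F) j n • m = 0) :
    ∀ n ∈ (RTAData.tensor D).Np, n • m = 0 := by
  suffices H : (RTAData.tensor D).Np ≤ LinearMap.ker
      ((LinearMap.toSpanSingleton (⨂[F] j, A j) V m).restrictScalars F) from H
  refine iSup_le ?_
  rintro ⟨θ, hθ, hne⟩
  rw [Q0_tensor] at hθ
  obtain ⟨σ, hσ, rfl⟩ := hθ
  obtain ⟨j, hj⟩ : ∃ j, σ j ≠ 1 := by
    by_contra! h1
    exact hne ((congrArg _ (funext h1)).trans (map_one _))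
  rw [BpRoot0_tensor hD]
  refine Submodule.span_le.2 ?_
  rintro _ ⟨b, hb, rfl⟩
  have e : PiTensorProduct.tprod F b = PiTensorProduct.tprod F (Function.update b j 1) *
      PiTensorProduct.singleAlgHom (R := F) j (b j) := by
    rw [tprod_mul_single]
    simp
  change PiTensorProduct.tprod F b • m = 0
  rw [e, mul_smul, h j, smul_zero]
  exact Submodule.mem_iSup_of_mem (p := fun θ : {θ // θ ∈ (D j).Q0 ∧ θ ≠ 1} => (D j).BpRoot0 θ)
    ⟨σ j, hσ j, hj⟩ (hb j)

theorem single_mem_Np {j : ι} {n : A j} (hn : n ∈ (D j).Np) :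
    PiTensorProduct.singleAlgHom (R := F) j n ∈ (RTAData.tensor D).Np := by
  have := nontrivial_of_isRTA hD
  suffices H : (D j).Np ≤ (RTAData.tensor D).Np.comap
      (PiTensorProduct.singleAlgHom (R := F) j).toLinearMap from H hn
  refine iSup_le ?_
  rintro ⟨θ, hθ, hne⟩ b hb
  refine Submodule.mem_iSup_of_mem (p := fun θ : {θ // θ ∈ (RTAData.tensor D).Q0 ∧ θ ≠ 1} =>
    (RTAData.tensor D).BpRoot0 θ) ⟨tensorAut0 D (Pi.mulSingle j θ), ?_, ?_⟩ ?_
  · rw [Q0_tensor]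
    refine ⟨_, fun k => ?_, rfl⟩
    by_cases hk : k = j
    · subst hk
      rwa [Pi.mulSingle_eq_same]
    · rw [Pi.mulSingle_eq_of_ne hk]
      exact (hD k).positive.one_mem
  · intro h
    have h1 := tensorAut0_injective hD (h.trans (map_one (tensorAut0 D)).symm)
    exact hne (by simpa using congrFun h1 j)
  · rw [BpRoot0_tensor hD]
    change PiTensorProduct.singleAlgHom (R := F) j b ∈ _
    rw [singleAlgHom_eq]
    refine tprod_mem_tprodSpan fun k => ?_
    by_cases hk : k = j
    · subst hk
      rwa [Pi.mulSingle_eq_same, Pi.mulSingle_eq_same]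
    · rw [Pi.mulSingle_eq_of_ne hk, Pi.mulSingle_eq_of_ne hk, (hD k).root_one]
      exact Submodule.mem_span_singleton_self _

theorem isMaxVec_tprod {w : (RTAData.tensor D).H1 →ₐ[F] F} {v : ∀ j, W j}
    (hv : ∀ j, (D j).IsMaxVec (comp1 D w j) (v j)) :
    (RTAData.tensor D).IsMaxVec w (PiTensorProduct.tprod F v : ⨂[F] j, W j) := by
  refine ⟨tprod_mem_weightSpace fun j => (hv j).weight, Np_tensor_smul_eq_zero hD ?_⟩
  intro j n hn
  rw [single_smul_tprod, (hv j).np n hn]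
  exact (PiTensorProduct.tprod F).map_update_zero v j

/-- The Verma modules of a tensor product are the tensor products of Verma modules: both sides
are cyclic, and the generator of each satisfies the relations that define the other. -/
theorem nonempty_equiv_verma (w : (RTAData.tensor D).H1 →ₐ[F] F) :
    Nonempty ((⨂[F] j, (D j).Verma (comp1 D w j)) ≃ₗ[⨂[F] j, A j] (RTAData.tensor D).Verma w) := by
  let f := vermaMap (isMaxVec_tprod hD (w := w) fun j => isMaxVec_mk (D := D j) (comp1 D w j))
  have hI : ∀ j, ∀ a ∈ (D j).vermaIdeal (comp1 D w j), PiTensorProduct.singleAlgHom (R := F) j a •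
      (Submodule.Quotient.mk 1 : (RTAData.tensor D).Verma w) = 0 := by
    intro j a ha
    let I := LinearMap.ker (LinearMap.toSpanSingleton (⨂[F] j, A j) _
      (Submodule.Quotient.mk 1 : (RTAData.tensor D).Verma w))
    let I' : Submodule (A j) (A j) :=
      { carrier := {a | PiTensorProduct.singleAlgHom (R := F) j a ∈ I}
        add_mem' := fun ha hb => by
          rw [Set.mem_ofPred_eq, map_add]
          exact I.add_mem ha hb
        zero_mem' := by
          rw [Set.mem_ofPred_eq, map_zero]
          exact I.zero_mem
        smul_mem' := fun c x hx => by
          rw [Set.mem_ofPred_eq, smul_eq_mul, map_mul]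
          exact I.smul_mem _ hx }
    have hI := (isMaxVec_mk (D := RTAData.tensor D) w)
    suffices H : (D j).vermaIdeal (comp1 D w j) ≤ I' from H ha
    refine sup_le (Submodule.span_le.2 fun n hn => ?_) (Submodule.span_le.2 ?_)
    · exact hI.np _ (single_mem_Np hD hn)
    · rintro _ ⟨h, hh, rfl⟩
      refine (hI.weight (tensorIncl (fun j => (D j).H1) j h)).trans ?_
      rw [show w (tensorIncl (fun j => (D j).H1) j h) = 0 from hh]
      exact zero_smul F (Submodule.Quotient.mk 1 : (RTAData.tensor D).Verma w)
  obtain ⟨g, hg⟩ := exists_linearMap_quotient (F := F) _ hI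
  have hf : f (Submodule.Quotient.mk 1) =
      PiTensorProduct.tprod F fun j => ((D j).vermaIdeal (comp1 D w j)).mkQ 1 :=
    (vermaMap_mk _ _).trans (one_smul _ _)
  refine ⟨LinearEquiv.ofLinearMap g f ?_ ?_⟩
  · refine LinearMap.ext fun x => ?_
    obtain ⟨a, rfl⟩ := exists_eq_smul_mk_one x
    rw [LinearMap.comp_apply, map_smul, map_smul, hf, hg, LinearMap.id_apply]
  · refine LinearMap.ext fun x => ?_
    obtain ⟨a, rfl⟩ := exists_eq_smul_tprod
      (fun j => exists_eq_smul_mk_one (D := D j) (w := comp1 D w j)) x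
    rw [LinearMap.comp_apply, map_smul, map_smul]
    exact congrArg (a • ·) ((congrArg f hg).trans hf)

/-- A tensor product of simple highest weight modules with free highest weights is simple. -/
theorem isSimpleModule_tensor_of_isMaxVec [∀ j, IsSimpleModule (A j) (W j)]
    {χ : ∀ j, (D j).H1 →ₐ[F] F} (hχ : ∀ j, χ j ∈ (D j).free1) {v : ∀ j, W j}
    (hv0 : ∀ j, v j ≠ 0) (hv : ∀ j, (D j).IsMaxVec (χ j) (v j)) :
    IsSimpleModule (⨂[F] j, A j) (⨂[F] j, W j) := by
  choose φ hφ h using fun j => exists_hwFunctional (hD j) (hv j)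
    (exists_eq_smul_of_isSimple (hv0 j)) (hχ j) (hv0 j)
  exact isSimpleModule_tensor inferInstance hφ h

/-- For free weights, `L(w)` is the tensor product of the `L(wⱼ)`. -/
theorem nonempty_tensor_equiv_simple [∀ j, IsSimpleModule (A j) (W j)]
    {w : (RTAData.tensor D).H1 →ₐ[F] F} (hw : w ∈ (RTAData.tensor D).free1) {v : ∀ j, W j}
    (hv0 : ∀ j, v j ≠ 0) (hv : ∀ j, (D j).IsMaxVec (comp1 D w j) (v j)) :
    Nonempty ((⨂[F] j, W j) ≃ₗ[⨂[F] j, A j] (RTAData.tensor D).Simple w) := by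
  have := isSimpleModule_tensor_of_isMaxVec (F := F) hD ((mem_free1_tensor_iff hD).1 hw) hv0 hv
  obtain ⟨e⟩ := nonempty_equiv_simple (isRTA_tensor hD) hw (tprod_ne_zero (F := F) hv0)
    (isMaxVec_tprod hD hv)
  exact ⟨e.symm⟩

end

end TensorWeights

/-! ### Category `𝒪` for tensor products -/

section CategoryO

open RTAData

theorem finiteDimensional_of_map_le {F M M' : Type*} [Field F] [AddCommGroup M] [Module F M]
    [AddCommGroup M'] [Module F M'] {f : M →ₗ[F] M'} (hf : Function.Injective f)
    {U : Submodule F M} {U' : Submodule F M'} (h : U.map f ≤ U') (hU' : FiniteDimensional F U') :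
    FiniteDimensional F U :=
  have := Submodule.finiteDimensional_of_le h
  Module.Finite.equiv (Submodule.equivMapOfInjective f hf U).symm

section Equiv

variable {F A : Type u} [Field F] [Ring A] [Algebra F A] {D : RTAData F A}
  {V : Type u} [AddCommGroup V] [Module F V] [Module A V] [IsScalarTower F A V]
  {V' : Type u} [AddCommGroup V'] [Module F V'] [Module A V'] [IsScalarTower F A V']

theorem map_weightSpace (e : V ≃ₗ[A] V') (H : Subalgebra F A) (w : H →ₐ[F] F) :
    (weightSpace H V w).map (e.restrictScalars F).toLinearMap = weightSpace H V' w := by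
  ext y
  constructor
  · rintro ⟨x, hx, rfl⟩ h
    exact (e.map_smul _ _).symm.trans
      ((congrArg e (hx h)).trans ((e.restrictScalars F).map_smul (w h) x))
  · intro hy
    refine ⟨e.symm y, fun h => ?_, e.apply_symm_apply y⟩
    refine e.injective ?_
    have : e (w h • e.symm y) = w h • y :=
      ((e.restrictScalars F).map_smul _ _).trans (congrArg _ (e.apply_symm_apply y))
    rw [this, e.map_smul, e.apply_symm_apply]
    exact hy h

theorem RTAData.InOFree.of_equiv (e : V ≃ₗ[A] V') (h : D.InOFree V) : D.InOFree V' where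
  fg := have := h.fg; Module.Finite.equiv e
  semisimple := by
    refine ⟨iSupIndep_weightSpace _, ?_⟩
    have := congrArg (Submodule.map (e.restrictScalars F).toLinearMap) h.semisimple.2
    rw [Submodule.map_iSup, Submodule.map_top, LinearEquiv.range] at this
    rw [← this]
    exact iSup_congr fun w => (map_weightSpace e _ w).symm
  finite w := by
    have := h.finite w
    rw [← map_weightSpace e]
    infer_instance
  locallyFinite m := by
    refine finiteDimensional_of_map_le (e.restrictScalars F).symm.injective (U' := Submodule.span F
      {x : V | ∃ b ∈ D.Bp, x = b • e.symm m}) ?_ (h.locallyFinite (e.symm m))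
    rw [Submodule.map_span_le]
    rintro _ ⟨b, hb, rfl⟩
    exact Submodule.subset_span ⟨b, hb, e.symm.map_smul b m⟩
  weights w hw := by
    refine h.weights w fun h0 => hw ?_
    rw [← map_weightSpace e, h0, Submodule.map_bot]

end Equiv

variable {ι : Type} [Fintype ι] [DecidableEq ι] {F : Type u} [Field F] {A : ι → Type u}
  [∀ j, Ring (A j)] [∀ j, Algebra F (A j)]
  {W : ι → Type u} [∀ j, AddCommGroup (W j)] [∀ j, Module F (W j)] [∀ j, Module (A j) (W j)]
  [∀ j, IsScalarTower F (A j) (W j)] {D : ∀ j, RTAData F (A j)}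

attribute [local instance] tensorModule isScalarTower_tensor

theorem finiteDimensional_Bp_smul_tprod {x : ∀ j, W j}
    (h : ∀ j, FiniteDimensional F (Submodule.span F {y : W j | ∃ b ∈ (D j).Bp, y = b • x j})) :
    FiniteDimensional F (Submodule.span F {y : ⨂[F] j, W j |
      ∃ b ∈ (RTAData.tensor D).Bp, y = b • PiTensorProduct.tprod F x}) := by
  have := finiteDimensional_tprodSpan h
  refine Submodule.finiteDimensional_of_le (Submodule.span_le.2 ?_ :
    _ ≤ tprodSpan fun j => Submodule.span F {y : W j | ∃ b ∈ (D j).Bp, y = b • x j})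
  rintro _ ⟨b, hb, rfl⟩
  suffices H : tprodSpan (fun j => Subalgebra.toSubmodule (D j).Bp) ≤ Submodule.comap
      ((LinearMap.toSpanSingleton (⨂[F] j, A j) (⨂[F] j, W j)
        (PiTensorProduct.tprod F x)).restrictScalars F) (tprodSpan fun j =>
          Submodule.span F {y : W j | ∃ b ∈ (D j).Bp, y = b • x j}) from H (mem_tensorSub.1 hb)
  refine Submodule.span_le.2 ?_
  rintro _ ⟨b, hb, rfl⟩
  have h := tprod_mem_tprodSpan (U := fun j => Submodule.span F
    {y : W j | ∃ b ∈ (D j).Bp, y = b • x j}) fun j => Submodule.subset_span ⟨b j, hb j, rfl⟩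
  rwa [← tprod_smul_tprod] at h

section

variable (hD : ∀ j, (D j).IsRTA)
include hD

theorem inOFree_tensor (hW : ∀ j, (D j).InOFree (W j))
    (hfg : Module.Finite (⨂[F] j, A j) (⨂[F] j, W j)) :
    (RTAData.tensor D).InOFree (⨂[F] j, W j) where
  fg := hfg
  semisimple := ⟨iSupIndep_weightSpace _,
    iSup_weightSpace_tensor fun j => (hW j).semisimple.2⟩
  finite w := by
    refine (congrArg (fun U : Submodule F (⨂[F] j, W j) => FiniteDimensional F U)
      (weightSpace_tensor (fun j => (hW j).semisimple.2) w)).mpr ?_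
    exact finiteDimensional_tprodSpan fun j => (hW j).finite _
  locallyFinite m := by
    induction m using PiTensorProduct.induction_on with
    | smul_tprod r x =>
      have := finiteDimensional_Bp_smul_tprod (x := x) fun j => (hW j).locallyFinite (x j)
      refine Submodule.finiteDimensional_of_le (Submodule.span_le.2 ?_ : _ ≤ Submodule.span F
        {y : ⨂[F] j, W j | ∃ b ∈ (RTAData.tensor D).Bp, y = b • PiTensorProduct.tprod F x})
      rintro _ ⟨b, hb, rfl⟩
      rw [smul_comm]
      exact Submodule.smul_mem _ _ (Submodule.subset_span ⟨b, hb, rfl⟩)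
    | add y z hy hz =>
      refine Submodule.finiteDimensional_of_le (Submodule.span_le.2 ?_ : _ ≤ Submodule.span F
        {x : ⨂[F] j, W j | ∃ b ∈ (RTAData.tensor D).Bp, x = b • y} ⊔ Submodule.span F
        {x : ⨂[F] j, W j | ∃ b ∈ (RTAData.tensor D).Bp, x = b • z})
      rintro _ ⟨b, hb, rfl⟩
      rw [smul_add]
      exact Submodule.add_mem_sup (Submodule.subset_span ⟨b, hb, rfl⟩)
        (Submodule.subset_span ⟨b, hb, rfl⟩)
  weights w hw := by
    refine (mem_free1_tensor_iff hD).2 fun j => (hW j).weights _ fun h0 => hw ?_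
    refine (weightSpace_tensor (fun j => (hW j).semisimple.2) w).trans
      (eq_bot_iff.2 (Submodule.span_le.2 ?_))
    rintro _ ⟨x, hx, rfl⟩
    have : x j = 0 := by
      have h1 : x j ∈ weightSpace (D j).H1 (W j) (comp1 D w j) := hx j
      rwa [h0] at h1
    exact (PiTensorProduct.tprod F).map_coord_zero j this

/-- A tensor factor of an object of `𝒪[free]` is an object of `𝒪[free]`, since it embeds into the
tensor product by `insertAt`. -/
theorem inOFree_of_tensor (h : (RTAData.tensor D).InOFree (⨂[F] j, W j)) {v : ∀ j, W j}
    {χ : ∀ j, (D j).H1 →ₐ[F] F} (hv : ∀ j, v j ∈ weightSpace (D j).H1 (W j) (χ j)) (j : ι)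
    (hv0 : ∀ k ≠ j, v k ≠ 0) (hfg : Module.Finite (A j) (W j))
    (hW : ⨆ χ, weightSpace (D j).H1 (W j) χ = ⊤) : (D j).InOFree (W j) := by
  have hinj := insertAt_injective (F := F) hv0
  have hwt : ∀ ψ : (D j).H1 →ₐ[F] F, ∃ w, comp1 D w j = ψ ∧ (weightSpace (D j).H1 (W j) ψ).map
      (insertAt v j) ≤ weightSpace (RTAData.tensor D).H1 (⨂[F] j, W j) w := by
    intro ψ
    obtain ⟨w, hw⟩ := comp1_bijective.2 (Function.update χ j ψ)
    refine ⟨w, by rw [hw, Function.update_self], ?_⟩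
    rintro _ ⟨y, hy, rfl⟩
    refine tprod_mem_weightSpace fun k => ?_
    change _ ∈ weightSpace (D k).H1 (W k) (comp1 D w k)
    rw [hw]
    by_cases hk : k = j
    · subst hk
      rwa [Function.update_self, Function.update_self]
    · rw [Function.update_of_ne hk, Function.update_of_ne hk]
      exact hv k
  refine ⟨⟨hfg, ⟨iSupIndep_weightSpace _, hW⟩, fun ψ => ?_, fun m => ?_⟩, fun ψ hψ => ?_⟩
  · obtain ⟨w, -, hw⟩ := hwt ψ
    exact finiteDimensional_of_map_le hinj hw (h.finite w)
  · refine finiteDimensional_of_map_le hinj ?_ (h.locallyFinite (insertAt v j m))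
    rw [Submodule.map_span_le]
    rintro _ ⟨b, hb, rfl⟩
    refine Submodule.subset_span ⟨_, single_mem_tensorSub hb, ?_⟩
    rw [single_smul_insertAt]
  · obtain ⟨w, rfl, hw⟩ := hwt ψ
    refine (mem_free1_tensor_iff hD).1 (h.weights w fun h0 => hψ ?_) j
    rw [h0, le_bot_iff] at hw
    exact Submodule.map_injective_of_injective hinj (hw.trans (Submodule.map_bot _).symm)

end

end CategoryO

/-! ### Simple objects of `𝒪[free]` over a tensor product -/

section SimpleObjects

open RTAData

variable {ι : Type} [Fintype ι] [DecidableEq ι] {F : Type u} [Field F] {A : ι → Type u}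
  [∀ j, Ring (A j)] [∀ j, Algebra F (A j)]
  {W : ι → Type u} [∀ j, AddCommGroup (W j)] [∀ j, Module F (W j)] [∀ j, Module (A j) (W j)]
  [∀ j, IsScalarTower F (A j) (W j)]
  {W' : ι → Type u} [∀ j, AddCommGroup (W' j)] [∀ j, Module F (W' j)] [∀ j, Module (A j) (W' j)]
  [∀ j, IsScalarTower F (A j) (W' j)]
  {V : Type u} [AddCommGroup V] [Module F V] [Module (⨂[F] j, A j) V]
  [IsScalarTower F (⨂[F] j, A j) V] {D : ∀ j, RTAData F (A j)}

attribute [local instance] tensorModule isScalarTower_tensor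

/-- The `Aⱼ`-linear map `Wⱼ → W'ⱼ` induced by a `⨂ Aₖ`-linear map `⨂ Wₖ → ⨂ W'ₖ`: the vectors `vₖ`
are inserted into the other factors, and the functionals `ψₖ` are evaluated on them afterwards. -/
def factorMap (f : (⨂[F] j, W j) →ₗ[⨂[F] j, A j] ⨂[F] j, W' j) (v : ∀ j, W j)
    (ψ : ∀ j, Module.Dual F (W' j)) (j : ι) : W j →ₗ[A j] W' j where
  toFun y := evalExcept j ψ (f (insertAt v j y))
  map_add' x y := by rw [map_add, map_add, map_add]
  map_smul' a y := by
    rw [← single_smul_insertAt, map_smul, evalExcept_single_smul, RingHom.id_apply]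

/-- Simple tensor factors are unique: an isomorphism of the tensor products induces a nonzero map
between the factors. -/
theorem nonempty_equiv_of_tensor_equiv [∀ j, IsSimpleModule (A j) (W j)]
    [∀ j, IsSimpleModule (A j) (W' j)]
    (e : (⨂[F] j, W j) ≃ₗ[⨂[F] j, A j] ⨂[F] j, W' j) (j : ι) : Nonempty (W j ≃ₗ[A j] W' j) := by
  have hn : ∀ j, Nontrivial (W j) := fun j => IsSimpleModule.nontrivial (A j) (W j)
  choose v hv using fun j => exists_ne (0 : W j)
  have h : e (PiTensorProduct.tprod F v) ≠ 0 := by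
    rw [Ne, e.map_eq_zero_iff]
    exact tprod_ne_zero hv
  obtain ⟨ψ, hψ⟩ := exists_evalExcept_ne_zero j h
  have h0 : factorMap e.toLinearMap v ψ j ≠ 0 := by
    intro h0
    refine hψ ?_
    have := DFunLike.congr_fun h0 (v j)
    change evalExcept j ψ (e (insertAt v j (v j))) = 0 at this
    rwa [insertAt_apply, Function.update_eq_self] at this
  exact ⟨LinearEquiv.ofBijective _ (LinearMap.bijective_of_ne_zero h0)⟩

section

variable (hD : ∀ j, (D j).IsRTA)
include hD

theorem inOFree_factors [∀ j, IsSimpleModule (A j) (W j)] (hV : (RTAData.tensor D).InOFree V)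
    {w : (RTAData.tensor D).H1 →ₐ[F] F} (hw : w ∈ (RTAData.tensor D).free1) {v : ∀ j, W j}
    (hv0 : ∀ j, v j ≠ 0) (hv : ∀ j, (D j).IsMaxVec (comp1 D w j) (v j))
    (e : (RTAData.tensor D).Simple w ≃ₗ[⨂[F] j, A j] V) :
    (∀ j, (D j).InOFree (W j)) ∧ IsTensorModule F A W V := by
  obtain ⟨e'⟩ := nonempty_tensor_equiv_simple (F := F) hD hw hv0 hv
  exact ⟨fun j => inOFree_of_tensor hD (hV.of_equiv (e'.trans e).symm) (fun k => (hv k).weight) j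
    (fun k _ => hv0 k) inferInstance (iSup_weightSpace1_eq_top (hD j) (hv j)
      (exists_eq_smul_of_isSimple (hv0 j))), isTensorModule_iff.2 ⟨e'.trans e⟩⟩

/-- The simple objects of `𝒪[free]` over a tensor product are the tensor products of simple objects.
A simple object has a maximal vector of free weight, hence is `L(w)` for a free `w`, which is the
tensor product of the modules `L(wⱼ)`. -/
theorem inOFree_and_isSimpleModule_iff (V : Type u) [AddCommGroup V] [Module F V]
    [Module (⨂[F] j, A j) V] [IsScalarTower F (⨂[F] j, A j) V] :
    ((RTAData.tensor D).InOFree V ∧ IsSimpleModule (⨂[F] j, A j) V) ↔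
      ∃ (W : ι → Type u) (_ : ∀ j, AddCommGroup (W j)) (_ : ∀ j, Module F (W j))
        (_ : ∀ j, Module (A j) (W j)) (_ : ∀ j, IsScalarTower F (A j) (W j)),
        (∀ j, (D j).InOFree (W j) ∧ IsSimpleModule (A j) (W j)) ∧ IsTensorModule F A W V := by
  constructor
  · rintro ⟨hV, hs⟩
    have := IsSimpleModule.nontrivial (⨂[F] j, A j) V
    obtain ⟨w, hw, v, -, hv0, hv⟩ := exists_isMaxVec (isRTA_tensor hD) hV.semisimple.2 hV.weights
      hV.locallyFinite (N := ⊤) top_ne_bot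
    obtain ⟨e⟩ := nonempty_equiv_simple (isRTA_tensor hD) hw hv0 hv
    have hw' := (mem_free1_tensor_iff hD).1 hw
    have := fun j => isSimpleModule_simple (hD j) (hw' j)
    have h := inOFree_factors hD hV hw (fun j => simple_mk_one_ne_zero (hD j) (hw' j))
      (fun j => isMaxVec_simple (D := D j)) e
    exact ⟨_, _, _, _, _, fun j => ⟨h.1 j, this j⟩, h.2⟩
  · rintro ⟨W, _, _, _, _, hW, hWV⟩
    obtain ⟨e⟩ := isTensorModule_iff.1 hWV
    have := fun j => (hW j).2
    have hn := fun j => IsSimpleModule.nontrivial (A j) (W j)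
    choose χ hχ v _ hv0 hv using fun j => exists_isMaxVec (hD j) (hW j).1.semisimple.2
      (hW j).1.weights (hW j).1.locallyFinite (N := (⊤ : Submodule (A j) (W j))) top_ne_bot
    have hs := isSimpleModule_tensor_of_isMaxVec (F := F) hD hχ hv0 hv
    have hO := inOFree_tensor hD (fun j => (hW j).1) inferInstance
    exact ⟨hO.of_equiv e, IsSimpleModule.congr e.symm⟩

end

end SimpleObjects

/-! ### Subquotients of Verma modules -/

section Subquotients

/-- If a simple module is a quotient of a cyclic submodule of a finite power of `Y`, it is a
subquotient of `Y`. -/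
theorem isSubquotient_of_finset {R L Y I : Type*} [Ring R] [AddCommGroup L] [Module R L]
    [AddCommGroup Y] [Module R Y] [IsSimpleModule R L] {f : R →ₗ[R] L} (hf : f ≠ 0)
    (s : Finset I) (y : I → Y) (h : ∀ a : R, (∀ i ∈ s, a • y i = 0) → f a = 0) :
    IsSubquotient R L Y := by
  classical
  induction s using Finset.induction_on with
  | empty => exact (hf (LinearMap.ext fun a => h a (by simp))).elim
  | insert i s _ ih =>
    by_cases hs : ∀ a : R, (∀ i ∈ s, a • y i = 0) → f a = 0
    · exact ih hs
    · push Not at hs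
      obtain ⟨a₀, ha₀, hfa⟩ := hs
      -- the annihilator `K` of the vectors `y k`, `k ∈ s`, maps onto the simple module, and this
      -- map factors through `a ↦ a • y i`
      let K : Submodule R R := ⨅ k ∈ s, LinearMap.ker (LinearMap.toSpanSingleton R Y (y k))
      have hK : ∀ a, a ∈ K ↔ ∀ k ∈ s, a • y k = 0 := fun a => by simp [K, Submodule.mem_iInf]
      let g : K →ₗ[R] Y := (LinearMap.toSpanSingleton R Y (y i)).domRestrict K
      let f' : K →ₗ[R] L := f.domRestrict K
      have hker : LinearMap.ker g ≤ LinearMap.ker f' := by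
        intro a ha
        refine h a.1 fun k hk => ?_
        rcases Finset.mem_insert.1 hk with rfl | hk
        · exact ha
        · exact (hK a.1).1 a.2 k hk
      have hf' : Function.Surjective f' := LinearMap.surjective_of_ne_zero fun h0 =>
        hfa (DFunLike.congr_fun h0 ⟨a₀, (hK a₀).2 ha₀⟩)
      refine ⟨LinearMap.range g, ((LinearMap.ker g).liftQ f' hker).comp
        g.quotKerEquivRange.symm.toLinearMap, ?_⟩
      rw [LinearMap.coe_comp]
      refine Function.Surjective.comp (fun l => ?_) g.quotKerEquivRange.symm.surjective
      obtain ⟨a, rfl⟩ := hf' l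
      exact ⟨Submodule.Quotient.mk a, Submodule.liftQ_apply _ _ _⟩

theorem isSubquotient_iff {R L M : Type u} [Ring R] [AddCommGroup L] [Module R L]
    [AddCommGroup M] [Module R M] : IsSubquotient R L M ↔
      ∃ (X : Type u) (_ : AddCommGroup X) (_ : Module R X) (i : X →ₗ[R] M) (f : X →ₗ[R] L),
        Function.Injective i ∧ Function.Surjective f := by
  constructor
  · rintro ⟨N, f, hf⟩
    exact ⟨N, _, _, N.subtype, f, N.injective_subtype, hf⟩
  · rintro ⟨X, _, _, i, f, hi, hf⟩
    exact ⟨LinearMap.range i, f.comp (LinearEquiv.ofInjective i hi).symm.toLinearMap,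
      hf.comp (LinearEquiv.ofInjective i hi).symm.surjective⟩

theorem IsSubquotient.congr {R L L' M M' : Type u} [Ring R] [AddCommGroup L] [Module R L]
    [AddCommGroup M] [Module R M] [AddCommGroup L'] [Module R L']
    [AddCommGroup M'] [Module R M'] (h : IsSubquotient R L M) (e : L ≃ₗ[R] L') (e' : M ≃ₗ[R] M') :
    IsSubquotient R L' M' := by
  obtain ⟨X, _, _, i, f, hi, hf⟩ := isSubquotient_iff.1 h
  exact isSubquotient_iff.2 ⟨X, _, _, e'.toLinearMap.comp i, e.toLinearMap.comp f,
    e'.injective.comp hi, e.surjective.comp hf⟩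

variable {ι : Type} [Fintype ι] [DecidableEq ι] {F : Type u} [Field F] {A : ι → Type u}
  [∀ j, Ring (A j)] [∀ j, Algebra F (A j)]
  {W : ι → Type u} [∀ j, AddCommGroup (W j)] [∀ j, Module F (W j)] [∀ j, Module (A j) (W j)]
  [∀ j, IsScalarTower F (A j) (W j)]
  {W' : ι → Type u} [∀ j, AddCommGroup (W' j)] [∀ j, Module F (W' j)] [∀ j, Module (A j) (W' j)]
  [∀ j, IsScalarTower F (A j) (W' j)]

attribute [local instance] tensorModule isScalarTower_tensor

theorem isSubquotient_tensor (h : ∀ j, IsSubquotient (A j) (W' j) (W j)) :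
    IsSubquotient (⨂[F] j, A j) (⨂[F] j, W' j) (⨂[F] j, W j) := by
  choose N f hf using h
  exact isSubquotient_iff.2 ⟨⨂[F] j, N j, _, _, tensorMap fun j => (N j).subtype, tensorMap f,
    tensorMap_injective fun j => (N j).injective_subtype, tensorMap_surjective hf⟩

/-- Finitely many of the maps `evalExcept j ψ` suffice to detect the vanishing of `a • x` for all
elements `a` of the `j`-th algebra. -/
theorem exists_finset_evalExcept (j : ι) (x : ⨂[F] j, W j) :
    ∃ s : Finset (∀ k, Module.Dual F (W k)), ∀ a : A j, (∀ ψ ∈ s, a • evalExcept j ψ x = 0) →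
      PiTensorProduct.singleAlgHom (R := F) j a • x = 0 := by
  classical
  let b := fun k => Module.Basis.ofVectorSpace F (W k)
  let B := Basis.piTensorProduct b
  refine ⟨(B.repr x).support.image fun p k => (b k).coord (p k), fun a ha => B.ext_elem fun p => ?_⟩
  rw [map_zero, Finsupp.zero_apply, piTensorProduct_repr, ← apply_evalExcept j,
    evalExcept_single_smul]
  suffices H : a • evalExcept j (fun k => (b k).coord (p k)) x = 0 by rw [H, map_zero]
  by_cases hp : ∃ p' ∈ (B.repr x).support, ∀ k ≠ j, p' k = p k
  · obtain ⟨p', hp', e⟩ := hp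
    rw [evalExcept_congr j (ψ' := fun k => (b k).coord (p' k)) fun k hk => by rw [e k hk]]
    exact ha _ (Finset.mem_image_of_mem _ hp')
  · suffices H : evalExcept j (fun k => (b k).coord (p k)) x = 0 by rw [H, smul_zero]
    refine (b j).ext_elem fun q => ?_
    rw [map_zero, Finsupp.zero_apply]
    have h1 : B.repr x (Function.update p j q) = 0 := by
      by_contra h
      exact hp ⟨_, Finsupp.mem_support_iff.2 h, fun k hk => Function.update_of_ne hk _ _⟩
    rw [piTensorProduct_repr, ← apply_evalExcept j, evalExcept_congr j
      (ψ' := fun k => (b k).coord (p k)) fun k hk => by rw [Function.update_of_ne hk]] at h1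
    simpa using h1

/-- Restricted to the `j`-th algebra, `⨂ₖ Wₖ` embeds into a power of `Wⱼ`; so a subquotient of it
yields subquotients of `Wⱼ`. -/
theorem isSubquotient_of_tensor [∀ j, IsSimpleModule (A j) (W' j)]
    (h : IsSubquotient (⨂[F] j, A j) (⨂[F] j, W' j) (⨂[F] j, W j)) (j : ι) :
    IsSubquotient (A j) (W' j) (W j) := by
  have hn : ∀ j, Nontrivial (W' j) := fun j => IsSimpleModule.nontrivial (A j) (W' j)
  choose v hv using fun j => exists_ne (0 : W' j)
  obtain ⟨N, f, hf⟩ := h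
  obtain ⟨x, hx⟩ := hf (PiTensorProduct.tprod F v)
  obtain ⟨ψ, hψ⟩ := exists_evalExcept_ne_zero j (tprod_ne_zero (F := F) hv)
  obtain ⟨s, hs⟩ := exists_finset_evalExcept (A := A) j (x : ⨂[F] j, W j)
  let g : A j →ₗ[A j] W' j := LinearMap.toSpanSingleton (A j) (W' j)
    (evalExcept j ψ (PiTensorProduct.tprod F v))
  refine isSubquotient_of_finset (f := g) (fun h0 => hψ ?_) s (fun ψ => evalExcept j ψ x.1)
    fun a ha => ?_
  · have := DFunLike.congr_fun h0 1
    rwa [LinearMap.toSpanSingleton_apply, one_smul] at this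
  · have h1 : PiTensorProduct.singleAlgHom (R := F) j a • x = 0 := Subtype.ext (hs a ha)
    rw [LinearMap.toSpanSingleton_apply, ← evalExcept_single_smul, ← hx, ← map_smul, h1, map_zero,
      map_zero]

end Subquotients

/-! ### The sets `Sᵐ` of a tensor product -/

section Families

variable {ι : Type} [Fintype ι] [DecidableEq ι] {X : ι → Type*} {Y : Type*} {e : Y → ∀ j, X j}

theorem finite_setOf_forall_mem_iff (he : Function.Bijective e) {T : ∀ j, Set (X j)}
    (hT : ∀ j, (T j).Nonempty) : {y | ∀ j, e y j ∈ T j}.Finite ↔ ∀ j, (T j).Finite := by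
  have h : {y | ∀ j, e y j ∈ T j} = e ⁻¹' Set.univ.pi T := by
    ext y
    simp
  rw [h]
  constructor
  · intro hf j
    have h1 := hf.image e
    rw [Set.image_preimage_eq _ he.2] at h1
    rw [← Set.eval_image_univ_pi (i := j) (Set.univ_pi_nonempty_iff.2 hT)]
    exact h1.image _
  · exact fun hf => (Set.Finite.pi' hf).subset (by simp [Set.pi]) |>.preimage he.1.injOn

theorem setOf_forall_mem_eq_iff (he : Function.Bijective e) {T U : ∀ j, Set (X j)}
    (hTU : ∀ j, T j ⊆ U j) (hU : ∀ j, (U j).Nonempty) :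
    {y | ∀ j, e y j ∈ T j} = {y | ∀ j, e y j ∈ U j} ↔ ∀ j, T j = U j := by
  constructor
  · intro h j
    refine (hTU j).antisymm fun x hx => ?_
    choose u hu using hU
    obtain ⟨y, hy⟩ := he.2 (Function.update u j x)
    have h1 : ∀ k, e y k ∈ U k := by
      intro k
      rw [hy]
      by_cases hk : k = j
      · subst hk
        rwa [Function.update_self]
      · rw [Function.update_of_ne hk]
        exact hu k
    have h2 := h.ge h1 j
    rwa [hy, Function.update_self] at h2
  · intro h
    rw [funext h]

/-- In a product, the equivalence relation generated by a relation which contains the product of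
the relations `r j` contains the product of the generated equivalence relations, on the part where
the `r j` are reflexive. -/
theorem eqvGen_of_forall (he : Function.Bijective e) {r : ∀ j, X j → X j → Prop}
    {R : Y → Y → Prop} (hR : ∀ v w, (∀ j, r j (e v j) (e w j)) → R v w)
    (hrefl : ∀ j x y, Relation.EqvGen (r j) x y → r j y y → r j x x) {v w : Y}
    (hw : ∀ j, r j (e w j) (e w j)) (h : ∀ j, Relation.EqvGen (r j) (e v j) (e w j)) :
    Relation.EqvGen R v w := by
  obtain ⟨E, hE, hE'⟩ := Function.bijective_iff_has_inverse.1 he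
  -- the coordinates are changed one at a time, while `r` links every other coordinate to itself
  have step : ∀ (p : ∀ j, X j), (∀ k, r k (p k) (p k)) → ∀ j x y, Relation.EqvGen (r j) x y →
      Relation.EqvGen R (E (Function.update p j x)) (E (Function.update p j y)) := by
    intro p hp j x y hxy
    induction hxy with
    | rel x y hxy =>
      refine .rel _ _ (hR _ _ fun k => ?_)
      rw [hE', hE']
      by_cases hk : k = j
      · subst hk
        rwa [Function.update_self, Function.update_self]
      · rw [Function.update_of_ne hk, Function.update_of_ne hk]
        exact hp k
    | refl x => exact .refl _
    | symm x y _ ih => exact .symm _ _ ih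
    | trans x y z _ _ ih ih' => exact .trans _ _ _ ih ih'
  have key : ∀ s : Finset ι, Relation.EqvGen R (E fun k => if k ∈ s then e v k else e w k) w := by
    intro s
    induction s using Finset.induction_on with
    | empty =>
      simp only [Finset.notMem_empty, if_false]
      rw [hE w]
      exact .refl _
    | insert j s hj ih =>
      refine .trans _ _ _ ?_ ih
      have := step (fun k => if k ∈ s then e v k else e w k) (fun k => ?_) j _ _ (h j)
      · convert this using 2
        · funext k
          by_cases hk : k = j
          · subst hk
            simp
          · simp [hk]
        · funext k
          by_cases hk : k = j
          · subst hk
            simp [hj]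
          · simp [hk]
      · split_ifs
        exacts [hrefl k _ _ (h k) (hw k), hw k]
  have := key Finset.univ
  simp only [Finset.mem_univ, if_true] at this
  rwa [hE v] at this

end Families

section SSets

open RTAData

section Single

variable {F A : Type u} [Field F] [Ring A] [Algebra F A] {D : RTAData F A}

theorem le0_refl (hD : D.IsRTA) (w : D.H0 →ₐ[F] F) : D.le0 w w :=
  ⟨1, hD.positive.one_mem, (act_one w).symm⟩

theorem S1_eq (hD : D.IsRTA) (w : D.H1 →ₐ[F] F) :
    D.S1 w = {x | x ∈ D.S2 w ∧ D.le0 x (D.res w)} := by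
  ext x
  constructor
  · rintro ⟨v, ⟨hv, hvw⟩, rfl⟩
    refine ⟨⟨v, hv, rfl⟩, ?_⟩
    rcases hvw with h | rfl
    exacts [h.1, le0_refl hD _]
  · rintro ⟨⟨v, hv, rfl⟩, h⟩
    by_cases e : D.res v = D.res w
    · exact ⟨w, ⟨.refl _, .inr rfl⟩, e.symm⟩
    · exact ⟨v, ⟨hv, .inl ⟨h, e⟩⟩, rfl⟩

theorem linked_self {w : D.H1 →ₐ[F] F} (hw : w ∈ D.free1) : D.Linked w w :=
  ⟨hw, isSubquotient_iff.2 ⟨_, _, _, LinearMap.id, (D.radVerma w).mkQ, Function.injective_id,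
    (D.radVerma w).mkQ_surjective⟩⟩

/-- The center acts on a Verma module with free highest weight by scalars, as it preserves the
one-dimensional highest weight space. -/
theorem mem_S4_self (hD : D.IsRTA) {w : D.H1 →ₐ[F] F} (hw : w ∈ D.free1) : w ∈ D.S4 w := by
  intro z hz
  have hz := Subalgebra.mem_center_iff.1 hz
  have hv := isMaxVec_mk (D := D) w
  have h1 : z • (Submodule.Quotient.mk 1 : D.Verma w) ∈ weightSpace D.H0 (D.Verma w) (D.res w) := by
    intro h
    rw [← mul_smul, hz, mul_smul, (weightSpace_le_res w hv.weight) h, smul_comm]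
  rw [weightSpace0_top hD hv exists_eq_smul_mk_one hw, Submodule.mem_span_singleton] at h1
  obtain ⟨c, hc⟩ := h1
  have : ∀ m : D.Verma w, z • m = c • m := by
    intro m
    obtain ⟨a, rfl⟩ := exists_eq_smul_mk_one m
    rw [← mul_smul, ← hz, mul_smul, ← hc, smul_comm]
  exact ⟨c, this, this⟩

/-- The elements of the algebra which act on `M(v)` and `M(w)` by the same scalar. -/
def scalarSubmodule (v w : D.H1 →ₐ[F] F) : Submodule F A where
  carrier := {z | ∃ c : F, (∀ m : D.Verma v, z • m = c • m) ∧ ∀ m : D.Verma w, z • m = c • m}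
  zero_mem' := ⟨0, fun m => by rw [zero_smul, zero_smul], fun m => by rw [zero_smul, zero_smul]⟩
  add_mem' := by
    rintro y z ⟨c, hc, hc'⟩ ⟨d, hd, hd'⟩
    exact ⟨c + d, fun m => by rw [add_smul, add_smul, hc, hd],
      fun m => by rw [add_smul, add_smul, hc', hd']⟩
  smul_mem' := by
    rintro r y ⟨c, hc, hc'⟩
    exact ⟨r * c, fun m => by rw [smul_assoc, hc, mul_smul],
      fun m => by rw [smul_assoc, hc', mul_smul]⟩

end Single

variable {ι : Type} [Fintype ι] [DecidableEq ι] {F : Type u} [Field F] {A : ι → Type u}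
  [∀ j, Ring (A j)] [∀ j, Algebra F (A j)]
  {W : ι → Type u} [∀ j, AddCommGroup (W j)] [∀ j, Module F (W j)] [∀ j, Module (A j) (W j)]
  [∀ j, IsScalarTower F (A j) (W j)] {D : ∀ j, RTAData F (A j)}

attribute [local instance] tensorModule isScalarTower_tensor

theorem evalExcept_single_mul (j : ι) (ψ : ∀ k, Module.Dual F (A k)) (a : A j) (y : ⨂[F] j, A j) :
    evalExcept j ψ (PiTensorProduct.singleAlgHom (R := F) j a * y) = a * evalExcept j ψ y := by
  induction y using PiTensorProduct.induction_on with
  | smul_tprod r x =>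
    rw [mul_smul_comm, map_smul, map_smul, single_mul_tprod, evalExcept_tprod, evalExcept_tprod,
      Function.update_self, mul_smul_comm, mul_smul_comm]
    congr 2
    refine Finset.prod_congr rfl fun k hk => ?_
    rw [Function.update_of_ne (Finset.ne_of_mem_erase hk)]
  | add y z hy hz => rw [mul_add, map_add, map_add, hy, hz, mul_add]

theorem evalExcept_mul_single (j : ι) (ψ : ∀ k, Module.Dual F (A k)) (a : A j) (y : ⨂[F] j, A j) :
    evalExcept j ψ (y * PiTensorProduct.singleAlgHom (R := F) j a) = evalExcept j ψ y * a := by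
  induction y using PiTensorProduct.induction_on with
  | smul_tprod r x =>
    rw [smul_mul_assoc, map_smul, map_smul, tprod_mul_single, evalExcept_tprod, evalExcept_tprod,
      Function.update_self, smul_mul_assoc, smul_mul_assoc]
    congr 2
    refine Finset.prod_congr rfl fun k hk => ?_
    rw [Function.update_of_ne (Finset.ne_of_mem_erase hk)]
  | add y z hy hz => rw [add_mul, map_add, map_add, hy, hz, add_mul]

variable (hD : ∀ j, (D j).IsRTA)
include hD

theorem isSubquotient_verma_tensor_iff [∀ j, IsSimpleModule (A j) (W j)]
    {χ w : (RTAData.tensor D).H1 →ₐ[F] F} (hχ : χ ∈ (RTAData.tensor D).free1) {v : ∀ j, W j}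
    (hv0 : ∀ j, v j ≠ 0) (hv : ∀ j, (D j).IsMaxVec (comp1 D χ j) (v j)) :
    IsSubquotient (⨂[F] j, A j) ((RTAData.tensor D).Simple χ) ((RTAData.tensor D).Verma w) ↔
      ∀ j, IsSubquotient (A j) (W j) ((D j).Verma (comp1 D w j)) := by
  obtain ⟨e⟩ := nonempty_tensor_equiv_simple (F := F) hD hχ hv0 hv
  obtain ⟨e'⟩ := nonempty_equiv_verma hD w
  exact ⟨fun h => isSubquotient_of_tensor (h.congr e.symm e'.symm),
    fun h => (isSubquotient_tensor h).congr e e'⟩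

theorem linked_tensor_iff {v w : (RTAData.tensor D).H1 →ₐ[F] F} :
    (RTAData.tensor D).Linked v w ↔ ∀ j, (D j).Linked (comp1 D v j) (comp1 D w j) := by
  have key := fun hv : v ∈ (RTAData.tensor D).free1 =>
    have hv' := (mem_free1_tensor_iff hD).1 hv
    have := fun j => isSimpleModule_simple (hD j) (hv' j)
    isSubquotient_verma_tensor_iff hD (w := w) hv (fun j => simple_mk_one_ne_zero (hD j) (hv' j))
      (fun j => isMaxVec_simple (D := D j))
  constructor
  · exact fun h j => ⟨(mem_free1_tensor_iff hD).1 h.1 j, (key h.1).1 h.2 j⟩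
  · intro h
    have hv := (mem_free1_tensor_iff hD).2 fun j => (h j).1
    exact ⟨hv, (key hv).2 fun j => (h j).2⟩

theorem mem_S3_tensor_iff {v w : (RTAData.tensor D).H1 →ₐ[F] F}
    (hw : w ∈ (RTAData.tensor D).free1) :
    v ∈ (RTAData.tensor D).S3 w ↔ ∀ j, comp1 D v j ∈ (D j).S3 (comp1 D w j) := by
  constructor
  · intro h j
    clear hw
    change Relation.EqvGen _ _ _ at h
    change Relation.EqvGen _ _ _
    induction h with
    | rel x y h => exact .rel _ _ ((linked_tensor_iff hD).1 h j)
    | refl x => exact .refl _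
    | symm x y _ ih => exact .symm _ _ ih
    | trans x y z _ _ ih ih' => exact .trans _ _ _ ih ih'
  · refine eqvGen_of_forall comp1_bijective (fun v w => (linked_tensor_iff hD).2)
      (fun j x y h hy => linked_self ((mem_free1_iff_of_eqvGen (hD j) h).2 hy.1))
      fun j => linked_self ((mem_free1_tensor_iff hD).1 hw j)

theorem mem_S2_tensor_iff {v : (RTAData.tensor D).H0 →ₐ[F] F} {w : (RTAData.tensor D).H1 →ₐ[F] F}
    (hw : w ∈ (RTAData.tensor D).free1) :
    v ∈ (RTAData.tensor D).S2 w ↔ ∀ j, comp0 D v j ∈ (D j).S2 (comp1 D w j) := by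
  constructor
  · rintro ⟨v, hv, rfl⟩ j
    exact ⟨_, (mem_S3_tensor_iff hD hw).1 hv j, rfl⟩
  · intro h
    choose x hx e using h
    obtain ⟨y, rfl⟩ := comp1_bijective.2 x
    exact ⟨y, (mem_S3_tensor_iff hD hw).2 hx, comp0_bijective.1 (funext e)⟩

theorem mem_S1_tensor_iff {v : (RTAData.tensor D).H0 →ₐ[F] F} {w : (RTAData.tensor D).H1 →ₐ[F] F}
    (hw : w ∈ (RTAData.tensor D).free1) :
    v ∈ (RTAData.tensor D).S1 w ↔ ∀ j, comp0 D v j ∈ (D j).S1 (comp1 D w j) := by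
  rw [S1_eq (isRTA_tensor hD), Set.mem_ofPred_eq, mem_S2_tensor_iff hD hw, le0_tensor_iff,
    ← forall_and]
  refine forall_congr' fun j => ?_
  rw [S1_eq (hD j)]
  rfl

/-- Central characters are compared factor by factor: evaluating functionals on all factors but one
shows that the center of `⨂ⱼ Aⱼ` is contained in (the image of) `⨂ⱼ Z(Aⱼ)`. -/
theorem mem_S4_tensor_iff {v w : (RTAData.tensor D).H1 →ₐ[F] F} :
    v ∈ (RTAData.tensor D).S4 w ↔ ∀ j, comp1 D v j ∈ (D j).S4 (comp1 D w j) := by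
  have := nontrivial_of_isRTA hD
  constructor
  · intro h j z hz
    have hz' : PiTensorProduct.singleAlgHom (R := F) j z ∈
        Subalgebra.center F (⨂[F] j, A j) := by
      rw [Subalgebra.mem_center_iff] at hz ⊢
      intro a
      induction a using PiTensorProduct.induction_on with
      | smul_tprod r x =>
        rw [smul_mul_assoc, mul_smul_comm, single_mul_tprod, tprod_mul_single, hz]
      | add a b ha hb => rw [add_mul, mul_add, ha, hb]
    obtain ⟨c, hc, hc'⟩ := h _ hz'
    have key : ∀ u, (∀ m : (RTAData.tensor D).Verma u,
        PiTensorProduct.singleAlgHom (R := F) j z • m = c • m) →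
        ∀ m : (D j).Verma (comp1 D u j), z • m = c • m := by
      intro u hu m
      obtain ⟨e⟩ := nonempty_equiv_verma hD u
      have hinj := insertAt_injective (F := F)
        (v := fun k => (Submodule.Quotient.mk 1 : (D k).Verma (comp1 D u k))) (j := j)
        fun k _ => mk_one_ne_zero (hD k)
      refine hinj (e.injective ?_)
      rw [← single_smul_insertAt, e.map_smul, hu, map_smul]
      exact ((e.restrictScalars F).map_smul _ _).symm
    exact ⟨c, key v hc, key w hc'⟩
  · intro h z hz
    have hz' : z ∈ tprodSpan fun j => Subalgebra.toSubmodule (Subalgebra.center F (A j)) := by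
      refine mem_tprodSpan_of_evalExcept fun j ψ => ?_
      rw [Subalgebra.mem_toSubmodule, Subalgebra.mem_center_iff]
      intro a
      rw [← evalExcept_single_mul, ← evalExcept_mul_single, Subalgebra.mem_center_iff.1 hz]
    suffices H : (tprodSpan fun j => Subalgebra.toSubmodule (Subalgebra.center F (A j))) ≤
        scalarSubmodule v w from H hz'
    refine Submodule.span_le.2 ?_
    rintro _ ⟨x, hx, rfl⟩
    choose c hc hc' using fun j => h j (x j) (hx j)
    have key : ∀ u, (∀ j, ∀ m : (D j).Verma (comp1 D u j), x j • m = c j • m) →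
        ∀ m : (RTAData.tensor D).Verma u, PiTensorProduct.tprod F x • m = (∏ j, c j) • m := by
      intro u hu m
      obtain ⟨e⟩ := nonempty_equiv_verma hD u
      obtain ⟨m, rfl⟩ := e.surjective m
      have : PiTensorProduct.tprod F x • m = (∏ j, c j) • m := by
        induction m using PiTensorProduct.induction_on with
        | smul_tprod r y =>
          rw [smul_comm, tprod_smul_tprod, funext fun j => hu j (y j),
            MultilinearMap.map_smul_univ, smul_comm]
        | add a b ha hb => rw [smul_add, smul_add, ha, hb]
      rw [← e.map_smul, this]
      exact (e.restrictScalars F).map_smul _ _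
    exact ⟨∏ j, c j, key v hc, key w hc'⟩

/-- If the sets `S w` are products of nonempty sets `T j wⱼ`, then `S w` is finite if and only if
all the `T j wⱼ` are. -/
theorem setOf_finite_eq {X : ι → Type*} {Y : Type*} {e : Y → ∀ j, X j}
    (he : Function.Bijective e) {S : ((RTAData.tensor D).H1 →ₐ[F] F) → Set Y}
    {T : ∀ j, ((D j).H1 →ₐ[F] F) → Set (X j)}
    (h : ∀ w ∈ (RTAData.tensor D).free1, ∀ v, v ∈ S w ↔ ∀ j, e v j ∈ T j (comp1 D w j))
    (hT : ∀ j, ∀ w ∈ (D j).free1, (T j w).Nonempty) :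
    {w ∈ (RTAData.tensor D).free1 | (S w).Finite} =
      {w | ∀ j, comp1 D w j ∈ {x ∈ (D j).free1 | (T j x).Finite}} := by
  ext w
  simp only [Set.mem_ofPred_eq]
  rw [forall_and, ← mem_free1_tensor_iff hD]
  refine and_congr_right fun hw => ?_
  rw [← finite_setOf_forall_mem_iff he fun j => hT j _ ((mem_free1_tensor_iff hD).1 hw j)]
  rw [show S w = {v | ∀ j, e v j ∈ T j (comp1 D w j)} from Set.ext (h w hw)]

theorem S1A_tensor :
    (RTAData.tensor D).S1A = {w | ∀ j, comp1 D w j ∈ (D j).S1A} := by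
  refine setOf_finite_eq hD comp0_bijective (fun _ hw _ => mem_S1_tensor_iff hD hw)
    fun j w _ => ⟨(D j).res w, ?_⟩
  rw [S1_eq (hD j)]
  exact ⟨⟨w, .refl _, rfl⟩, le0_refl (hD j) _⟩

theorem S2A_tensor :
    (RTAData.tensor D).S2A = {w | ∀ j, comp1 D w j ∈ (D j).S2A} :=
  setOf_finite_eq hD comp0_bijective (fun _ hw _ => mem_S2_tensor_iff hD hw)
    fun j w _ => ⟨(D j).res w, w, .refl _, rfl⟩

theorem S3A_tensor :
    (RTAData.tensor D).S3A = {w | ∀ j, comp1 D w j ∈ (D j).S3A} :=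
  setOf_finite_eq hD comp1_bijective (fun _ hw _ => mem_S3_tensor_iff hD hw)
    fun _ w _ => ⟨w, .refl _⟩

theorem S4A_tensor :
    (RTAData.tensor D).S4A = {w | ∀ j, comp1 D w j ∈ (D j).S4A} :=
  setOf_finite_eq hD comp1_bijective (fun _ _ _ => mem_S4_tensor_iff hD)
    fun j w hw => ⟨w, mem_S4_self (hD j) hw⟩

theorem S2barA_tensor :
    (RTAData.tensor D).S2barA = {w | ∀ j, comp1 D w j ∈ (D j).S2barA} := by
  ext w
  constructor
  · rintro ⟨hw, h⟩ j
    have hfree := hw.1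
    rw [S2A_tensor hD] at hw
    refine ⟨hw j, fun x a ha b hb hax hxb => ?_⟩
    -- all other components are taken to be those of `w`
    have hself : ∀ k, (D k).res (comp1 D w k) ∈ (D k).S2 (comp1 D w k) :=
      fun k => ⟨_, .refl _, rfl⟩
    obtain ⟨v, hv⟩ := comp1_bijective.2 (Function.update (comp1 D w) j x)
    obtain ⟨a', ha'⟩ := comp0_bijective.2
      (Function.update (fun k => (D k).res (comp1 D w k)) j a)
    obtain ⟨b', hb'⟩ := comp0_bijective.2
      (Function.update (fun k => (D k).res (comp1 D w k)) j b)
    have hvA : v ∈ (RTAData.tensor D).S1A := by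
      refine h v a' ((mem_S2_tensor_iff hD hfree).2 fun k => ?_) b'
        ((mem_S2_tensor_iff hD hfree).2 fun k => ?_) (le0_tensor_iff.2 fun k => ?_)
        (le0_tensor_iff.2 fun k => ?_)
      all_goals
        simp only [comp0_res, hv, ha', hb']
        by_cases hk : k = j
        · subst hk
          simpa only [Function.update_self]
        · simp only [Function.update_of_ne hk]
          first | exact hself k | exact le0_refl (hD k) _
    rw [S1A_tensor hD] at hvA
    have := hvA j
    rwa [hv, Function.update_self] at this
  · intro h
    have hw : w ∈ (RTAData.tensor D).S2A := by
      rw [S2A_tensor hD]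
      exact fun j => (h j).1
    refine ⟨hw, fun v a ha b hb hav hvb => ?_⟩
    rw [S1A_tensor hD]
    exact fun j => (h j).2 _ _ ((mem_S2_tensor_iff hD hw.1).1 ha j) _
      ((mem_S2_tensor_iff hD hw.1).1 hb j) (le0_tensor_iff.1 hav j) (le0_tensor_iff.1 hvb j)

theorem free1_tensor :
    (RTAData.tensor D).free1 = {w | ∀ j, comp1 D w j ∈ (D j).free1} :=
  Set.ext fun _ => mem_free1_tensor_iff hD

variable (hne : ∀ j, (D j).free1.Nonempty)
include hne

theorem condS1_tensor_iff : (RTAData.tensor D).CondS1 ↔ ∀ j, (D j).CondS1 := by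
  rw [CondS1, S1A_tensor hD, free1_tensor hD]
  exact setOf_forall_mem_eq_iff comp1_bijective (fun j w h => h.1) hne

theorem condS2_tensor_iff : (RTAData.tensor D).CondS2 ↔ ∀ j, (D j).CondS2 := by
  rw [CondS2, S2A_tensor hD, free1_tensor hD]
  exact setOf_forall_mem_eq_iff comp1_bijective (fun j w h => h.1) hne

theorem condS3_tensor_iff : (RTAData.tensor D).CondS3 ↔ ∀ j, (D j).CondS3 := by
  rw [CondS3, S3A_tensor hD, free1_tensor hD]
  exact setOf_forall_mem_eq_iff comp1_bijective (fun j w h => h.1) hne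

theorem condS4_tensor_iff : (RTAData.tensor D).CondS4 ↔ ∀ j, (D j).CondS4 := by
  rw [CondS4, S4A_tensor hD, free1_tensor hD]
  exact setOf_forall_mem_eq_iff comp1_bijective (fun j w h => h.1) hne

end SSets

/-! ### Complete reducibility -/

section HighestWeight

open RTAData

variable {F A : Type u} [Field F] [Ring A] [Algebra F A] {D : RTAData F A}
  {V : Type u} [AddCommGroup V] [Module F V] [Module A V] [IsScalarTower F A V]
  {V' : Type u} [AddCommGroup V'] [Module F V'] [Module A V'] [IsScalarTower F A V']

theorem TriData.IsTriangular.H1_comm {T : TriData F A} (hT : T.IsTriangular) {h h' : A}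
    (hh : h ∈ T.H1) (hh' : h' ∈ T.H1) : h * h' = h' * h := by
  rw [← hT.i_fix _ (T.H1.mul_mem hh hh'), hT.i_mul, hT.i_fix _ hh, hT.i_fix _ hh']

theorem RTAData.IsMaxVec.of_injective {w : D.H1 →ₐ[F] F} {v : V} {f : V →ₗ[A] V'}
    (hf : Function.Injective f) (hv : D.IsMaxVec w (f v)) : D.IsMaxVec w v where
  weight h := hf (by rw [map_smul, hv.weight h, LinearMap.map_smul_of_tower])
  np n hn := hf (by rw [map_smul, hv.np n hn, map_zero])

/-- A semisimple object of `𝒪[free]` is generated by vectors killed by `N⁺`, and so are its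
submodules. -/
theorem le_span_Np_smul_eq_zero (hD : D.IsRTA) (hV : D.InOFree V) [IsSemisimpleModule A V]
    (N : Submodule A V) : N ≤ Submodule.span A {v | v ∈ N ∧ ∀ n ∈ D.Np, n • v = 0} := by
  conv_lhs => rw [← sSup_atoms_le_eq N]
  refine sSup_le ?_
  rintro S ⟨hS, hSN⟩
  obtain ⟨w, -, v, hvS, hv0, hv⟩ := exists_isMaxVec hD hV.semisimple.2 hV.weights
    hV.locallyFinite hS.1
  have h1 : Submodule.span A {v} ≤ S := by rwa [Submodule.span_singleton_le_iff_mem]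
  have h2 : Submodule.span A {v} = S :=
    ((hS.le_iff).1 h1).resolve_left fun h => hv0 (Submodule.span_singleton_eq_bot.1 h)
  rw [← h2]
  exact Submodule.span_mono (Set.singleton_subset_iff.2 ⟨hSN hvS, hv.np⟩)

theorem mem_span_isMaxVec (hD : D.IsRTA) (hV : ⨆ χ, weightSpace D.H1 V χ = ⊤) {x : V}
    (hx : ∀ n ∈ D.Np, n • x = 0) : x ∈ Submodule.span A {v : V | ∃ w, D.IsMaxVec w v} := by
  let N : Submodule F V :=
    { carrier := {x | ∀ n ∈ D.Np, n • x = 0}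
      zero_mem' := fun n _ => smul_zero n
      add_mem' := fun hx hy n hn => by rw [smul_add, hx n hn, hy n hn, add_zero]
      smul_mem' := fun c x hx n hn => by rw [smul_comm, hx n hn, smul_zero] }
  have h1 := mem_iSup_inf_weightSpace D.H1 N (fun h x hx => Np_smul_smul_eq_zero hD hx h)
    (x := x) hx (by rw [hV]; trivial)
  suffices H : ⨆ w, N ⊓ weightSpace D.H1 V w ≤
      (Submodule.span A {v : V | ∃ w, D.IsMaxVec w v}).restrictScalars F from H h1
  exact iSup_le fun w v hv => Submodule.subset_span ⟨w, ⟨hv.2, hv.1⟩⟩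

theorem inOFree_of_isMaxVec (hD : D.IsRTA) [FiniteDimensional F V] {w : D.H1 →ₐ[F] F}
    (hw : w ∈ D.free1) {v : V} (hv : D.IsMaxVec w v) (hgen : ∀ x : V, ∃ a : A, x = a • v) :
    D.InOFree V where
  fg := Module.Finite.of_restrictScalars_finite F A V
  semisimple := ⟨iSupIndep_weightSpace _, iSup_weightSpace1_eq_top hD hv hgen⟩
  finite _ := inferInstance
  locallyFinite _ := inferInstance
  weights χ hχ := by
    obtain ⟨θ, hθ, e⟩ := exists_eq_comp_of_weightSpace0_ne_bot hD hv hgen (χ := D.res χ)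
      fun h => hχ (le_bot_iff.1 ((weightSpace_le_res χ).trans h.le))
    refine mem_free0_of_act (mem_closure hθ) (χ := D.res χ) ?_
    rw [e, ← act_inv, ← act_mul, mul_inv_cancel, act_one]
    exact hw

end HighestWeight

/-- The space `V`, considered as a module over the `j`-th tensor factor only. -/
@[nolint unusedArguments]
def Restrict {ι : Type} [Fintype ι] [DecidableEq ι] (F : Type u) [Field F] (A : ι → Type u)
    [∀ j, Ring (A j)] [∀ j, Algebra F (A j)] (_j : ι) (V : Type u) : Type u := V

section Restrict

open RTAData

variable {ι : Type} [Fintype ι] [DecidableEq ι] {F : Type u} [Field F] {A : ι → Type u}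
  [∀ j, Ring (A j)] [∀ j, Algebra F (A j)] {j : ι}
  {V : Type u} [AddCommGroup V] [Module F V] [Module (⨂[F] j, A j) V]
  [IsScalarTower F (⨂[F] j, A j) V] {D : ∀ j, RTAData F (A j)}

instance : AddCommGroup (Restrict F A j V) := inferInstanceAs (AddCommGroup V)

instance : Module F (Restrict F A j V) := inferInstanceAs (Module F V)

instance : Module (A j) (Restrict F A j V) :=
  Module.compHom V (PiTensorProduct.singleAlgHom (R := F) (A := A) j).toRingHom

instance : IsScalarTower F (A j) (Restrict F A j V) :=
  ⟨fun c a (x : V) => by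
    have h : PiTensorProduct.singleAlgHom (R := F) j (c • a) • x =
        c • PiTensorProduct.singleAlgHom (R := F) j a • x := by
      rw [map_smul, smul_assoc]
    exact h⟩

instance [h : FiniteDimensional F V] : FiniteDimensional F (Restrict F A j V) := h

variable (F A j V) in
/-- The identity map from `V` to its restriction. -/
def toRestrict : V ≃ₗ[F] Restrict F A j V := LinearEquiv.refl F V

theorem single_smul_single_smul {j k : ι} (h : j ≠ k) (a : A j) (b : A k) (x : V) :
    PiTensorProduct.singleAlgHom (R := F) j a • PiTensorProduct.singleAlgHom (R := F) k b • x =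
    PiTensorProduct.singleAlgHom (R := F) k b • PiTensorProduct.singleAlgHom (R := F) j a • x := by
  have : PiTensorProduct.singleAlgHom (R := F) j a * PiTensorProduct.singleAlgHom (R := F) k b =
    PiTensorProduct.singleAlgHom (R := F) k b * PiTensorProduct.singleAlgHom (R := F) j a := by
    rw [singleAlgHom_eq, singleAlgHom_eq, PiTensorProduct.tprod_mul_tprod,
      PiTensorProduct.tprod_mul_tprod, (Pi.mulSingle_commute h a b).eq]
  rw [← mul_smul, this, mul_smul]

theorem toRestrict_mem_weightSpace {w : (RTAData.tensor D).H1 →ₐ[F] F} {x : V}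
    (hx : x ∈ weightSpace (RTAData.tensor D).H1 V w) :
    toRestrict F A j V x ∈ weightSpace (D j).H1 (Restrict F A j V) (comp1 D w j) := fun h =>
  congrArg (toRestrict F A j V) (hx (tensorIncl (fun j => (D j).H1) j h))

section

variable (hD : ∀ j, (D j).IsRTA)
include hD

theorem RTAData.IsMaxVec.restrict {w : (RTAData.tensor D).H1 →ₐ[F] F} {v : V}
    (hv : (RTAData.tensor D).IsMaxVec w v) (j : ι) :
    (D j).IsMaxVec (comp1 D w j) (toRestrict F A j V v) :=
  ⟨toRestrict_mem_weightSpace hv.weight, fun _ hn => hv.np _ (single_mem_Np hD hn)⟩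

theorem inOFree_restrict [FiniteDimensional F V] (hV : (RTAData.tensor D).InOFree V) (j : ι) :
    (D j).InOFree (Restrict F A j V) where
  fg := Module.Finite.of_restrictScalars_finite F (A j) _
  semisimple := by
    refine ⟨iSupIndep_weightSpace _, ?_⟩
    have h := congrArg (Submodule.map (toRestrict F A j V).toLinearMap) hV.semisimple.2
    rw [Submodule.map_iSup, Submodule.map_top, LinearEquiv.range] at h
    rw [← top_le_iff, ← h]
    refine iSup_le fun w => le_iSup_of_le (comp1 D w j) ?_
    rintro _ ⟨x, hx, rfl⟩
    exact toRestrict_mem_weightSpace hx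
  finite _ := inferInstance
  locallyFinite _ := inferInstance
  weights χ hχ := by
    have := nontrivial_of_isRTA hD
    let N : Submodule F V := (weightSpace (D j).H1 (Restrict F A j V) χ).comap
      (toRestrict F A j V).toLinearMap
    have hN : ∀ (h : (RTAData.tensor D).H1), ∀ x ∈ N, (h : ⨂[F] j, A j) • x ∈ N := by
      intro h x hx h'
      change PiTensorProduct.singleAlgHom (R := F) j (h' : A j) • (h : ⨂[F] j, A j) • x =
        χ h' • (h : ⨂[F] j, A j) • x
      rw [← mul_smul, (isTriangular_tensor_of_isRTA hD).H1_comm (single_mem_tensorSub h'.2) h.2,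
        mul_smul, smul_comm (χ h')]
      exact congrArg _ (hx h')
    have hne : N ≠ ⊥ := by
      refine fun h => hχ ?_
      rw [eq_bot_iff]
      intro y hy
      have : (toRestrict F A j V).symm y ∈ N := hy
      rw [h] at this
      exact this
    obtain ⟨w, x, hxN, hx0, hx⟩ := exists_weight_vector (H := (RTAData.tensor D).H1) (N := N)
      hN hne (by rw [hV.semisimple.2]; exact le_top)
    have hw : w ∈ (RTAData.tensor D).free1 :=
      hV.weights w fun h => hx0 (by rw [h] at hx; exact hx)
    have e : comp1 D w j = χ := by
      ext h
      refine smul_left_injective F hx0 ?_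
      exact (hx (tensorIncl (fun j => (D j).H1) j h)).symm.trans (hxN h)
    rw [← e]
    exact (mem_free1_tensor_iff hD).1 hw j

attribute [local instance] tensorModule isScalarTower_tensor

omit hD in
theorem isSimpleModule_range_of_tensor {W : ι → Type u} [∀ j, AddCommGroup (W j)]
    [∀ j, Module F (W j)] [∀ j, Module (A j) (W j)] [∀ j, IsScalarTower F (A j) (W j)]
    (hs : IsSimpleModule (⨂[F] j, A j) (⨂[F] j, W j))
    {G : (⨂[F] j, W j) →ₗ[⨂[F] j, A j] V} (hG : G ≠ 0) :
    IsSimpleModule (⨂[F] j, A j) (LinearMap.range G) :=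
  IsSimpleModule.congr (LinearEquiv.ofInjective G (LinearMap.injective_of_ne_zero hG)).symm

/-- A maximal vector of free weight generates a simple module if all restrictions to the tensor
factors are semisimple: the generated module is a quotient of a tensor product of simple
modules. -/
theorem isSimpleModule_span_singleton [∀ j, IsSemisimpleModule (A j) (Restrict F A j V)]
    {w : (RTAData.tensor D).H1 →ₐ[F] F} (hw : w ∈ (RTAData.tensor D).free1) {v : V} (hv0 : v ≠ 0)
    (hv : (RTAData.tensor D).IsMaxVec w v) :
    IsSimpleModule (⨂[F] j, A j) (Submodule.span (⨂[F] j, A j) {v}) := by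
  let f := fun j => LinearMap.toSpanSingleton (A j) (Restrict F A j V) (toRestrict F A j V v)
  let I := fun j => LinearMap.ker (f j)
  let g := fun j => (I j).liftQ (f j) le_rfl
  have hg : ∀ j, Function.Injective (g j) := fun j =>
    LinearMap.ker_eq_bot.1 (Submodule.ker_liftQ_eq_bot _ _ _ le_rfl)
  have hg1 : ∀ j, g j ((I j).mkQ 1) = toRestrict F A j V v := fun j =>
    (Submodule.liftQ_apply _ _ _).trans (one_smul (A j) _)
  have hmax : ∀ j, (D j).IsMaxVec (comp1 D w j) ((I j).mkQ 1) := fun j =>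
    .of_injective (hg j) (by rw [hg1]; exact hv.restrict hD j)
  have hne : ∀ j, (I j).mkQ 1 ≠ 0 := by
    intro j h
    have := hg1 j
    rw [h, map_zero] at this
    exact hv0 this.symm
  have hw' := (mem_free1_tensor_iff hD).1 hw
  have hsimple : ∀ j, IsSimpleModule (A j) (A j ⧸ I j) := fun j =>
    have := IsSemisimpleModule.congr (LinearEquiv.ofInjective (g j) (hg j))
    isSimpleModule_of_isSemisimple (hD j) (hmax j) (fun x => by
      obtain ⟨a, rfl⟩ := (I j).mkQ_surjective x
      exact ⟨a, by rw [← map_smul, smul_eq_mul, mul_one]⟩) (hw' j) (hne j)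
  have hs := isSimpleModule_tensor_of_isMaxVec (F := F) hD hw' hne hmax
  obtain ⟨G, hG⟩ := exists_linearMap_quotient (F := F) I (v := v) fun j a ha => ha
  have hG0 : G ≠ 0 := fun h => hv0 (by rw [← hG, h]; rfl)
  have hrange : LinearMap.range G = Submodule.span (⨂[F] j, A j) {v} := by
    apply le_antisymm
    · rintro _ ⟨x, rfl⟩
      obtain ⟨a, rfl⟩ := exists_eq_smul_tprod (F := F) (v := fun j => (I j).mkQ 1) (fun j x => by
        obtain ⟨a, rfl⟩ := (I j).mkQ_surjective x
        exact ⟨a, by rw [← map_smul, smul_eq_mul, mul_one]⟩) x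
      rw [map_smul, hG]
      exact Submodule.smul_mem _ _ (Submodule.mem_span_singleton_self v)
    · rw [Submodule.span_singleton_le_iff_mem, ← hG]
      exact ⟨_, rfl⟩
  rw [← hrange]
  exact isSimpleModule_range_of_tensor (W := fun j => A j ⧸ I j) hs hG0

/-- If all restrictions of `V` to the tensor factors are semisimple, then `V` is generated by the
vectors killed by the `N⁺` of the factors in a given set. -/
theorem span_Np_smul_eq_zero [FiniteDimensional F V] (hV : (RTAData.tensor D).InOFree V)
    [∀ j, IsSemisimpleModule (A j) (Restrict F A j V)] (s : Finset ι) :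
    Submodule.span (⨂[F] j, A j) {v : V | ∀ k ∈ s, ∀ n ∈ (D k).Np,
      PiTensorProduct.singleAlgHom (R := F) k n • v = 0} = ⊤ := by
  induction s using Finset.induction_on with
  | empty => simp
  | insert k s hk ih =>
    rw [← top_le_iff, ← ih, Submodule.span_le]
    let N : Submodule (A k) (Restrict F A k V) :=
      { carrier := {v | ∀ l ∈ s, ∀ n ∈ (D l).Np,
          PiTensorProduct.singleAlgHom (R := F) l n • (toRestrict F A k V).symm v = 0}
        zero_mem' := fun l _ n _ => by rw [map_zero, smul_zero]
        add_mem' := fun hx hy l hl n hn => by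
          rw [map_add, smul_add, hx l hl n hn, hy l hl n hn, add_zero]
        smul_mem' := fun a x hx l hl n hn => by
          have hlk : l ≠ k := fun h => hk (h ▸ hl)
          refine (single_smul_single_smul hlk n a ((toRestrict F A k V).symm x)).trans ?_
          rw [hx l hl n hn, smul_zero] }
    let S : Submodule (⨂[F] j, A j) V := Submodule.span (⨂[F] j, A j)
      {v : V | ∀ l ∈ insert k s, ∀ n ∈ (D l).Np,
        PiTensorProduct.singleAlgHom (R := F) l n • v = 0}
    let S' : Submodule (A k) (Restrict F A k V) :=
      { carrier := {v | (toRestrict F A k V).symm v ∈ S}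
        zero_mem' := S.zero_mem
        add_mem' := S.add_mem
        smul_mem' := fun a x hx => S.smul_mem (PiTensorProduct.singleAlgHom (R := F) k a)
          (show (toRestrict F A k V).symm x ∈ S from hx) }
    suffices H : N ≤ S' by
      intro v hv
      have h : toRestrict F A k V v ∈ S' := H hv
      exact h
    refine (le_span_Np_smul_eq_zero (hD k) (inOFree_restrict hD hV k) N).trans
      (Submodule.span_le.2 ?_)
    rintro v ⟨hvN, hv⟩
    have h : (toRestrict F A k V).symm v ∈ S := by
      refine Submodule.subset_span fun l hl n hn => ?_
      rcases Finset.mem_insert.1 hl with rfl | hl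
      · exact hv n hn
      · exact hvN l hl n hn
    exact h

/-- Complete reducibility passes to tensor products: a finite-dimensional module is semisimple over
every factor, hence generated by vectors that are maximal over all factors at once, and each of
these generates a simple module. -/
theorem completelyReducible_tensor (h : ∀ j, (D j).CompletelyReducible) :
    (RTAData.tensor D).CompletelyReducible := by
  intro V _ _ _ _ hfd hV
  have := fun j => h j (Restrict F A j V) inferInstance (inOFree_restrict hD hV j)
  refine IsSemisimpleModule.of_sSup_simples_eq_top (top_le_iff.1 ?_)
  rw [← span_Np_smul_eq_zero hD hV Finset.univ, Submodule.span_le]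
  intro x hx
  have hx' := mem_span_isMaxVec (isRTA_tensor hD) hV.semisimple.2
    (Np_tensor_smul_eq_zero hD fun j n hn => hx j (Finset.mem_univ j) n hn)
  suffices H : Submodule.span (⨂[F] j, A j) {v : V | ∃ w, (RTAData.tensor D).IsMaxVec w v} ≤
    sSup {m : Submodule (⨂[F] j, A j) V | IsSimpleModule (⨂[F] j, A j) m} from H hx'
  rw [Submodule.span_le]
  rintro v ⟨w, hv⟩
  by_cases hv0 : v = 0
  · rw [hv0]
    exact Submodule.zero_mem _
  · have hw : w ∈ (RTAData.tensor D).free1 := hV.weights w fun hbot => hv0 (by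
      have := hv.weight
      rwa [hbot] at this)
    exact (le_sSup (isSimpleModule_span_singleton hD hw hv0 hv) :
      Submodule.span (⨂[F] j, A j) {v} ≤ _) (Submodule.mem_span_singleton_self v)

end

end Restrict

section Converse

open RTAData

variable {ι : Type} [Fintype ι] [DecidableEq ι] {F : Type u} [Field F] {A : ι → Type u}
  [∀ j, Ring (A j)] [∀ j, Algebra F (A j)]
  {W : ι → Type u} [∀ j, AddCommGroup (W j)] [∀ j, Module F (W j)] [∀ j, Module (A j) (W j)]
  [∀ j, IsScalarTower F (A j) (W j)] {D : ∀ j, RTAData F (A j)}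

attribute [local instance] tensorModule isScalarTower_tensor

/-- If `⨂ₖ Wₖ` is semisimple and `Wₖ` is nonzero for `k ≠ j`, then `Wⱼ` is semisimple: a
projection of the tensor product onto `N ⊗ ⨂_{k ≠ j} Wₖ` induces a projection onto `N`. -/
theorem isSemisimpleModule_of_tensor [IsSemisimpleModule (⨂[F] j, A j) (⨂[F] j, W j)] (j : ι)
    {v : ∀ j, W j} (hv : ∀ k ≠ j, v k ≠ 0) : IsSemisimpleModule (A j) (W j) := by
  refine (isSemisimpleModule_iff _ _).2 ⟨fun N => ?_⟩
  let U : ∀ k, Submodule (A k) (W k) := Function.update (fun _ => ⊤) j N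
  let T : Submodule (⨂[F] j, A j) (⨂[F] j, W j) :=
    LinearMap.range (tensorMap (F := F) fun k => (U k).subtype)
  obtain ⟨T', hT⟩ := exists_isCompl T
  have hψ : ∀ k, ∃ ψ : Module.Dual F (W k), k ≠ j → ψ (v k) = 1 := by
    intro k
    by_cases hk : k = j
    · exact ⟨0, fun h => (h hk).elim⟩
    · exact (Module.Projective.exists_dual_eq_one F (hv k hk)).imp fun _ h _ => h
  choose ψ hψ using hψ
  have hU : ∀ z, (tensorMap (F := F) fun k => (U k).subtype) z ∈
      tprodSpan fun k => (U k).restrictScalars F := by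
    intro z
    induction z using PiTensorProduct.induction_on with
    | smul_tprod r x =>
      rw [LinearMap.map_smul_of_tower, tensorMap_tprod]
      exact Submodule.smul_mem _ _ (tprod_mem_tprodSpan fun k => (x k).2)
    | add a b ha hb =>
      rw [map_add]
      exact Submodule.add_mem _ ha hb
  let q := factorMap (T.subtype.comp (T.projectionOnto T' hT)) v ψ j
  have hqN : ∀ y, q y ∈ N := by
    intro y
    obtain ⟨z, hz⟩ := (T.projectionOnto T' hT (insertAt v j y)).2
    have h2 := evalExcept_mem j ψ (hU z)
    rw [hz] at h2
    have h3 : U j = N := Function.update_self _ _ _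
    rw [← h3]
    exact h2
  have hq : ∀ y : N, q.codRestrict N hqN y = y := by
    intro y
    refine Subtype.ext ?_
    have hT' : insertAt v j (y : W j) ∈ T := by
      have hy : ∀ k, Function.update v j (y : W j) k ∈ U k := by
        intro k
        by_cases hk : k = j
        · subst hk
          simp [U]
        · simp [U, hk]
      exact ⟨PiTensorProduct.tprod F fun k => ⟨_, hy k⟩, tensorMap_tprod _ _⟩
    change evalExcept j ψ (T.projectionOnto T' hT (insertAt v j (y : W j))) = y
    rw [Submodule.projectionOnto_apply_left hT ⟨_, hT'⟩]
    exact evalExcept_insertAt v j _ ψ hψ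
  exact ⟨_, LinearMap.isCompl_of_proj hq⟩

/-- A finite-dimensional object of `𝒪[free]`, bundled so that one member of a family of objects can
be replaced by `Function.update`. -/
structure FinObj {F A : Type u} [Field F] [Ring A] [Algebra F A] (D : RTAData F A) where
  carrier : Type u
  [addCommGroup : AddCommGroup carrier]
  [module : Module F carrier]
  [moduleA : Module A carrier]
  [isScalarTower : IsScalarTower F A carrier]
  finiteDimensional : FiniteDimensional F carrier
  inOFree : D.InOFree carrier

attribute [local instance] FinObj.addCommGroup FinObj.module FinObj.moduleA FinObj.isScalarTower

/-- Complete reducibility descends to the factors: a module over the `j`-th factor is tensored with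
finite-dimensional simple modules over the other factors. -/
theorem completelyReducible_of_tensor (hD : ∀ j, (D j).IsRTA)
    (hμ : ∀ j, ∃ w ∈ (D j).free1, FiniteDimensional F ((D j).Simple w))
    (h : (RTAData.tensor D).CompletelyReducible) (j : ι) : (D j).CompletelyReducible := by
  intro M _ _ _ _ hfd hM
  choose μ hμ hfin using hμ
  let X : ∀ k, FinObj (D k) := fun k => ⟨(D k).Simple (μ k), hfin k,
    inOFree_of_isMaxVec (hD k) (hμ k) isMaxVec_simple exists_eq_smul_simple⟩
  let Y : ∀ k, FinObj (D k) := Function.update X j ⟨M, hfd, hM⟩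
  have hY : Y j = ⟨M, hfd, hM⟩ := Function.update_self _ _ _
  have hv : ∀ k, ∃ v : (Y k).carrier, k ≠ j → v ≠ 0 := by
    intro k
    by_cases hk : k = j
    · exact ⟨0, fun h => (h hk).elim⟩
    · have : Y k = X k := Function.update_of_ne hk _ _
      rw [this]
      exact ⟨_, fun _ => simple_mk_one_ne_zero (hD k) (hμ k)⟩
  choose v hv using hv
  have := fun k => (Y k).finiteDimensional
  have hfdT : FiniteDimensional F (⨂[F] k, (Y k).carrier) := inferInstance
  have hss := h (⨂[F] k, (Y k).carrier) hfdT (inOFree_tensor hD (fun k => (Y k).inOFree)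
    (Module.Finite.of_restrictScalars_finite F _ _))
  have key := isSemisimpleModule_of_tensor (F := F) (A := A) j hv
  rw [hY] at key
  exact key

end Converse

/-! ### Adjoint weight spaces of Hopf algebras -/

section Rho

variable {F K A : Type u} [Field F] [CommRing K] [HopfAlgebra F K] [Ring A] [Algebra F A]

open WithConv

theorem toConv_rho (w : WithConv (K →ₐ[F] F)) :
    toConv (rho w) = toConv ((Algebra.ofId F K).comp w⁻¹.ofConv) * toConv (.id F K) := by
  apply WithConv.ofConv_injective
  ext h
  exact (AlgHom.convMul_apply (toConv ((Algebra.ofId F K).comp w⁻¹.ofConv))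
    (toConv (.id F K)) h).symm

theorem comp_ofId_comp {K' : Type u} [CommRing K'] [Algebra F K'] (f : K →ₐ[F] K')
    {L : Type u} [CommRing L] [Algebra F L] (w : L →ₐ[F] F) :
    f.comp ((Algebra.ofId F K).comp w) = (Algebra.ofId F K').comp w := by
  rw [← AlgHom.comp_assoc, Subsingleton.elim (f.comp (Algebra.ofId F K))]

theorem rho_comp_rho (w w' : WithConv (K →ₐ[F] F)) :
    (rho w).comp (rho w') = rho (w * w') := by
  apply WithConv.toConv_injective
  have h := AlgHom.comp_convMul_distrib (rho w) (toConv ((Algebra.ofId F K).comp w'⁻¹.ofConv))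
    (toConv (.id F K))
  rw [← toConv_rho] at h
  simp only at h
  rw [h, toConv_ofConv, comp_ofId_comp, AlgHom.comp_id, toConv_rho, toConv_rho, ← mul_assoc,
    mul_inv_rev]
  congr 1
  have h2 := AlgHom.comp_convMul_distrib (Algebra.ofId F K) w'⁻¹ w⁻¹
  rw [h2, toConv_ofConv]

theorem rho_one : rho (1 : WithConv (K →ₐ[F] F)) = .id F K := by
  apply WithConv.toConv_injective
  rw [toConv_rho, inv_one]
  exact one_mul _

theorem counit_comp_rho (w : WithConv (K →ₐ[F] F)) :
    toConv ((Bialgebra.counitAlgHom F K).comp (rho w)) = w⁻¹ := by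
  have h := AlgHom.comp_convMul_distrib (Bialgebra.counitAlgHom F K)
    (toConv ((Algebra.ofId F K).comp w⁻¹.ofConv)) (toConv (.id F K))
  rw [← toConv_rho] at h
  simp only at h
  rw [h, toConv_ofConv, comp_ofId_comp, AlgHom.comp_id]
  exact mul_one _

variable (F K) in
/-- The weight-to-root map as a homomorphism into the automorphism group of `K`. -/
def rhoHom : WithConv (K →ₐ[F] F) →* (K ≃ₐ[F] K) where
  toFun w := AlgEquiv.ofAlgHom (rho w) (rho w⁻¹) (by rw [rho_comp_rho, mul_inv_cancel, rho_one])
    (by rw [rho_comp_rho, inv_mul_cancel, rho_one])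
  map_one' := AlgEquiv.ext fun x => DFunLike.congr_fun (rho_one (F := F) (K := K)) x
  map_mul' w w' := AlgEquiv.ext fun x => (DFunLike.congr_fun (rho_comp_rho w w') x).symm

theorem rhoHom_injective : Function.Injective (rhoHom F K) := by
  intro w w' h
  have e : rho w = rho w' := AlgHom.ext fun x => DFunLike.congr_fun h x
  rw [← inv_inj, ← counit_comp_rho, e, counit_comp_rho]

/-- The automorphism of the image of `K` in `A` induced by `ρ(w)`. -/
def rangeAut {f : K →ₐ[F] A} (hf : Function.Injective f) :
    WithConv (K →ₐ[F] F) →* (f.range ≃ₐ[F] f.range) :=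
  (AlgEquiv.autCongr (AlgEquiv.ofInjective f hf)).toMonoidHom.comp (rhoHom F K)

theorem rangeAut_injective {f : K →ₐ[F] A} (hf : Function.Injective f) :
    Function.Injective (rangeAut hf) :=
  (AlgEquiv.autCongr (AlgEquiv.ofInjective f hf)).injective.comp rhoHom_injective

theorem rangeAut_rangeRestrict {f : K →ₐ[F] A} (hf : Function.Injective f)
    (w : WithConv (K →ₐ[F] F)) (h : K) :
    rangeAut hf w (f.rangeRestrict h) = f.rangeRestrict (rho w h) :=
  congrArg (fun x => f.rangeRestrict (rho w x))
    ((AlgEquiv.ofInjective f hf).symm_apply_apply h)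

theorem rangeAut_eq_iff {f : K →ₐ[F] A} (hf : Function.Injective f) {w : WithConv (K →ₐ[F] F)}
    {θ : f.range ≃ₐ[F] f.range} :
    θ = rangeAut hf w ↔ ∀ h, θ (f.rangeRestrict h) = f.rangeRestrict (rho w h) := by
  refine ⟨fun e h => by rw [e, rangeAut_rangeRestrict], fun e => AlgEquiv.ext ?_⟩
  intro x
  obtain ⟨h, rfl⟩ := f.rangeRestrict_surjective x
  rw [e, rangeAut_rangeRestrict]

theorem conv_comp_antipode (f : K →ₐ[F] A) :
    toConv f.toLinearMap * toConv (f.toLinearMap ∘ₗ HopfAlgebra.antipode F) = 1 ∧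
    toConv (f.toLinearMap ∘ₗ HopfAlgebra.antipode F) * toConv f.toLinearMap = 1 := by
  have h1 := LinearMap.algHom_comp_convMul_distrib f (toConv LinearMap.id)
    (toConv (HopfAlgebra.antipode F (A := K)))
  have h2 := LinearMap.algHom_comp_convMul_distrib f (toConv (HopfAlgebra.antipode F (A := K)))
    (toConv LinearMap.id)
  rw [LinearMap.id_mul_antipode] at h1
  rw [LinearMap.antipode_mul_id] at h2
  have h3 : f.toLinearMap ∘ₗ (1 : WithConv (K →ₗ[F] K)).ofConv =
      (1 : WithConv (K →ₗ[F] A)).ofConv := by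
    ext x
    exact f.commutes _
  rw [h3] at h1 h2
  exact ⟨(WithConv.ofConv_injective h1).symm, (WithConv.ofConv_injective h2).symm⟩

/-- The weight space of weight `w` for the adjoint action is the root space of `ρ(w)`. In the
convolution algebra of linear maps `K → A`, with `c` the map `a · ε` and `W` the map `w`, the two
conditions are `f c f⁻¹ = W c` and `c f = W⁻¹ f c`. -/
theorem mem_adWeightSpace_iff {f : K →ₐ[F] A} {w : WithConv (K →ₐ[F] F)} {a : A} :
    a ∈ adWeightSpace f w.ofConv ↔ ∀ h, a * f h = f (rho w h) * a := by
  let φ : WithConv (K →ₗ[F] A) := toConv f.toLinearMap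
  let φ' : WithConv (K →ₗ[F] A) := toConv (f.toLinearMap ∘ₗ HopfAlgebra.antipode F)
  let c : WithConv (K →ₗ[F] A) := toConv (LinearMap.toSpanSingleton F A a ∘ₗ Coalgebra.counit)
  let g : K →ₐ[F] A := (Algebra.ofId F A).comp w.ofConv
  let W : WithConv (K →ₗ[F] A) := toConv g.toLinearMap
  let W' : WithConv (K →ₗ[F] A) := toConv (g.toLinearMap ∘ₗ HopfAlgebra.antipode F)
  obtain ⟨h1, h2⟩ : φ * φ' = 1 ∧ φ' * φ = 1 := conv_comp_antipode f
  obtain ⟨h3, h4⟩ : W * W' = 1 ∧ W' * W = 1 := conv_comp_antipode g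
  have hr : ∀ (ψ : WithConv (K →ₗ[F] A)) (h : K), (ψ * c) h = ψ h * a := by
    intro ψ h
    have e : ∀ t, LinearMap.mul' F A (TensorProduct.map ψ.ofConv c.ofConv t) =
        LinearMap.mul' F A (TensorProduct.map ψ.ofConv
          (1 : WithConv (K →ₗ[F] A)).ofConv t) * a := by
      intro t
      induction t with
      | zero => simp
      | tmul x y =>
        change ψ.ofConv x * (Coalgebra.counit (R := F) y • a) =
          ψ.ofConv x * algebraMap F A (Coalgebra.counit (R := F) y) * a
        rw [mul_assoc, Algebra.smul_def]
      | add x y hx hy => rw [map_add, map_add, map_add, map_add, add_mul, hx, hy]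
    exact (e _).trans (congrArg (fun x : WithConv (K →ₗ[F] A) => x h * a) (mul_one ψ))
  have hl : ∀ (ψ : WithConv (K →ₗ[F] A)) (h : K), (c * ψ) h = a * ψ h := by
    intro ψ h
    have e : ∀ t, LinearMap.mul' F A (TensorProduct.map c.ofConv ψ.ofConv t) =
        a * LinearMap.mul' F A (TensorProduct.map (1 : WithConv (K →ₗ[F] A)).ofConv
          ψ.ofConv t) := by
      intro t
      induction t with
      | zero => simp
      | tmul x y =>
        change (Coalgebra.counit (R := F) x • a) * ψ.ofConv y =
          a * (algebraMap F A (Coalgebra.counit (R := F) x) * ψ.ofConv y)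
        rw [← mul_assoc, ← Algebra.commutes, Algebra.smul_def]
      | add x y hx hy => rw [map_add, map_add, map_add, map_add, mul_add, hx, hy]
    exact (e _).trans (congrArg (fun x : WithConv (K →ₗ[F] A) => a * x h) (one_mul ψ))
  have had : ∀ h, ad f h a = (φ * c * φ') h := by
    intro h
    have e : φ * c = toConv (LinearMap.mulRight F a ∘ₗ f.toLinearMap) := by
      apply WithConv.ofConv_injective
      ext x
      exact hr φ x
    rw [e]
    rfl
  have hrho : ∀ h, f (rho w h) = (W' * φ) h := by
    intro h
    have e : ∀ t, f (Algebra.TensorProduct.lift ((Algebra.ofId F K).comp w⁻¹.ofConv) (.id F K)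
        (fun _ _ => Commute.all _ _) t) =
        LinearMap.mul' F A (TensorProduct.map W'.ofConv φ.ofConv t) := by
      intro t
      induction t with
      | zero => simp
      | tmul x y =>
        rw [Algebra.TensorProduct.lift_tmul, map_mul]
        exact congrArg (· * f y) (f.commutes _)
      | add x y hx hy => rw [map_add, map_add, map_add, map_add, hx, hy]
    exact e _
  have key : φ * c * φ' = W * c ↔ c * φ = W' * φ * c := by
    constructor
    · intro e
      rw [mul_assoc, show φ * c = W * c * φ by rw [← e, mul_assoc, h2, mul_one], ← mul_assoc,
        ← mul_assoc, h4, one_mul]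
    · intro e
      rw [show φ * c = W * (c * φ) by rw [e, ← mul_assoc, ← mul_assoc, h3, one_mul], mul_assoc,
        mul_assoc, h1, mul_one]
  have hext : ∀ {x y : WithConv (K →ₗ[F] A)}, x = y ↔ ∀ h, x h = y h := by
    intro x y
    exact ⟨fun e h => by rw [e], fun e => WithConv.ofConv_injective (LinearMap.ext e)⟩
  rw [hext, hext] at key
  refine Iff.trans (forall_congr' fun h => ?_) (key.trans (forall_congr' fun h => ?_))
  · rw [had, hr, Algebra.smul_def]
    rfl
  · rw [hl, hr, hrho]
    rfl

theorem rootSpace_rangeAut {f : K →ₐ[F] A} (hf : Function.Injective f)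
    (w : WithConv (K →ₐ[F] F)) :
    rootSpace f.range (rangeAut hf w) = adWeightSpace f w.ofConv := by
  ext a
  rw [mem_adWeightSpace_iff]
  constructor
  · intro h x
    exact (h (f.rangeRestrict x)).trans (by rw [rangeAut_rangeRestrict]; rfl)
  · intro h x
    obtain ⟨x, rfl⟩ := f.rangeRestrict_surjective x
    rw [rangeAut_rangeRestrict]
    exact h x

/-- Restriction of weights along a map of bialgebras. -/
def convComp {K' : Type u} [CommRing K'] [HopfAlgebra F K'] (f : K →ₐc[F] K') :
    WithConv (K' →ₐ[F] F) →* WithConv (K →ₐ[F] F) where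
  toFun w := toConv (w.ofConv.comp (f : K →ₐ[F] K'))
  map_one' := by
    apply WithConv.ofConv_injective
    ext x
    simp
  map_mul' w w' := by
    apply WithConv.ofConv_injective
    exact AlgHom.convMul_comp_bialgHom_distrib w w' f

theorem rho_bialgHom {K' : Type u} [CommRing K'] [HopfAlgebra F K'] (f : K →ₐc[F] K')
    (w : WithConv (K' →ₐ[F] F)) (h : K) :
    rho w (f h) = f (rho (convComp f w) h) := by
  have h1 := AlgHom.convMul_comp_bialgHom_distrib (toConv ((Algebra.ofId F K').comp w⁻¹.ofConv))
    (toConv (.id F K')) f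
  have h2 := AlgHom.comp_convMul_distrib (f : K →ₐ[F] K')
    (toConv ((Algebra.ofId F K).comp (convComp f w)⁻¹.ofConv)) (toConv (.id F K))
  rw [← toConv_rho] at h1 h2
  simp only [comp_ofId_comp, AlgHom.id_comp, AlgHom.comp_id, ← map_inv, AlgHom.comp_assoc] at h1 h2
  exact DFunLike.congr_fun (h1.trans h2.symm) h

end Rho

/-! ### The data underlying a Hopf regular triangular algebra -/

section Underlying

open WithConv

variable {F A K1 K0 : Type u} [Field F] [Ring A] [Algebra F A] [CommRing K1]
  [HopfAlgebra F K1] [CommRing K0] [HopfAlgebra F K0] {E : HRTAData F A K1 K0}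

namespace HRTAData

/-- The automorphism `ρ(w)` of `H₀`. -/
def aut0 (h : Function.Injective E.incl) :
    WithConv (K0 →ₐ[F] F) →* (E.toRTAData.H0 ≃ₐ[F] E.toRTAData.H0) :=
  rangeAut h

/-- The automorphism `ρ(w)` of `H₁`. -/
def aut1 (h : Function.Injective E.incl1) :
    WithConv (K1 →ₐ[F] F) →* (E.toRTAData.H1 ≃ₐ[F] E.toRTAData.H1) :=
  rangeAut h

theorem coe_aut0_incl (h : Function.Injective E.incl) (w : WithConv (K0 →ₐ[F] F)) (x : K0) :
    (aut0 h w (E.incl.rangeRestrict x) : A) = E.incl (rho w x) :=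
  congrArg Subtype.val (rangeAut_rangeRestrict h w x)

theorem aut0_injective (h : Function.Injective E.incl) : Function.Injective (aut0 h) :=
  rangeAut_injective h

theorem Q0_toRTAData (h : Function.Injective E.incl) : E.toRTAData.Q0 = aut0 h '' E.Q0 := by
  ext θ
  constructor
  · rintro ⟨w, hw, e⟩
    exact ⟨w, hw, ((rangeAut_eq_iff h).2 e).symm⟩
  · rintro ⟨w, hw, rfl⟩
    exact ⟨w, hw, fun x => rangeAut_rangeRestrict h w x⟩

theorem BpRoot0_aut0 (h : Function.Injective E.incl) (w : WithConv (K0 →ₐ[F] F)) :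
    E.toRTAData.BpRoot0 (aut0 h w) =
      Subalgebra.toSubmodule E.Bp ⊓ adWeightSpace E.incl w.ofConv :=
  congrArg (Subalgebra.toSubmodule E.Bp ⊓ ·) (rootSpace_rangeAut h w)

theorem BpRoot1_aut1 (h : Function.Injective E.incl1) (w : K1 →ₐ[F] F) :
    E.toRTAData.BpRoot1 (aut1 h (toConv w)) =
      Subalgebra.toSubmodule E.Bp ⊓ adWeightSpace E.incl1 w :=
  congrArg (Subalgebra.toSubmodule E.Bp ⊓ ·) (rootSpace_rangeAut h (toConv w))

theorem aut1_mem_Q1 (h1 : Function.Injective E.incl1) (h0 : Function.Injective E.incl)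
    {w : K1 →ₐ[F] F} (hw : w ∈ E.Q1) : aut1 h1 (toConv w) ∈ E.toRTAData.Q1 := by
  refine ⟨aut0 h0 (convComp E.incl0 (toConv w)), ?_, fun x => ?_⟩
  · rw [Q0_toRTAData h0]
    exact ⟨_, hw, rfl⟩
  · obtain ⟨x, rfl⟩ := E.incl.rangeRestrict_surjective x
    refine (rangeAut_rangeRestrict h1 (toConv w) (E.incl0 x)).trans (Subtype.ext ?_)
    refine (congrArg E.incl1 (rho_bialgHom E.incl0 (toConv w) x)).trans ?_
    exact (coe_aut0_incl h0 (convComp E.incl0 (toConv w)) x).symm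

theorem ofConv_one : (1 : WithConv (K0 →ₐ[F] F)).ofConv = Bialgebra.counitAlgHom F K0 :=
  AlgHom.ext fun _ => rfl

theorem IsHRTA.injective (hE : E.IsHRTA) : Function.Injective E.incl :=
  hE.injective1.comp hE.injective0

theorem IsHRTA.isRTA (hE : E.IsHRTA) : E.toRTAData.IsRTA where
  triangular := hE.triangular
  positive := by
    rw [Q0_toRTAData hE.injective]
    have hp := hE.positive
    refine ⟨⟨1, hp.one_mem, map_one _⟩, ?_, ?_⟩
    · rintro _ ⟨w, h, rfl⟩ _ ⟨w', h', rfl⟩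
      exact ⟨w * w', hp.mul_mem _ h _ h', map_mul _ _ _⟩
    · rintro _ ⟨w, h, rfl⟩ _ ⟨w', h', rfl⟩ hne hne' e
      rw [← map_mul, map_eq_one_iff _ (aut0_injective hE.injective)] at e
      exact hp.mul_ne_one _ h _ h' (fun h => hne (by rw [h, map_one]))
        (fun h => hne' (by rw [h, map_one])) e
  -- a priori `H₁` may have more automorphisms than those of the form `ρ(w)`; their root spaces are
  -- independent all the same, and the `ρ(w)` already exhaust `B⁺`
  decomp := by
    refine ⟨(hE.triangular.iSupIndep_rootSpace _ le_rfl).comp Subtype.val_injective,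
      le_antisymm (iSup_le fun _ => inf_le_left) ?_⟩
    refine hE.decomp.2.ge.trans (iSup_le fun w => ?_)
    refine le_iSup_of_le ⟨_, aut1_mem_Q1 hE.injective1 hE.injective w.2⟩ ?_
    exact (BpRoot1_aut1 hE.injective1 w.1).ge
  root_one := by
    rw [← map_one (aut0 hE.injective), BpRoot0_aut0, ofConv_one]
    exact hE.weight_one
  finite := by
    rw [Q0_toRTAData hE.injective]
    rintro _ ⟨w, hw, rfl⟩
    rw [BpRoot0_aut0]
    exact hE.finite w hw

/-- A converse of `IsHRTA.isRTA`: besides injectivity and positivity, the only information which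
the underlying regular triangular algebra lacks is that the weights of `H₁`, rather than all its
automorphisms, suffice to decompose `B⁺`. -/
theorem isHRTA_of_isRTA (h1 : Function.Injective E.incl1) (h0 : Function.Injective E.incl0)
    (hp : IsPositiveMonoid E.Q0) (hE : E.toRTAData.IsRTA)
    (hB : Subalgebra.toSubmodule E.Bp ≤
      ⨆ w : E.Q1, Subalgebra.toSubmodule E.Bp ⊓ adWeightSpace E.incl1 w) : E.IsHRTA where
  injective1 := h1
  injective0 := h0
  triangular := hE.triangular
  positive := hp
  decomp := by
    refine ⟨?_, le_antisymm (iSup_le fun _ => inf_le_left) hB⟩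
    have h := (hE.triangular.iSupIndep_rootSpace _ le_rfl).comp
      (f := fun w : E.Q1 => aut1 h1 (toConv w.1))
      ((rangeAut_injective h1).comp (WithConv.toConv_injective.comp Subtype.val_injective))
    have e : (fun w : E.Q1 => Subalgebra.toSubmodule E.Bp ⊓ adWeightSpace E.incl1 w) =
        fun w : E.Q1 => E.toRTAData.BpRoot1 (aut1 h1 (toConv w.1)) :=
      funext fun w => (BpRoot1_aut1 h1 w.1).symm
    rw [e]
    exact h
  weight_one := by
    have h : Function.Injective E.incl := h1.comp h0
    rw [← ofConv_one, ← BpRoot0_aut0 h, map_one]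
    exact hE.root_one
  finite w hw := by
    have h : Function.Injective E.incl := h1.comp h0
    rw [← BpRoot0_aut0 h]
    refine hE.finite _ ?_
    rw [Q0_toRTAData h]
    exact ⟨w, hw, rfl⟩

end HRTAData

end Underlying

/-! ### Tensor products of Hopf regular triangular algebras -/

theorem TriData.ext_of_eq {F A : Type u} [Field F] [Ring A] [Algebra F A] {T T' : TriData F A}
    (h1 : T.Bm = T'.Bm) (h2 : T.Bp = T'.Bp) (h3 : T.H1 = T'.H1) (h4 : T.H0 = T'.H0)
    (h5 : T.i = T'.i) : T = T' := by
  cases T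
  cases T'
  subst h1 h2 h3 h4 h5
  rfl

theorem RTAData.ext_of_eq {F A : Type u} [Field F] [Ring A] [Algebra F A] {D D' : RTAData F A}
    (h : D.toTriData = D'.toTriData)
    (hQ : ∀ θ θ', (∀ (x : D.H0) (x' : D'.H0), (x : A) = x' → (θ x : A) = θ' x') →
      (θ ∈ D.Q0 ↔ θ' ∈ D'.Q0)) : D = D' := by
  obtain ⟨T, Q⟩ := D
  obtain ⟨T', Q'⟩ := D'
  obtain rfl : T = T' := h
  congr 1
  ext θ
  exact hQ θ θ fun x x' h => by rw [Subtype.ext h]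

section PiHopf

open WithConv

variable {ι : Type} [Fintype ι] [DecidableEq ι] {F : Type u} [Field F] {K : ι → Type u}
  [∀ j, CommRing (K j)] [∀ j, HopfAlgebra F (K j)]

/-- The inclusion of a tensor factor, as a map of bialgebras. -/
def singleBialgHom (j : ι) : K j →ₐc[F] ⨂[F] j, K j :=
  BialgHom.ofAlgHom (PiTensorProduct.singleAlgHom j)
    (piLift_single (fun j => Bialgebra.counitAlgHom F (K j)) j) (piComul_single j).symm

/-- The character group of a tensor product is the product of the character groups. -/
def piWeightHom : (∀ j, WithConv (K j →ₐ[F] F)) →* WithConv ((⨂[F] j, K j) →ₐ[F] F) where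
  toFun w := toConv (piWeight fun j => (w j).ofConv)
  map_one' := by
    apply WithConv.ofConv_injective
    refine PiTensorProduct.algHom_ext fun j => AlgHom.ext fun x => ?_
    exact (piWeight_single _ j x).trans
      (DFunLike.congr_fun (congrArg ofConv
        (map_one (convComp (singleBialgHom (F := F) (K := K) j)))) x).symm
  map_mul' w w' := by
    apply WithConv.ofConv_injective
    refine PiTensorProduct.algHom_ext fun j => AlgHom.ext fun x => ?_
    have e : ∀ w : ∀ j, WithConv (K j →ₐ[F] F), convComp (singleBialgHom (F := F) (K := K) j)
        (toConv (piWeight fun j => (w j).ofConv)) = w j := fun w =>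
      WithConv.ofConv_injective (AlgHom.ext fun x => piWeight_single _ j x)
    refine (piWeight_single _ j x).trans ?_
    have h := map_mul (convComp (singleBialgHom (F := F) (K := K) j))
      (toConv (piWeight fun j => (w j).ofConv)) (toConv (piWeight fun j => (w' j).ofConv))
    rw [e, e] at h
    exact (DFunLike.congr_fun (congrArg ofConv h) x).symm

theorem convComp_piWeightHom (w : ∀ j, WithConv (K j →ₐ[F] F)) (j : ι) :
    convComp (singleBialgHom j) (piWeightHom w) = w j :=
  WithConv.ofConv_injective (AlgHom.ext fun x => piWeight_single _ j x)

theorem piWeightHom_injective : Function.Injective (piWeightHom (F := F) (K := K)) := by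
  intro w w' h
  funext j
  rw [← convComp_piWeightHom w, h, convComp_piWeightHom]

theorem piWeightHom_convComp (w : WithConv ((⨂[F] j, K j) →ₐ[F] F)) :
    piWeightHom (fun j => convComp (singleBialgHom j) w) = w := by
  apply WithConv.ofConv_injective
  refine PiTensorProduct.algHom_ext fun j => AlgHom.ext fun x => ?_
  exact piWeight_single _ j x

theorem rho_single (w : WithConv ((⨂[F] j, K j) →ₐ[F] F)) (j : ι) (x : K j) :
    rho w (PiTensorProduct.singleAlgHom j x) =
      PiTensorProduct.singleAlgHom (R := F) j (rho (convComp (singleBialgHom j) w) x) :=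
  rho_bialgHom (singleBialgHom j) w x

theorem rho_piWeightHom (w : ∀ j, WithConv (K j →ₐ[F] F)) :
    rho (piWeightHom w) = piMapAlgHom (F := F) (A := K) (B := K) fun j => rho (w j) := by
  refine PiTensorProduct.algHom_ext fun j => AlgHom.ext fun x => ?_
  refine (rho_single _ j x).trans ?_
  rw [convComp_piWeightHom]
  exact (piMapAlgHom_single (fun j => rho (w j)) j x).symm

variable {A : ι → Type u} [∀ j, Ring (A j)] [∀ j, Algebra F (A j)]

theorem range_piMapAlgHom {L : ι → Type u} [∀ j, Ring (L j)] [∀ j, Algebra F (L j)]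
    (f : ∀ j, L j →ₐ[F] A j) : (piMapAlgHom f).range = tensorSub fun j => (f j).range := by
  apply le_antisymm
  · rintro _ ⟨z, rfl⟩
    change piMapAlgHom f z ∈ _
    induction z using PiTensorProduct.induction_on with
    | smul_tprod r x =>
      rw [map_smul, piMapAlgHom_tprod]
      exact Subalgebra.smul_mem _ (mem_tensorSub.2 (tprod_mem_tprodSpan
        fun j => (f j).mem_range_self (x j))) r
    | add x y hx hy => rw [map_add]; exact Subalgebra.add_mem _ hx hy
  · refine iSup_le fun j => ?_
    rintro _ ⟨_, ⟨x, rfl⟩, rfl⟩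
    exact ⟨PiTensorProduct.singleAlgHom j x, piMapAlgHom_single f j x⟩

theorem tprod_mem_adWeightSpace {f : ∀ j, K j →ₐ[F] A j} {w : ∀ j, WithConv (K j →ₐ[F] F)}
    {x : ∀ j, A j} (hx : ∀ j, x j ∈ adWeightSpace (f j) (w j).ofConv) :
    PiTensorProduct.tprod F x ∈ adWeightSpace (piMapAlgHom f) (piWeightHom w).ofConv := by
  rw [mem_adWeightSpace_iff]
  intro z
  rw [rho_piWeightHom]
  induction z using PiTensorProduct.induction_on with
  | smul_tprod r y =>
    simp only [map_smul, piMapAlgHom_tprod, mul_smul_comm, smul_mul_assoc,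
      PiTensorProduct.tprod_mul_tprod]
    congr 2
    funext j
    exact mem_adWeightSpace_iff.1 (hx j) (y j)
  | add a b ha hb => simp only [map_add, mul_add, add_mul, ha, hb]

end PiHopf

section HopfTensor

open WithConv

variable {ι : Type} [Fintype ι] [DecidableEq ι] {F : Type u} [Field F]
  {A K1 K0 : ι → Type u} [∀ j, Ring (A j)] [∀ j, Algebra F (A j)] [∀ j, CommRing (K1 j)]
  [∀ j, HopfAlgebra F (K1 j)] [∀ j, CommRing (K0 j)] [∀ j, HopfAlgebra F (K0 j)]
  {E : ∀ j, HRTAData F (A j) (K1 j) (K0 j)}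

namespace HRTAData

theorem incl1_tensor : (HRTAData.tensor E).incl1 = piMapAlgHom fun j => (E j).incl1 := rfl

theorem incl0_tensor : ((HRTAData.tensor E).incl0 : (⨂[F] j, K0 j) →ₐ[F] ⨂[F] j, K1 j) =
    piMapAlgHom fun j => ((E j).incl0 : K0 j →ₐ[F] K1 j) := by
  refine PiTensorProduct.algHom_ext fun j => AlgHom.ext fun x => ?_
  exact (DFunLike.congr_fun (piLift_single (fun j => (PiTensorProduct.singleAlgHom j).comp
    ((E j).incl0 : K0 j →ₐ[F] K1 j)) j) x).trans (piMapAlgHom_single (fun j => ((E j).incl0 : K0 j →ₐ[F] K1 j)) j x).symm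

theorem incl_tensor : (HRTAData.tensor E).incl = piMapAlgHom fun j => (E j).incl := by
  refine PiTensorProduct.algHom_ext fun j => AlgHom.ext fun x => ?_
  change (HRTAData.tensor E).incl1 (((HRTAData.tensor E).incl0 :
    (⨂[F] j, K0 j) →ₐ[F] ⨂[F] j, K1 j) (PiTensorProduct.singleAlgHom j x)) =
    piMapAlgHom (fun j => (E j).incl) (PiTensorProduct.singleAlgHom j x)
  rw [incl0_tensor, piMapAlgHom_single, incl1_tensor, piMapAlgHom_single, piMapAlgHom_single]
  rfl

theorem incl_tensor_single (j : ι) (x : K0 j) :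
    (HRTAData.tensor E).incl (PiTensorProduct.singleAlgHom j x) =
      PiTensorProduct.singleAlgHom (R := F) j ((E j).incl x) := by
  rw [incl_tensor, piMapAlgHom_single]

theorem toTri_tensor : (HRTAData.tensor E).toTri = TriData.tensor fun j => (E j).toTri :=
  TriData.ext_of_eq rfl rfl (range_piMapAlgHom _)
    ((congrArg AlgHom.range incl_tensor).trans (range_piMapAlgHom _)) rfl

theorem Q0_tensor : (HRTAData.tensor E).Q0 = piWeightHom '' {w | ∀ j, w j ∈ (E j).Q0} := by
  ext w
  constructor
  · exact fun h => ⟨_, h, piWeightHom_convComp w⟩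
  · rintro ⟨w, hw, rfl⟩ j
    have := hw j
    rwa [← convComp_piWeightHom w j] at this

theorem coe_tensorIncl_aut0 {j : ι} (h : Function.Injective (E j).incl)
    (w : WithConv (K0 j →ₐ[F] F)) (x : K0 j) :
    (tensorIncl (fun j => (E j).toRTAData.H0) j (aut0 h w ((E j).incl.rangeRestrict x)) :
      ⨂[F] j, A j) = (HRTAData.tensor E).incl (PiTensorProduct.singleAlgHom j (rho w x)) := by
  rw [incl_tensor_single, ← coe_aut0_incl h]
  rfl

variable (hE : ∀ j, (E j).IsHRTA)
include hE

theorem toRTAData_tensor :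
    (HRTAData.tensor E).toRTAData = RTAData.tensor fun j => (E j).toRTAData := by
  refine RTAData.ext_of_eq toTri_tensor fun θ θ' h => ?_
  have hθ : ∀ (j : ι) (x : K0 j), (θ ((HRTAData.tensor E).incl.rangeRestrict
      (PiTensorProduct.singleAlgHom j x)) : ⨂[F] j, A j) =
      θ' (tensorIncl (fun j => (E j).toRTAData.H0) j ((E j).incl.rangeRestrict x)) := fun j x =>
    h _ _ (incl_tensor_single j x)
  constructor
  · rintro ⟨w, hw, e⟩
    refine ⟨fun j => aut0 (hE j).injective (convComp (singleBialgHom j) w), fun j => ⟨?_, ?_⟩⟩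
    · rw [Q0_toRTAData (hE j).injective]
      exact ⟨_, hw j, rfl⟩
    · intro x
      obtain ⟨x, rfl⟩ := (E j).incl.rangeRestrict_surjective x
      have e1 : (θ ((HRTAData.tensor E).incl.rangeRestrict
          (PiTensorProduct.singleAlgHom j x)) : ⨂[F] j, A j) =
          (HRTAData.tensor E).incl (rho w (PiTensorProduct.singleAlgHom j x)) :=
        congrArg Subtype.val (e (PiTensorProduct.singleAlgHom j x))
      rw [hθ, rho_single, ← coe_tensorIncl_aut0 (hE j).injective] at e1
      exact Subtype.ext e1
  · rintro ⟨θ'', h'⟩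
    choose h1 h2 using h'
    choose w hw hθ' using h1
    refine ⟨piWeightHom w, by rw [Q0_tensor]; exact ⟨w, hw, rfl⟩, fun z => ?_⟩
    have key : (((HRTAData.tensor E).toTri.H0.val.comp θ.toAlgHom).comp
        (HRTAData.tensor E).incl.rangeRestrict) =
        (HRTAData.tensor E).incl.comp (rho (piWeightHom w)) := by
      refine PiTensorProduct.algHom_ext fun j => AlgHom.ext fun x => ?_
      have e1 : (θ' (tensorIncl (fun j => (E j).toRTAData.H0) j ((E j).incl.rangeRestrict x)) :
          ⨂[F] j, A j) = tensorIncl (fun j => (E j).toRTAData.H0) j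
            (aut0 (hE j).injective (w j) ((E j).incl.rangeRestrict x)) := by
        have e2 : θ'' j = aut0 (hE j).injective (w j) := (rangeAut_eq_iff _).2 (hθ' j)
        rw [← e2]
        exact congrArg Subtype.val (h2 j _)
      rw [← hθ, coe_tensorIncl_aut0] at e1
      change _ = (HRTAData.tensor E).incl (rho (piWeightHom w) (PiTensorProduct.singleAlgHom j x))
      rw [rho_single, convComp_piWeightHom]
      exact e1
    exact Subtype.ext (DFunLike.congr_fun key z)

theorem isHRTA_tensor : (HRTAData.tensor E).IsHRTA := by
  refine isHRTA_of_isRTA ?_ ?_ ?_ ?_ ?_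
  · exact piTensorProduct_map_injective (fun j => (E j).incl1.toLinearMap) fun j =>
      (hE j).injective1
  · have h : Function.Injective (piMapAlgHom fun j => ((E j).incl0 : K0 j →ₐ[F] K1 j)) :=
      piTensorProduct_map_injective (fun j => ((E j).incl0 : K0 j →ₐ[F] K1 j).toLinearMap)
        fun j => (hE j).injective0
    rw [← incl0_tensor] at h
    exact h
  · rw [Q0_tensor]
    exact isPositiveMonoid_image (piWeightHom_injective (F := F) (K := K0)) fun j => (hE j).positive
  · rw [toRTAData_tensor hE]
    exact isRTA_tensor fun j => (hE j).isRTA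
  · refine (toSubmodule_tensorSub _).le.trans ((tprodSpan_le_iSup
      (fun j (w : (E j).Q1) => Subalgebra.toSubmodule (E j).Bp ⊓ adWeightSpace (E j).incl1 w)
      fun j => (hE j).decomp.2.ge).trans ?_)
    refine iSup_le fun p => ?_
    have hQ : (piWeightHom fun j => toConv (p j).1).ofConv ∈ (HRTAData.tensor E).Q1 := by
      intro j
      have h := (p j).2
      suffices e : ((piWeightHom fun j => toConv (p j).1).ofConv.comp
          ((HRTAData.tensor E).incl0 : (⨂[F] j, K0 j) →ₐ[F] ⨂[F] j, K1 j)).comp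
          (PiTensorProduct.singleAlgHom j) = (p j).1.comp ((E j).incl0 : K0 j →ₐ[F] K1 j) by
        change toConv (((piWeightHom fun j => toConv (p j).1).ofConv.comp
          ((HRTAData.tensor E).incl0 : (⨂[F] j, K0 j) →ₐ[F] ⨂[F] j, K1 j)).comp
          (PiTensorProduct.singleAlgHom j)) ∈ (E j).Q0
        rw [e]
        exact h
      ext x
      refine (congrArg (piWeight fun j => (p j).1) (DFunLike.congr_fun (incl0_tensor (E := E))
        (PiTensorProduct.singleAlgHom j x))).trans ?_
      rw [piMapAlgHom_single, piWeight_single]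
      rfl
    refine le_iSup_of_le ⟨_, hQ⟩ (Submodule.span_le.2 ?_)
    rintro _ ⟨x, hx, rfl⟩
    exact ⟨mem_tensorSub.2 (tprod_mem_tprodSpan fun j => (hx j).1),
      tprod_mem_adWeightSpace (w := fun j => toConv (p j).1) fun j => (hx j).2⟩

theorem isStrict_tensor_iff : (HRTAData.tensor E).IsStrict ↔ ∀ j, (E j).IsStrict := by
  have := fun j => (hE j).triangular.nontrivial
  rw [IsStrict, toTri_tensor]
  exact tensorSub_eq_iff

theorem isBased_tensor_iff : (HRTAData.tensor E).IsBased ↔ ∀ j, (E j).IsBased := by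
  rw [IsBased, Q0_tensor]
  exact isBasedMonoid_image_iff (piWeightHom_injective (F := F) (K := K0)) fun j => (hE j).positive

theorem isDiscretelyGraded_tensor_iff :
    (HRTAData.tensor E).IsDiscretelyGraded ↔ ∀ j, (E j).IsDiscretelyGraded := by
  rw [IsDiscretelyGraded, Q0_tensor]
  exact isDiscreteMonoid_image_iff (piWeightHom_injective (F := F) (K := K0)) fun j => (hE j).positive

end HRTAData

end HopfTensor

end

end RTAlg

open RTAlg in
theorem mainTheorem2 {F : Type u} [Field F] {n : ℕ} (A : Fin n → Type u) [∀ j, Ring (A j)]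
    [∀ j, Algebra F (A j)] :
    -- the statement for regular triangular algebras
    (∀ D : ∀ j, RTAData F (A j), (∀ j, (D j).IsRTA) →
      -- the tensor product is again an RTA; strictness, basedness, discrete grading
      ((RTAData.tensor D).IsRTA ∧
        ((RTAData.tensor D).IsStrict ↔ ∀ j, (D j).IsStrict) ∧
        ((RTAData.tensor D).IsBased ↔ ∀ j, (D j).IsBased) ∧
        ((RTAData.tensor D).IsDiscretelyGraded ↔ ∀ j, (D j).IsDiscretelyGraded)) ∧
      -- simple objects, and uniqueness of the tensor factors
      (∀ (V : Type u) [AddCommGroup V] [Module F V] [Module (⨂[F] j, A j) V]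
        [IsScalarTower F (⨂[F] j, A j) V],
        ((RTAData.tensor D).InOFree V ∧ IsSimpleModule (⨂[F] j, A j) V) ↔
          ∃ (W : Fin n → Type u) (_ : ∀ j, AddCommGroup (W j)) (_ : ∀ j, Module F (W j))
            (_ : ∀ j, Module (A j) (W j)) (_ : ∀ j, IsScalarTower F (A j) (W j)),
            (∀ j, (D j).InOFree (W j) ∧ IsSimpleModule (A j) (W j)) ∧
              IsTensorModule F A W V) ∧
      (∀ (V : Type u) [AddCommGroup V] [Module F V] [Module (⨂[F] j, A j) V]
        [IsScalarTower F (⨂[F] j, A j) V]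
        (W W' : Fin n → Type u) [∀ j, AddCommGroup (W j)] [∀ j, Module F (W j)]
        [∀ j, Module (A j) (W j)] [∀ j, IsScalarTower F (A j) (W j)]
        [∀ j, AddCommGroup (W' j)] [∀ j, Module F (W' j)]
        [∀ j, Module (A j) (W' j)] [∀ j, IsScalarTower F (A j) (W' j)],
        (∀ j, (D j).InOFree (W j) ∧ IsSimpleModule (A j) (W j)) →
        (∀ j, (D j).InOFree (W' j) ∧ IsSimpleModule (A j) (W' j)) →
        IsTensorModule F A W V → IsTensorModule F A W' V →
        ∀ j, Nonempty (W j ≃ₗ[A j] W' j)) ∧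
      -- the S-sets; weights of the tensor product are tuples of weights
      (Function.Bijective (RTAData.comp1 D) ∧ Function.Bijective (RTAData.comp0 D) ∧
        (RTAData.tensor D).free1 = {w | ∀ j, RTAData.comp1 D w j ∈ (D j).free1} ∧
        (∀ w ∈ (RTAData.tensor D).free1,
          (RTAData.tensor D).S1 w =
            {v | ∀ j, RTAData.comp0 D v j ∈ (D j).S1 (RTAData.comp1 D w j)} ∧
          (RTAData.tensor D).S2 w =
            {v | ∀ j, RTAData.comp0 D v j ∈ (D j).S2 (RTAData.comp1 D w j)} ∧
          (RTAData.tensor D).S3 w =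
            {v | ∀ j, RTAData.comp1 D v j ∈ (D j).S3 (RTAData.comp1 D w j)} ∧
          (RTAData.tensor D).S4 w =
            {v | ∀ j, RTAData.comp1 D v j ∈ (D j).S4 (RTAData.comp1 D w j)}) ∧
        (RTAData.tensor D).S1A = {w | ∀ j, RTAData.comp1 D w j ∈ (D j).S1A} ∧
        (RTAData.tensor D).S2A = {w | ∀ j, RTAData.comp1 D w j ∈ (D j).S2A} ∧
        (RTAData.tensor D).S3A = {w | ∀ j, RTAData.comp1 D w j ∈ (D j).S3A} ∧
        (RTAData.tensor D).S4A = {w | ∀ j, RTAData.comp1 D w j ∈ (D j).S4A} ∧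
        (RTAData.tensor D).S2barA = {w | ∀ j, RTAData.comp1 D w j ∈ (D j).S2barA}) ∧
      ((∀ j, (D j).free1.Nonempty) →
        ((RTAData.tensor D).CondS1 ↔ ∀ j, (D j).CondS1) ∧
        ((RTAData.tensor D).CondS2 ↔ ∀ j, (D j).CondS2) ∧
        ((RTAData.tensor D).CondS3 ↔ ∀ j, (D j).CondS3) ∧
        ((RTAData.tensor D).CondS4 ↔ ∀ j, (D j).CondS4)) ∧
      -- complete reducibility of finite-dimensional modules
      ((∀ j, (D j).CompletelyReducible) → (RTAData.tensor D).CompletelyReducible) ∧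
      ((∀ j, ∃ w ∈ (D j).free1, FiniteDimensional F ((D j).Simple w)) →
        ((RTAData.tensor D).CompletelyReducible ↔ ∀ j, (D j).CompletelyReducible))) ∧
    -- the statement for Hopf regular triangular algebras; by the last two clauses the underlying
    -- data are RTAs, compatibly with tensor products, so that all of the above applies to them
    (∀ (K1 K0 : Fin n → Type u) [∀ j, CommRing (K1 j)] [∀ j, HopfAlgebra F (K1 j)]
      [∀ j, CommRing (K0 j)] [∀ j, HopfAlgebra F (K0 j)]
      (E : ∀ j, HRTAData F (A j) (K1 j) (K0 j)), (∀ j, (E j).IsHRTA) →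
      (HRTAData.tensor E).IsHRTA ∧
      ((HRTAData.tensor E).IsStrict ↔ ∀ j, (E j).IsStrict) ∧
      ((HRTAData.tensor E).IsBased ↔ ∀ j, (E j).IsBased) ∧
      ((HRTAData.tensor E).IsDiscretelyGraded ↔ ∀ j, (E j).IsDiscretelyGraded) ∧
      (∀ j, (E j).toRTAData.IsRTA) ∧
      (HRTAData.tensor E).toRTAData = RTAData.tensor fun j => (E j).toRTAData) := by
  refine ⟨fun D hD => ⟨⟨isRTA_tensor hD, isStrict_tensor_iff hD, isBased_tensor_iff hD,
    isDiscretelyGraded_tensor_iff hD⟩, fun V _ _ _ _ => inOFree_and_isSimpleModule_iff hD V, ?_,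
    ⟨comp1_bijective, comp0_bijective, free1_tensor hD, fun w hw =>
      ⟨Set.ext fun _ => mem_S1_tensor_iff hD hw, Set.ext fun _ => mem_S2_tensor_iff hD hw,
        Set.ext fun _ => mem_S3_tensor_iff hD hw, Set.ext fun _ => mem_S4_tensor_iff hD⟩,
      S1A_tensor hD, S2A_tensor hD, S3A_tensor hD, S4A_tensor hD, S2barA_tensor hD⟩,
    fun hne => ⟨condS1_tensor_iff hD hne, condS2_tensor_iff hD hne, condS3_tensor_iff hD hne,
      condS4_tensor_iff hD hne⟩,
    completelyReducible_tensor hD, fun hμ =>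
      ⟨completelyReducible_of_tensor hD hμ, completelyReducible_tensor hD⟩⟩,
    fun K1 K0 _ _ _ _ E hE => ⟨HRTAData.isHRTA_tensor hE, HRTAData.isStrict_tensor_iff hE,
      HRTAData.isBased_tensor_iff hE, HRTAData.isDiscretelyGraded_tensor_iff hE,
      fun j => (hE j).isRTA, HRTAData.toRTAData_tensor hE⟩⟩
  intro V _ _ _ _ W W' _ _ _ _ _ _ _ _ hW hW' h h' j
  obtain ⟨e⟩ := isTensorModule_iff.1 h
  obtain ⟨e'⟩ := isTensorModule_iff.1 h'
  have := fun j => (hW j).2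
  have := fun j => (hW' j).2
  exact nonempty_equiv_of_tensor_equiv (e.trans e'.symm) j
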